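/- **Setting.** Let $V=V_0\oplus V_1$ be a finite-dimensional real supervector space of dimension $(m,n)$, with a symplectic form $B$: a non-degenerate, even, skew-supersymmetric bilinear form (so $B|_{V_0}$ is symplectic, $B|_{V_1}$ is symmetric non-degenerate of any signature, and $B(V_0,V_1)=0$; in particular $m=2r$ is even). Assume that $n=\dim V_1$ is even, and that $V$ is oriented: fix a symplectic basis of $V_0$ with dual coordinates $x^1,\dots,x^m$, and a basis $\xi^1,\dots,\xi^n$ of $V_1^*\otimes\mathbb C$ dual to an orthonormal basis of $V_1\otimes\mathbb C$ whose elements lie in $V_1\cup iV_1$. The Liouville–Berezin integral is $$\int_V d_V(v)\,\phi(v)=(2\pi)^{-m/2}\int_{V_0}|dx^1\cdots dx^m|\ \Big(\tfrac{\partial}{\partial \xi^1}\cdots\tfrac{\partial}{\partial \xi^n}\phi\Big)\Big|_{\xi=0}.$$ Let $\mathfrak{spo}(V)$ be the Lie superalgebra of endomorphisms $X$ of $V$ with $B(Xv,w)+(-1)^{p(X)p(v)}B(v,Xw)=0$, and let $S(\mathfrak{spo}(V))=S(\mathfrak{spo}(V)_0)\otimes\Lambda(\mathfrak{spo}(V)_1)$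 be its symmetric superalgebra, $S^k(\mathfrak{spo}(V))$ its component of degree $k$. Put $\mu(X,v)=-\tfrac12B(v,Xv)$, and let $\check\mu:S(\mathfrak{spo}(V))\to S(V^*)$ be the morphism of superalgebras with $\check\mu(X)(v)=\mu(X,v)$ for $X\in\mathfrak{spo}(V)$. Let $\mathcal V^+=\{X\in\mathfrak{spo}(V)_0 : B(v,Xv)>0\text{ for all }v\in V_0\setminus\{0\}\}$, an open set, and $C^\infty_{\mathfrak{spo}(V)}(\mathcal V^+,\mathbb C)=C^\infty(\mathcal V^+,\mathbb C)\otimes\Lambda(\mathfrak{spo}(V)_1^*)$. For homogeneous $X\in\mathfrak{spo}(V)$ let $\partial_X$ be the superderivation of $C^\infty_{\mathfrak{spo}(V)}(\mathcal V^+,\mathbb C)$ with $\partial_X\psi=(-1)^{p(X)p(\psi)}\psi(X)$ for homogeneous $\psi\in\mathfrak{spo}(V)^*$, and let $D\mapsto\partial_D$ be the extension of $X\mapsto\partial_X$ to an algebra morphism from $S(\mathfrak{spo}(V))$ to differential operators with constant coefficients. Let $K(X,Y)=\operatorname{str}(XY)$ on $\mathfrak{spo}(V)$, and, for bases $(X_i)$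 and $(X_i')$ of $\mathfrak{spo}(V)$ with $K(X_i,X'_j)=\delta_{ij}$, put $\square_K=\sum_i\partial_{X'_i}\partial_{X_i}$. **Statement.** There is a unique $\operatorname{Spf}\in C^\infty_{\mathfrak{spo}(V)}(\mathcal V^+,\mathbb C)$ whose value at the generic point $X$ over $\mathcal V^+$ (that is, $X=X_0+\Xi$ with $X_0\in\mathcal V^+$ and $\Xi$ the generic point of $\mathfrak{spo}(V)_1$) is the convergent integral $$\operatorname{Spf}(X)=\int_V d_V(v)\,\exp\big(-\tfrac12B(v,Xv)\big),$$ and it satisfies: 1. $\partial_D\operatorname{Spf}=0$ for every $D\in\ker(\check\mu)\subset S(\mathfrak{spo}(V))$. 2. If $\dim V_0>0$, then $\partial_D\operatorname{Spf}=0$ for every $D\in\bigoplus_{k\ge1}S^k(\mathfrak{spo}(V))^{\mathfrak{spo}(V)}$. 3. If $V=V_1$, $k\ge1$ and $D\in S^k(\mathfrak{so}(V))^{\mathfrak{so}(V)}$, then $\partial_D\operatorname{Spf}=0$ whenever $k\ne\frac{\dim V}{2}$ or $D$ is $O(V)$-invariant. 4. In all cases, $\square_K\operatorname{Spf}=0$.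 -/

import Mathlib

open scoped TensorProduct ContDiff
open Module

noncomputable section

set_option linter.unusedSectionVars false

namespace SuperPfaffian

/-! ### The symmetric algebra of a supervector space -/

/-- The symmetric algebra `S(W) = S(W₀) ⊗ Λ(W₁)` of a real supervector space `W = W₀ ⊕ W₁`. -/
def SuperSym (W₀ W₁ : Type*) [AddCommGroup W₀] [Module ℝ W₀] [AddCommGroup W₁] [Module ℝ W₁] :
    Type _ :=
  SymmetricAlgebra ℝ W₀ ⊗[ℝ] ExteriorAlgebra ℝ W₁

instance (W₀ W₁ : Type*) [AddCommGroup W₀] [Module ℝ W₀] [AddCommGroup W₁] [Module ℝ W₁] :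
    Ring (SuperSym W₀ W₁) :=
  inferInstanceAs (Ring (SymmetricAlgebra ℝ W₀ ⊗[ℝ] ExteriorAlgebra ℝ W₁))

instance (W₀ W₁ : Type*) [AddCommGroup W₀] [Module ℝ W₀] [AddCommGroup W₁] [Module ℝ W₁] :
    Algebra ℝ (SuperSym W₀ W₁) :=
  inferInstanceAs (Algebra ℝ (SymmetricAlgebra ℝ W₀ ⊗[ℝ] ExteriorAlgebra ℝ W₁))

/-- Extension of a linear map with pairwise commuting values in a (not necessarily commutative)
algebra to the symmetric algebra. -/
def symLift {W A : Type*} [AddCommGroup W] [Module ℝ W] [Ring A] [Algebra ℝ A]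
    (f : W →ₗ[ℝ] A) (hf : ∀ x y, Commute (f x) (f y)) : SymmetricAlgebra ℝ W →ₐ[ℝ] A :=
  letI : CommSemiring (Algebra.adjoin ℝ (Set.range f)) :=
    { (Algebra.adjoin ℝ (Set.range f)).toSemiring with
      mul_comm := (Algebra.isMulCommutative_adjoin ℝ (s := Set.range f) (by
        rintro _ ⟨x, rfl⟩ _ ⟨y, rfl⟩
        exact hf x y)).is_comm.comm }
  let g : W →ₗ[ℝ] Algebra.adjoin ℝ (Set.range f) :=
    f.codRestrict (Subalgebra.toSubmodule (Algebra.adjoin ℝ (Set.range f)))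
      fun x => Algebra.subset_adjoin ⟨x, rfl⟩
  (Algebra.adjoin ℝ (Set.range f)).val.comp
    (SymmetricAlgebra.lift (A := Algebra.adjoin ℝ (Set.range f)) g)

theorem symLift_ι {W A : Type*} [AddCommGroup W] [Module ℝ W] [Ring A] [Algebra ℝ A]
    (f : W →ₗ[ℝ] A) (hf : ∀ x y, Commute (f x) (f y)) (w : W) :
    symLift f hf (SymmetricAlgebra.ι ℝ W w) = f w := by
  simp only [symLift, AlgHom.comp_apply, SymmetricAlgebra.lift_ι_apply]
  rfl

namespace SuperSym

variable {W₀ W₁ A : Type*} [AddCommGroup W₀] [Module ℝ W₀] [AddCommGroup W₁] [Module ℝ W₁]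
  [Ring A] [Algebra ℝ A]

/-- `S(W)` is the algebra `S(W₀) ⊗ Λ(W₁)`. -/
def equivTensor (W₀ W₁ : Type*) [AddCommGroup W₀] [Module ℝ W₀] [AddCommGroup W₁] [Module ℝ W₁] :
    SuperSym W₀ W₁ ≃ₐ[ℝ] SymmetricAlgebra ℝ W₀ ⊗[ℝ] ExteriorAlgebra ℝ W₁ :=
  AlgEquiv.refl

/-- The inclusion of `S(W₀)` in `S(W)`. -/
def inl : SymmetricAlgebra ℝ W₀ →ₐ[ℝ] SuperSym W₀ W₁ :=
  (equivTensor W₀ W₁).symm.toAlgHom.comp Algebra.TensorProduct.includeLeft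

/-- The inclusion of `Λ(W₁)` in `S(W)`. -/
def inr : ExteriorAlgebra ℝ W₁ →ₐ[ℝ] SuperSym W₀ W₁ :=
  (equivTensor W₀ W₁).symm.toAlgHom.comp Algebra.TensorProduct.includeRight

theorem inl_mul_inr (a : SymmetricAlgebra ℝ W₀) (b : ExteriorAlgebra ℝ W₁) :
    (inl a : SuperSym W₀ W₁) * inr b = (equivTensor W₀ W₁).symm (a ⊗ₜ b) := by
  simp [inl, inr, ← map_mul]

theorem inl_commute_inr (a : SymmetricAlgebra ℝ W₀) (b : ExteriorAlgebra ℝ W₁) :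
    Commute (inl a : SuperSym W₀ W₁) (inr b) := by
  simp [inl, inr, commute_iff_eq, ← map_mul]

theorem induction_on {p : SuperSym W₀ W₁ → Prop} (x : SuperSym W₀ W₁) (zero : p 0)
    (add : ∀ x y, p x → p y → p (x + y)) (mul : ∀ a b, p (inl a * inr b)) : p x := by
  obtain ⟨x, rfl⟩ := (equivTensor W₀ W₁).symm.surjective x
  induction x using TensorProduct.induction_on with
  | zero => rw [map_zero]; exact zero
  | tmul a b => rw [← inl_mul_inr]; exact mul a b
  | add a b ha hb => rw [map_add]; exact add _ _ ha hb

/-- The inclusion of `W₀` in `S(W)`. -/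
def ι₀ : W₀ →ₗ[ℝ] SuperSym W₀ W₁ := inl.toLinearMap ∘ₗ SymmetricAlgebra.ι ℝ W₀

/-- The inclusion of `W₁` in `S(W)`. -/
def ι₁ : W₁ →ₗ[ℝ] SuperSym W₀ W₁ := inr.toLinearMap ∘ₗ ExteriorAlgebra.ι ℝ

/-- The inclusion of `W = W₀ ⊕ W₁` in `S(W)`. -/
def ι : W₀ × W₁ →ₗ[ℝ] SuperSym W₀ W₁ := LinearMap.coprod ι₀ ι₁

/-- `S^k(W)`, the span of the products of `k` elements of `W`. -/
def homogeneous (W₀ W₁ : Type*) [AddCommGroup W₀] [Module ℝ W₀] [AddCommGroup W₁] [Module ℝ W₁]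
    (k : ℕ) : Submodule ℝ (SuperSym W₀ W₁) :=
  LinearMap.range (ι : W₀ × W₁ →ₗ[ℝ] SuperSym W₀ W₁) ^ k

theorem ι₀_commute (y : W₀) (x : SuperSym W₀ W₁) : Commute (ι₀ y) x := by
  induction x using induction_on with
  | zero => exact Commute.zero_right _
  | add a b ha hb => exact ha.add_right hb
  | mul a b =>
    refine Commute.mul_right ?_ (inl_commute_inr _ _)
    exact (Commute.all (SymmetricAlgebra.ι ℝ W₀ y) a).map inl

theorem ι₁_sq (z : W₁) : (ι₁ z : SuperSym W₀ W₁) * ι₁ z = 0 := by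
  simp only [ι₁, LinearMap.comp_apply, AlgHom.toLinearMap_apply, ← map_mul,
    ExteriorAlgebra.ι_sq_zero, map_zero]

theorem ι₁_anticomm (z w : W₁) : (ι₁ z : SuperSym W₀ W₁) * ι₁ w + ι₁ w * ι₁ z = 0 := by
  have h := ι₁_sq (W₀ := W₀) (z + w)
  simp only [map_add, add_mul, mul_add, ι₁_sq, zero_add, add_zero] at h
  rw [add_comm]
  exact h

theorem anticomm_aux {z w u : A} (h1 : w * u + u * w = 0) (h2 : z * u + u * z = 0) :
    Commute (z * w) u := by
  rw [commute_iff_eq, mul_assoc, eq_neg_of_add_eq_zero_left h1, mul_neg, ← mul_assoc,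
    eq_neg_of_add_eq_zero_left h2, neg_mul, neg_neg, mul_assoc]

theorem mul_neg_aux (x : A) {z w : A} (h : z * w + w * z = 0) : x * (z * w) = -(x * (w * z)) := by
  rw [eq_neg_of_add_eq_zero_left h, mul_neg]

theorem ι₁_mul_commute (z w : W₁) (x : SuperSym W₀ W₁) : Commute (ι₁ z * ι₁ w) x := by
  induction x using induction_on with
  | zero => exact Commute.zero_right _
  | add a b ha hb => exact ha.add_right hb
  | mul a b =>
    refine Commute.mul_right
      (((inl_commute_inr a _).symm).mul_left ((inl_commute_inr a _).symm)) ?_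
    induction b using ExteriorAlgebra.induction with
    | algebraMap r => rw [AlgHom.commutes]; exact Algebra.commute_algebraMap_right _ _
    | ι u => exact anticomm_aux (ι₁_anticomm w u) (ι₁_anticomm z u)
    | mul c d hc hd => rw [map_mul]; exact hc.mul_right hd
    | add c d hc hd => rw [map_add]; exact hc.add_right hd

/-- Universal property of `S(W)`: linear maps on `W₀` and `W₁` whose values satisfy the
(super)commutation relations extend to an algebra morphism. -/
def lift (f : W₀ →ₗ[ℝ] A) (g : W₁ →ₗ[ℝ] A) (hf : ∀ x y, Commute (f x) (f y))
    (hg : ∀ z, g z * g z = 0) (hfg : ∀ y z, Commute (f y) (g z)) : SuperSym W₀ W₁ →ₐ[ℝ] A :=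
  AlgHom.comp (Algebra.TensorProduct.lift (symLift f hf) (ExteriorAlgebra.lift ℝ ⟨g, hg⟩) (by
    intro x y
    induction x using SymmetricAlgebra.induction with
    | algebraMap r => rw [AlgHom.commutes]; exact Algebra.commute_algebraMap_left _ _
    | mul a b ha hb => rw [map_mul]; exact ha.mul_left hb
    | add a b ha hb => rw [map_add]; exact ha.add_left hb
    | ι w =>
      rw [symLift_ι]
      induction y using ExteriorAlgebra.induction with
      | algebraMap r => rw [AlgHom.commutes]; exact Algebra.commute_algebraMap_right _ _
      | mul a b ha hb => rw [map_mul]; exact ha.mul_right hb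
      | add a b ha hb => rw [map_add]; exact ha.add_right hb
      | ι u => rw [ExteriorAlgebra.lift_ι_apply]; exact hfg w u))
    (equivTensor W₀ W₁).toAlgHom

theorem lift_ι₀ (f : W₀ →ₗ[ℝ] A) (g : W₁ →ₗ[ℝ] A) (hf hg hfg) (y : W₀) :
    lift f g hf hg hfg (ι₀ y) = f y := by
  simp [lift, ι₀, inl, symLift_ι]

theorem lift_ι₁ (f : W₀ →ₗ[ℝ] A) (g : W₁ →ₗ[ℝ] A) (hf hg hfg) (z : W₁) :
    lift f g hf hg hfg (ι₁ z) = g z := by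
  simp [lift, ι₁, inr]

/-- The algebra morphism `S(W) → S(W)` induced by an even linear map. -/
def map (a : W₀ →ₗ[ℝ] W₀) (b : W₁ →ₗ[ℝ] W₁) : SuperSym W₀ W₁ →ₐ[ℝ] SuperSym W₀ W₁ :=
  lift (ι₀ ∘ₗ a) (ι₁ ∘ₗ b) (fun _ _ => ι₀_commute _ _) (fun _ => ι₁_sq _)
    (fun _ _ => ι₀_commute _ _)

/-- The linear map `x ↦ !![p, q; 0, r]` with entries depending linearly on `x`. -/
def upper {W : Type*} [AddCommGroup W] [Module ℝ W] (p q r : W →ₗ[ℝ] A) :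
    W →ₗ[ℝ] Matrix (Fin 2) (Fin 2) A where
  toFun x := !![p x, q x; 0, r x]
  map_add' x y := by ext i j; fin_cases i <;> fin_cases j <;> simp
  map_smul' c x := by ext i j; fin_cases i <;> fin_cases j <;> simp

theorem upper_commute {W W' : Type*} [AddCommGroup W] [Module ℝ W] [AddCommGroup W'] [Module ℝ W']
    (p q r : W →ₗ[ℝ] A) (p' q' r' : W' →ₗ[ℝ] A) (x : W) (y : W')
    (h1 : p x * p' y = p' y * p x) (h2 : r x * r' y = r' y * r x)
    (h3 : p x * q' y + q x * r' y = p' y * q x + q' y * r x) :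
    Commute (upper p q r x) (upper p' q' r' y) := by
  rw [commute_iff_eq]
  ext i j
  fin_cases i <;> fin_cases j <;> simp [upper, Matrix.mul_apply, Fin.sum_univ_two, h1, h2, h3]

theorem upper_sq {W : Type*} [AddCommGroup W] [Module ℝ W] (p q r : W →ₗ[ℝ] A) (x : W)
    (h1 : p x * p x = 0) (h2 : r x * r x = 0) (h3 : p x * q x + q x * r x = 0) :
    upper p q r x * upper p q r x = 0 := by
  ext i j
  fin_cases i <;> fin_cases j <;> simp [upper, Matrix.mul_apply, Fin.sum_univ_two, h1, h2, h3]

/-- The algebra morphism `x ↦ !![x, δ x; 0, x]`, where `δ` is the derivation of `S(W)` extending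
the even linear map `(a, b)`. -/
def evenDerMatrix (a : W₀ →ₗ[ℝ] W₀) (b : W₁ →ₗ[ℝ] W₁) :
    SuperSym W₀ W₁ →ₐ[ℝ] Matrix (Fin 2) (Fin 2) (SuperSym W₀ W₁) :=
  lift (upper ι₀ (ι₀ ∘ₗ a) ι₀) (upper ι₁ (ι₁ ∘ₗ b) ι₁)
    (fun x y => upper_commute _ _ _ _ _ _ _ _ (ι₀_commute _ _) (ι₀_commute _ _) (by
      simp only [LinearMap.comp_apply]
      rw [(ι₀_commute x _).eq, (ι₀_commute (a x) _).eq, add_comm]))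
    (fun z => upper_sq _ _ _ _ (ι₁_sq z) (ι₁_sq z) (ι₁_anticomm _ _))
    (fun y z => upper_commute _ _ _ _ _ _ _ _ (ι₀_commute _ _) (ι₀_commute _ _) (by
      simp only [LinearMap.comp_apply]
      rw [(ι₀_commute y _).eq, (ι₀_commute (a y) _).eq, add_comm]))

/-- The derivation of `S(W)` that extends the even linear map `(a, b)` of `W = W₀ ⊕ W₁`. -/
def evenDer (a : W₀ →ₗ[ℝ] W₀) (b : W₁ →ₗ[ℝ] W₁) : SuperSym W₀ W₁ →ₗ[ℝ] SuperSym W₀ W₁ where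
  toFun x := evenDerMatrix a b x 0 1
  map_add' x y := by simp
  map_smul' c x := by simp

/-- The algebra morphism `x ↦ !![σ x, δ x; 0, x]`, where `σ` is the parity automorphism and `δ` is
the odd superderivation of `S(W)` extending the odd linear map `(a, b)`. -/
def oddDerMatrix (a : W₀ →ₗ[ℝ] W₁) (b : W₁ →ₗ[ℝ] W₀) :
    SuperSym W₀ W₁ →ₐ[ℝ] Matrix (Fin 2) (Fin 2) (SuperSym W₀ W₁) :=
  lift (upper ι₀ (ι₁ ∘ₗ a) ι₀) (upper ((-1 : ℝ) • ι₁) (ι₀ ∘ₗ b) ι₁)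
    (fun x y => upper_commute _ _ _ _ _ _ _ _ (ι₀_commute _ _) (ι₀_commute _ _) (by
      simp only [LinearMap.comp_apply]
      rw [(ι₀_commute x _).eq, (ι₀_commute y _).eq, add_comm]))
    (fun z => upper_sq _ _ _ _ (by
        rw [LinearMap.smul_apply, smul_mul_smul_comm, ι₁_sq, smul_zero]) (ι₁_sq z) (by
      simp only [LinearMap.comp_apply, LinearMap.smul_apply, smul_mul_assoc]
      rw [(ι₀_commute (b z) _).eq]
      module))
    (fun y z => upper_commute _ _ _ _ _ _ _ _ (ι₀_commute _ _) (ι₀_commute _ _) (by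
      simp only [LinearMap.comp_apply, LinearMap.smul_apply, smul_mul_assoc]
      rw [(ι₀_commute y _).eq]
      have h := ι₁_anticomm (W₀ := W₀) (a y) z
      rw [neg_one_smul, ← sub_eq_neg_add, eq_sub_iff_add_eq, add_assoc, h, add_zero]))

/-- The odd superderivation `δ` of `S(W)`, `δ(xy) = δ(x) y + (-1)^{p(x)} x δ(y)`, that extends the
odd linear map of `W = W₀ ⊕ W₁` given by `a : W₀ → W₁` and `b : W₁ → W₀`. -/
def oddDer (a : W₀ →ₗ[ℝ] W₁) (b : W₁ →ₗ[ℝ] W₀) : SuperSym W₀ W₁ →ₗ[ℝ] SuperSym W₀ W₁ where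
  toFun x := oddDerMatrix a b x 0 1
  map_add' x y := by simp
  map_smul' c x := by simp

end SuperSym

/-! ### Symplectic supervector spaces and the Lie superalgebra `spo(V)` -/

variable {V₀ V₁ : Type*} [AddCommGroup V₀] [Module ℝ V₀] [FiniteDimensional ℝ V₀]
  [AddCommGroup V₁] [Module ℝ V₁] [FiniteDimensional ℝ V₁]

/-- A symplectic form on the supervector space `V = V₀ ⊕ V₁`: a non degenerate even skew symmetric
bilinear form, i.e. a symplectic form on `V₀` and a non degenerate symmetric form on `V₁`, with
`V₀` and `V₁` orthogonal. -/
structure SymplecticForm (V₀ V₁ : Type*) [AddCommGroup V₀] [Module ℝ V₀]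
    [AddCommGroup V₁] [Module ℝ V₁] where
  even : LinearMap.BilinForm ℝ V₀
  odd : LinearMap.BilinForm ℝ V₁
  even_alt : even.IsAlt
  even_nondegenerate : even.Nondegenerate
  odd_symm : odd.IsSymm
  odd_nondegenerate : odd.Nondegenerate

/-- The bilinear form `B` on `V = V₀ ⊕ V₁`. -/
def SymplecticForm.form (B : SymplecticForm V₀ V₁) (v w : V₀ × V₁) : ℝ :=
  B.even v.1 w.1 + B.odd v.2 w.2

/-- Endomorphisms of `V = V₀ ⊕ V₁`. -/
abbrev EndV (V₀ V₁ : Type*) [AddCommGroup V₀] [Module ℝ V₀]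
    [AddCommGroup V₁] [Module ℝ V₁] : Type _ :=
  (V₀ × V₁) →ₗ[ℝ] (V₀ × V₁)

/-- The even part `spo(V)₀`: even endomorphisms with `B(Xv, w) + B(v, Xw) = 0`. -/
def spoEven (B : SymplecticForm V₀ V₁) : Submodule ℝ (EndV V₀ V₁) where
  carrier := {X | (∀ v : V₀, (X (v, 0)).2 = 0) ∧ (∀ v : V₁, (X (0, v)).1 = 0) ∧
    ∀ v w, B.form (X v) w + B.form v (X w) = 0}
  zero_mem' := by simp [SymplecticForm.form]
  add_mem' := by
    rintro X Y ⟨hX, hX', hX''⟩ ⟨hY, hY', hY''⟩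
    refine ⟨fun v => by simp [hX, hY], fun v => by simp [hX', hY'], fun v w => ?_⟩
    have h1 := hX'' v w
    have h2 := hY'' v w
    simp only [SymplecticForm.form, LinearMap.add_apply, Prod.fst_add, Prod.snd_add,
      map_add, LinearMap.add_apply] at *
    linarith
  smul_mem' := by
    rintro c X ⟨hX, hX', hX''⟩
    refine ⟨fun v => by simp [hX], fun v => by simp [hX'], fun v w => ?_⟩
    have h1 := congrArg (fun t => c * t) (hX'' v w)
    simp only [SymplecticForm.form, LinearMap.smul_apply, Prod.smul_fst, Prod.smul_snd,
      map_smul, LinearMap.smul_apply, smul_eq_mul, mul_zero] at *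
    linarith

/-- The odd part `spo(V)₁`: odd endomorphisms with `B(Xv, w) + (-1)^{p(v)} B(v, Xw) = 0` for
homogeneous `v`. -/
def spoOdd (B : SymplecticForm V₀ V₁) : Submodule ℝ (EndV V₀ V₁) where
  carrier := {X | (∀ v : V₀, (X (v, 0)).1 = 0) ∧ (∀ v : V₁, (X (0, v)).2 = 0) ∧
    ∀ v w, B.form (X v) w + B.form (v.1, -v.2) (X w) = 0}
  zero_mem' := by simp [SymplecticForm.form]
  add_mem' := by
    rintro X Y ⟨hX, hX', hX''⟩ ⟨hY, hY', hY''⟩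
    refine ⟨fun v => by simp [hX, hY], fun v => by simp [hX', hY'], fun v w => ?_⟩
    have h1 := hX'' v w
    have h2 := hY'' v w
    simp only [SymplecticForm.form, LinearMap.add_apply, Prod.fst_add, Prod.snd_add,
      map_add, LinearMap.add_apply] at *
    linarith
  smul_mem' := by
    rintro c X ⟨hX, hX', hX''⟩
    refine ⟨fun v => by simp [hX], fun v => by simp [hX'], fun v w => ?_⟩
    have h1 := congrArg (fun t => c * t) (hX'' v w)
    simp only [SymplecticForm.form, LinearMap.smul_apply, Prod.smul_fst, Prod.smul_snd,
      map_smul, LinearMap.smul_apply, smul_eq_mul, mul_zero] at *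
    linarith

/-- The even part of the Lie superalgebra `spo(V)`, as a type. -/
def SpoEven (B : SymplecticForm V₀ V₁) : Type _ := spoEven B

/-- The odd part of the Lie superalgebra `spo(V)`, as a type. -/
def SpoOdd (B : SymplecticForm V₀ V₁) : Type _ := spoOdd B

instance (B : SymplecticForm V₀ V₁) : AddCommGroup (SpoEven B) :=
  inferInstanceAs (AddCommGroup (spoEven B))

instance (B : SymplecticForm V₀ V₁) : AddCommGroup (SpoOdd B) :=
  inferInstanceAs (AddCommGroup (spoOdd B))

instance (B : SymplecticForm V₀ V₁) : Module ℝ (SpoEven B) :=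
  inferInstanceAs (Module ℝ (spoEven B))

instance (B : SymplecticForm V₀ V₁) : Module ℝ (SpoOdd B) :=
  inferInstanceAs (Module ℝ (spoOdd B))

instance (B : SymplecticForm V₀ V₁) : FiniteDimensional ℝ (SpoEven B) :=
  inferInstanceAs (FiniteDimensional ℝ (spoEven B))

instance (B : SymplecticForm V₀ V₁) : FiniteDimensional ℝ (SpoOdd B) :=
  inferInstanceAs (FiniteDimensional ℝ (spoOdd B))

/-- The inclusion of `spo(V)₀` in the space of endomorphisms of `V`. -/
def SpoEven.val {B : SymplecticForm V₀ V₁} : SpoEven B →ₗ[ℝ] EndV V₀ V₁ := (spoEven B).subtype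

/-- The inclusion of `spo(V)₁` in the space of endomorphisms of `V`. -/
def SpoOdd.val {B : SymplecticForm V₀ V₁} : SpoOdd B →ₗ[ℝ] EndV V₀ V₁ := (spoOdd B).subtype

theorem SpoEven.prop {B : SymplecticForm V₀ V₁} (X : SpoEven B) : X.val ∈ spoEven B :=
  Subtype.property _

theorem SpoOdd.prop {B : SymplecticForm V₀ V₁} (X : SpoOdd B) : X.val ∈ spoOdd B :=
  Subtype.property _

@[ext] theorem SpoEven.ext {B : SymplecticForm V₀ V₁} {X Y : SpoEven B} (h : X.val = Y.val) : X = Y :=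
  Subtype.ext h

@[ext] theorem SpoOdd.ext {B : SymplecticForm V₀ V₁} {X Y : SpoOdd B} (h : X.val = Y.val) : X = Y :=
  Subtype.ext h

/-- An element of `spo(V)₀`. -/
def SpoEven.mk {B : SymplecticForm V₀ V₁} (X : EndV V₀ V₁) (h : X ∈ spoEven B) : SpoEven B :=
  ⟨X, h⟩

/-- An element of `spo(V)₁`. -/
def SpoOdd.mk {B : SymplecticForm V₀ V₁} (X : EndV V₀ V₁) (h : X ∈ spoOdd B) : SpoOdd B :=
  ⟨X, h⟩

@[simp] theorem SpoEven.val_mk {B : SymplecticForm V₀ V₁} (X : EndV V₀ V₁) (h : X ∈ spoEven B) :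
    (SpoEven.mk X h).val = X := rfl

@[simp] theorem SpoOdd.val_mk {B : SymplecticForm V₀ V₁} (X : EndV V₀ V₁) (h : X ∈ spoOdd B) :
    (SpoOdd.mk X h).val = X := rfl

theorem mk_zero_zero : ((0 : V₀), (0 : V₁)) = 0 := rfl

theorem mul_app (X Y : EndV V₀ V₁) (v : V₀ × V₁) : (X * Y) v = X (Y v) := rfl

theorem spoEven_apply (B : SymplecticForm V₀ V₁) (X : SpoEven B) (v : V₀ × V₁) :
    X.val v = ((X.val (v.1, 0)).1, (X.val (0, v.2)).2) := by
  have h : v = (v.1, 0) + (0, v.2) := by simp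
  conv_lhs => rw [h, map_add]
  ext <;> simp [X.prop.1, X.prop.2.1]

theorem spoOdd_apply (B : SymplecticForm V₀ V₁) (X : SpoOdd B) (v : V₀ × V₁) :
    X.val v = ((X.val (0, v.2)).1, (X.val (v.1, 0)).2) := by
  have h : v = (v.1, 0) + (0, v.2) := by simp
  conv_lhs => rw [h, map_add]
  ext <;> simp [X.prop.1, X.prop.2.1]

/-- The bracket `[X, Y] = XY - YX` of even elements. -/
theorem bracket_even_even (B : SymplecticForm V₀ V₁) (X Y : SpoEven B) :
    X.val * Y.val - Y.val * X.val ∈ spoEven B := by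
  refine ⟨fun v => ?_, fun v => ?_, fun v w => ?_⟩
  · simp [spoEven_apply B X (Y.val _), spoEven_apply B Y (X.val _), X.prop.1, Y.prop.1, mk_zero_zero]
  · simp [spoEven_apply B X (Y.val _), spoEven_apply B Y (X.val _), X.prop.2.1, Y.prop.2.1, mk_zero_zero]
  · have h1 := X.prop.2.2 (Y.val v) w
    have h2 := Y.prop.2.2 (X.val v) w
    have h3 := X.prop.2.2 v (Y.val w)
    have h4 := Y.prop.2.2 v (X.val w)
    simp only [SymplecticForm.form, LinearMap.sub_apply, mul_app,
      Prod.fst_sub, Prod.snd_sub, map_sub, LinearMap.sub_apply] at *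
    linarith

/-- The bracket `[X, Y] = XY - YX` of an even and an odd element. -/
theorem bracket_even_odd (B : SymplecticForm V₀ V₁) (X : SpoEven B) (Y : SpoOdd B) :
    X.val * Y.val - Y.val * X.val ∈ spoOdd B := by
  refine ⟨fun v => ?_, fun v => ?_, fun v w => ?_⟩
  · simp [spoEven_apply B X (Y.val _), spoOdd_apply B Y (X.val _), X.prop.1, Y.prop.1, mk_zero_zero]
  · simp [spoEven_apply B X (Y.val _), spoOdd_apply B Y (X.val _), X.prop.2.1, Y.prop.2.1, mk_zero_zero]
  · have h1 := X.prop.2.2 (Y.val v) w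
    have h2 := Y.prop.2.2 (X.val v) w
    have h3 := X.prop.2.2 (v.1, -v.2) (Y.val w)
    have h4 := Y.prop.2.2 v (X.val w)
    have e : X.val (v.1, -v.2) = ((X.val v).1, -(X.val v).2) := by
      rw [spoEven_apply B X (v.1, -v.2), spoEven_apply B X v]
      have : ((0 : V₀), -v.2) = -(0, v.2) := by simp
      rw [this, map_neg, Prod.snd_neg]
    rw [e] at h3
    simp only [SymplecticForm.form, LinearMap.sub_apply, mul_app,
      Prod.fst_sub, Prod.snd_sub, map_sub, LinearMap.sub_apply] at *
    linarith

/-- The bracket `[X, Y] = XY + YX` of odd elements. -/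
theorem bracket_odd_odd (B : SymplecticForm V₀ V₁) (X Y : SpoOdd B) :
    X.val * Y.val + Y.val * X.val ∈ spoEven B := by
  have e (Z : SpoOdd B) (v : V₀ × V₁) : Z.val (v.1, -v.2) = (-(Z.val v).1, (Z.val v).2) := by
    rw [spoOdd_apply B Z (v.1, -v.2), spoOdd_apply B Z v]
    have : ((0 : V₀), -v.2) = -(0, v.2) := by simp
    rw [this, map_neg, Prod.fst_neg]
  refine ⟨fun v => ?_, fun v => ?_, fun v w => ?_⟩
  · simp [spoOdd_apply B X (Y.val _), spoOdd_apply B Y (X.val _), X.prop.1, Y.prop.1, mk_zero_zero]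
  · simp [spoOdd_apply B X (Y.val _), spoOdd_apply B Y (X.val _), X.prop.2.1, Y.prop.2.1, mk_zero_zero]
  · have h1 := X.prop.2.2 (Y.val v) w
    have h2 := Y.prop.2.2 (X.val v) w
    have h3 := X.prop.2.2 (v.1, -v.2) (Y.val w)
    have h4 := Y.prop.2.2 (v.1, -v.2) (X.val w)
    rw [e] at h3 h4
    simp only [SymplecticForm.form, LinearMap.add_apply, mul_app,
      Prod.fst_add, Prod.snd_add, map_add, map_neg, neg_neg, LinearMap.add_apply,
      LinearMap.neg_apply] at *
    linarith

/-- `ad X : spo(V)₀ → spo(V)₀` for `X` even. -/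
def adEE (B : SymplecticForm V₀ V₁) (X : SpoEven B) : SpoEven B →ₗ[ℝ] SpoEven B where
  toFun Y := .mk (X.val * Y.val - Y.val * X.val) (bracket_even_even B X Y)
  map_add' Y Z := by ext1; simp [mul_add, add_mul]; abel
  map_smul' c Y := by ext1; simp [smul_sub]

/-- `ad X : spo(V)₁ → spo(V)₁` for `X` even. -/
def adEO (B : SymplecticForm V₀ V₁) (X : SpoEven B) : SpoOdd B →ₗ[ℝ] SpoOdd B where
  toFun Y := .mk (X.val * Y.val - Y.val * X.val) (bracket_even_odd B X Y)
  map_add' Y Z := by ext1; simp [mul_add, add_mul]; abel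
  map_smul' c Y := by ext1; simp [smul_sub]

/-- `ad X : spo(V)₀ → spo(V)₁` for `X` odd. -/
def adOE (B : SymplecticForm V₀ V₁) (X : SpoOdd B) : SpoEven B →ₗ[ℝ] SpoOdd B where
  toFun Y := .mk (X.val * Y.val - Y.val * X.val) (by
    rw [← neg_sub]; exact neg_mem (bracket_even_odd B Y X))
  map_add' Y Z := by ext1; simp [mul_add, add_mul]; abel
  map_smul' c Y := by ext1; simp [smul_sub]

/-- `ad X : spo(V)₁ → spo(V)₀` for `X` odd. -/
def adOO (B : SymplecticForm V₀ V₁) (X : SpoOdd B) : SpoOdd B →ₗ[ℝ] SpoEven B where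
  toFun Y := .mk (X.val * Y.val + Y.val * X.val) (bracket_odd_odd B X Y)
  map_add' Y Z := by ext1; simp [mul_add, add_mul]; abel
  map_smul' c Y := by ext1; simp

/-- The superalgebra `S(spo(V))`. -/
abbrev SSpo (B : SymplecticForm V₀ V₁) : Type _ := SuperSym (SpoEven B) (SpoOdd B)

/-- The subspace `S(spo(V))^{spo(V)}` of invariants of the adjoint action. -/
def invariants (B : SymplecticForm V₀ V₁) : Submodule ℝ (SSpo B) :=
  (⨅ X : SpoEven B, LinearMap.ker (SuperSym.evenDer (adEE B X) (adEO B X))) ⊓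
    ⨅ X : SpoOdd B, LinearMap.ker (SuperSym.oddDer (adOE B X) (adOO B X))

/-- The subspace `S^k(spo(V))^{spo(V)}`. -/
def homogeneousInvariants (B : SymplecticForm V₀ V₁) (k : ℕ) : Submodule ℝ (SSpo B) :=
  SuperSym.homogeneous (SpoEven B) (SpoOdd B) k ⊓ invariants B

/-- The group of even automorphisms of `V` that preserve `B`; it is `O(V)` if `V = V₁`. -/
structure EvenIsometry (B : SymplecticForm V₀ V₁) where
  even : V₀ ≃ₗ[ℝ] V₀
  odd : V₁ ≃ₗ[ℝ] V₁
  map_even : ∀ v w, B.even (even v) (even w) = B.even v w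
  map_odd : ∀ v w, B.odd (odd v) (odd w) = B.odd v w

namespace EvenIsometry

variable {B : SymplecticForm V₀ V₁}

/-- The automorphism of `V = V₀ ⊕ V₁`. -/
def equiv (h : EvenIsometry B) : (V₀ × V₁) ≃ₗ[ℝ] (V₀ × V₁) := h.even.prodCongr h.odd

theorem form_equiv (h : EvenIsometry B) (v w : V₀ × V₁) :
    B.form (h.equiv v) w = B.form v (h.equiv.symm w) := by
  have h1 := h.map_even v.1 (h.even.symm w.1)
  have h2 := h.map_odd v.2 (h.odd.symm w.2)
  simp only [LinearEquiv.apply_symm_apply] at h1 h2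
  exact congrArg₂ (· + ·) h1 h2

/-- Conjugation `X ↦ h X h⁻¹`. -/
def conj (h : EvenIsometry B) (X : EndV V₀ V₁) : EndV V₀ V₁ :=
  (h.equiv : EndV V₀ V₁) * X * (h.equiv.symm : EndV V₀ V₁)

/-- The action on `spo(V)₀` by conjugation. -/
def conjEven (h : EvenIsometry B) : SpoEven B →ₗ[ℝ] SpoEven B where
  toFun X := .mk (h.conj X.val) (by
    refine ⟨fun v => ?_, fun v => ?_, fun v w => ?_⟩
    · simp [conj, equiv, X.prop.1]
    · simp [conj, equiv, X.prop.2.1]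
    · have h1 := X.prop.2.2 (h.equiv.symm v) (h.equiv.symm w)
      have h2 := h.form_equiv (X.val (h.equiv.symm v)) w
      have h3 := h.form_equiv (h.equiv.symm v) (h.equiv (X.val (h.equiv.symm w)))
      simp only [LinearEquiv.apply_symm_apply,
        LinearEquiv.symm_apply_apply] at h3
      simp only [conj, mul_app, LinearEquiv.coe_coe]
      rw [h2, h3, h1])
  map_add' X Y := by ext1; simp [conj, mul_add, add_mul]
  map_smul' c X := by ext1; simp [conj]

/-- The action on `spo(V)₁` by conjugation. -/
def conjOdd (h : EvenIsometry B) : SpoOdd B →ₗ[ℝ] SpoOdd B where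
  toFun X := .mk (h.conj X.val) (by
    refine ⟨fun v => ?_, fun v => ?_, fun v w => ?_⟩
    · simp [conj, equiv, X.prop.1]
    · simp [conj, equiv, X.prop.2.1]
    · have h1 := X.prop.2.2 (h.equiv.symm v) (h.equiv.symm w)
      have h2 := h.form_equiv (X.val (h.equiv.symm v)) w
      have h3 := h.form_equiv (h.equiv.symm (v.1, -v.2)) (h.equiv (X.val (h.equiv.symm w)))
      have e : h.equiv.symm (v.1, -v.2) = ((h.equiv.symm v).1, -(h.equiv.symm v).2) := by
        simp [equiv]
      simp only [LinearEquiv.apply_symm_apply,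
        LinearEquiv.symm_apply_apply] at h3
      simp only [conj, mul_app, LinearEquiv.coe_coe]
      rw [h2, h3, e, h1])
  map_add' X Y := by ext1; simp [conj, mul_add, add_mul]
  map_smul' c X := by ext1; simp [conj]

end EvenIsometry

/-- Invariance of an element of `S(spo(V))` under all even isometries of `V` (that is, under
`O(V)` if `V = V₁`). -/
def IsIsometryInvariant {B : SymplecticForm V₀ V₁} (D : SSpo B) : Prop :=
  ∀ h : EvenIsometry B, SuperSym.map h.conjEven h.conjOdd D = D

/-! ### The moment map -/

/-- The superalgebra `S(V*)`. -/
abbrev SDual (V₀ V₁ : Type*) [AddCommGroup V₀] [Module ℝ V₀] [AddCommGroup V₁] [Module ℝ V₁] :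
    Type _ :=
  SuperSym (Dual ℝ V₀) (Dual ℝ V₁)

/-- An element of the basis of `V₀*` dual to a basis of `V₀`, in `S(V*)`. -/
def evenCoord (i : Fin (finrank ℝ V₀)) : SDual V₀ V₁ :=
  SuperSym.ι₀ ((finBasis ℝ V₀).coord i)

/-- An element of the basis of `V₁*` dual to a basis of `V₁`, in `S(V*)`. -/
def oddCoord (j : Fin (finrank ℝ V₁)) : SDual V₀ V₁ :=
  SuperSym.ι₁ ((finBasis ℝ V₁).coord j)

/-- The moment `μ̌(X)(v) = -½ B(v, Xv)` for even `X`, where `v = ∑ gᵢ zⁱ` is the generic point of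
`V`: `μ̌(X) = -½ ∑ B(gᵢ, X gⱼ) zʲ zⁱ`. -/
def momentEven (B : SymplecticForm V₀ V₁) : SpoEven B →ₗ[ℝ] SDual V₀ V₁ where
  toFun X := (-1 / 2 : ℝ) •
    ((∑ i, ∑ j, B.even (finBasis ℝ V₀ i) (X.val (finBasis ℝ V₀ j, 0)).1 •
        (evenCoord j * evenCoord i)) +
      ∑ i, ∑ j, B.odd (finBasis ℝ V₁ i) (X.val (0, finBasis ℝ V₁ j)).2 •
        (oddCoord j * oddCoord i))
  map_add' X Y := by
    simp only [LinearMap.add_apply, Prod.fst_add, Prod.snd_add,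
      map_add, add_smul, Finset.sum_add_distrib, ← smul_add]
    congr 1
    abel
  map_smul' c X := by
    simp only [LinearMap.smul_apply, Prod.smul_fst, Prod.smul_snd,
      map_smul, smul_eq_mul, mul_smul, ← Finset.smul_sum, ← smul_add, RingHom.id_apply]
    rw [smul_comm]

/-- The moment for odd `X`: if `(G_k)` is a basis of `spo(V)` with dual basis `(Z^k)`, then
`-½ B(v, Xv) = -½ ∑ B(gᵢ, G_k gⱼ) zʲ Z^k zⁱ = ∑ μ̌(G_k) Z^k` at the generic points, so that
`μ̌(X) = -½ ∑ (-1)^{p(gᵢ)} B(gᵢ, X gⱼ) zʲ zⁱ` for `X` odd. -/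
def momentOdd (B : SymplecticForm V₀ V₁) : SpoOdd B →ₗ[ℝ] SDual V₀ V₁ where
  toFun X := (-1 / 2 : ℝ) • ∑ i, evenCoord i * ∑ j,
    (B.even (finBasis ℝ V₀ i) (X.val (0, finBasis ℝ V₁ j)).1 -
      B.odd (finBasis ℝ V₁ j) (X.val (finBasis ℝ V₀ i, 0)).2) • oddCoord j
  map_add' X Y := by
    rw [← smul_add, ← Finset.sum_add_distrib]
    congr 1
    refine Finset.sum_congr rfl fun i _ => ?_
    rw [← mul_add, ← Finset.sum_add_distrib]
    congr 1
    refine Finset.sum_congr rfl fun j _ => ?_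
    rw [← add_smul]
    congr 1
    simp only [LinearMap.add_apply, Prod.fst_add, Prod.snd_add,
      map_add]
    ring
  map_smul' c X := by
    rw [RingHom.id_apply, smul_comm c, Finset.smul_sum (r := c)]
    congr 1
    refine Finset.sum_congr rfl fun i _ => ?_
    rw [← mul_smul_comm, Finset.smul_sum]
    congr 1
    refine Finset.sum_congr rfl fun j _ => ?_
    rw [smul_smul]
    congr 1
    simp only [LinearMap.smul_apply, Prod.smul_fst, Prod.smul_snd,
      map_smul, smul_eq_mul]
    ring

theorem momentEven_commute (B : SymplecticForm V₀ V₁) (X : SpoEven B) (s : SDual V₀ V₁) :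
    Commute (momentEven B X) s := by
  refine Commute.smul_left (Commute.add_left ?_ ?_) _
  · exact Commute.sum_left _ _ _ fun i _ => Commute.sum_left _ _ _ fun j _ =>
      ((SuperSym.ι₀_commute _ _).mul_left (SuperSym.ι₀_commute _ _)).smul_left _
  · exact Commute.sum_left _ _ _ fun i _ => Commute.sum_left _ _ _ fun j _ =>
      (SuperSym.ι₁_mul_commute _ _ _).smul_left _

theorem momentOdd_sq (B : SymplecticForm V₀ V₁) (X : SpoOdd B) :
    momentOdd B X * momentOdd B X = 0 := by
  have key : ∀ θ : Fin (finrank ℝ V₀) → Dual ℝ V₁,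
      (∑ i, (evenCoord i : SDual V₀ V₁) * SuperSym.ι₁ (θ i)) *
        (∑ i, (evenCoord i : SDual V₀ V₁) * SuperSym.ι₁ (θ i)) = 0 := by
    intro θ
    set S := (∑ i, (evenCoord i : SDual V₀ V₁) * SuperSym.ι₁ (θ i)) *
        (∑ i, (evenCoord i : SDual V₀ V₁) * SuperSym.ι₁ (θ i)) with hS
    have h1 : S = -S := by
      conv_lhs => rw [hS, Finset.sum_mul_sum, Finset.sum_comm]
      rw [hS, Finset.sum_mul_sum, ← Finset.sum_neg_distrib]
      refine Finset.sum_congr rfl fun i _ => ?_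
      rw [← Finset.sum_neg_distrib]
      refine Finset.sum_congr rfl fun k _ => ?_
      have c1 : Commute (evenCoord i : SDual V₀ V₁) (SuperSym.ι₁ (θ k)) :=
        SuperSym.ι₀_commute _ _
      have c2 : Commute (evenCoord k : SDual V₀ V₁) (SuperSym.ι₁ (θ i)) :=
        SuperSym.ι₀_commute _ _
      have c3 : Commute (evenCoord k : SDual V₀ V₁) (evenCoord i) := SuperSym.ι₀_commute _ _
      rw [c1.symm.mul_mul_mul_comm, c2.symm.mul_mul_mul_comm, c3.eq]
      exact SuperSym.mul_neg_aux _ (SuperSym.ι₁_anticomm (θ k) (θ i))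
    have h2 : (2 : ℝ) • S = 0 := by
      rw [two_smul]
      nth_rewrite 2 [h1]
      exact add_neg_cancel S
    exact (smul_eq_zero.1 h2).resolve_left two_ne_zero
  have h := key fun i => ∑ j, (B.even (finBasis ℝ V₀ i) (X.val (0, finBasis ℝ V₁ j)).1 -
      B.odd (finBasis ℝ V₁ j) (X.val (finBasis ℝ V₀ i, 0)).2) • (finBasis ℝ V₁).coord j
  simp only [map_sum, map_smul] at h
  simp only [momentOdd, LinearMap.coe_mk, AddHom.coe_mk, smul_mul_smul_comm]
  exact (congrArg _ h).trans (smul_zero _)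

/-- The morphism of superalgebras `μ̌ : S(spo(V)) → S(V*)`. -/
def moment (B : SymplecticForm V₀ V₁) : SSpo B →ₐ[ℝ] SDual V₀ V₁ :=
  SuperSym.lift (momentEven B) (momentOdd B) (fun _ _ => momentEven_commute B _ _)
    (momentOdd_sq B) (fun _ _ => momentEven_commute B _ _)

/-! ### Smooth functions and constant coefficient differential operators -/

/-- Linear coordinates on a finite dimensional real vector space. -/
def coords (E : Type*) [AddCommGroup E] [Module ℝ E] [FiniteDimensional ℝ E] :
    (Fin (finrank ℝ E) → ℝ) ≃ₗ[ℝ] E :=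
  (finBasis ℝ E).equivFun.symm

/-- An open subset of a finite dimensional real vector space. -/
structure OpenSubset (E : Type*) [AddCommGroup E] [Module ℝ E] [FiniteDimensional ℝ E] where
  carrier : Set E
  isOpen : IsOpen (coords E ⁻¹' carrier)

section SmoothFun

variable {E : Type*} [AddCommGroup E] [Module ℝ E] [FiniteDimensional ℝ E]

/-- The space `C^∞(U, ℂ)` of smooth functions on an open subset `U` of `E`; a function on `U` is
represented by its extension by zero to `E`. -/
def SmoothFun (U : OpenSubset E) : Submodule ℂ (E → ℂ) where
  carrier := {f | ContDiffOn ℝ ∞ (f ∘ coords E) (coords E ⁻¹' U.carrier) ∧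
    ∀ x ∉ U.carrier, f x = 0}
  zero_mem' := ⟨contDiffOn_const, fun _ _ => rfl⟩
  add_mem' := fun hf hg => ⟨hf.1.add hg.1, fun x hx => by simp [hf.2 x hx, hg.2 x hx]⟩
  smul_mem' := fun c f hf => ⟨hf.1.const_smul c, fun x hx => by simp [hf.2 x hx]⟩

variable {U : OpenSubset E}

theorem SmoothFun.contDiffAt (f : SmoothFun U) {x : Fin (finrank ℝ E) → ℝ}
    (hx : coords E x ∈ U.carrier) : ContDiffAt ℝ ∞ (f.1 ∘ coords E) x :=
  f.2.1.contDiffAt (U.isOpen.mem_nhds hx)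

theorem SmoothFun.lineDeriv_eq (f : SmoothFun U) (Y : E) {x : Fin (finrank ℝ E) → ℝ}
    (hx : coords E x ∈ U.carrier) :
    lineDeriv ℝ f.1 (coords E x) Y = fderiv ℝ (f.1 ∘ coords E) x ((coords E).symm Y) := by
  have hd : DifferentiableAt ℝ (f.1 ∘ coords E) x :=
    (SmoothFun.contDiffAt f hx).differentiableAt (by simp)
  rw [← hd.lineDeriv_eq_fderiv]
  simp [lineDeriv]

open Classical in
/-- The derivative of a smooth function along the constant vector field `Y`. -/
def dirDeriv (Y : E) : SmoothFun U →ₗ[ℂ] SmoothFun U where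
  toFun f := ⟨fun x => if x ∈ U.carrier then lineDeriv ℝ f.1 x Y else 0, by
    refine ⟨?_, fun x hx => if_neg hx⟩
    have h : ContDiffOn ℝ ∞ (fun x => fderiv ℝ (f.1 ∘ coords E) x ((coords E).symm Y))
        (coords E ⁻¹' U.carrier) :=
      (f.2.1.fderiv_of_isOpen U.isOpen (m := ∞) (by simp)).clm_apply contDiffOn_const
    exact h.congr fun x hx => (if_pos hx).trans (SmoothFun.lineDeriv_eq f Y hx)⟩
  map_add' f g := by
    ext x
    obtain ⟨x, rfl⟩ := (coords E).surjective x
    by_cases hx : coords E x ∈ U.carrier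
    · have h := SmoothFun.lineDeriv_eq (f + g) Y hx
      have hf := (SmoothFun.contDiffAt f hx).differentiableAt (by simp)
      have hg := (SmoothFun.contDiffAt g hx).differentiableAt (by simp)
      have e : (f + g).1 ∘ coords E = f.1 ∘ coords E + g.1 ∘ coords E := rfl
      rw [e, fderiv_add hf hg] at h
      simpa [hx, SmoothFun.lineDeriv_eq f Y hx, SmoothFun.lineDeriv_eq g Y hx] using h
    · simp [hx]
  map_smul' c f := by
    ext x
    obtain ⟨x, rfl⟩ := (coords E).surjective x
    by_cases hx : coords E x ∈ U.carrier
    · have h := SmoothFun.lineDeriv_eq (c • f) Y hx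
      have hf := (SmoothFun.contDiffAt f hx).differentiableAt (by simp)
      have e : (c • f).1 ∘ coords E = c • (f.1 ∘ coords E) := rfl
      rw [e, fderiv_const_smul hf c] at h
      simpa [hx, SmoothFun.lineDeriv_eq f Y hx] using h
    · simp [hx]

theorem dirDeriv_apply (Y : E) (f : SmoothFun U) {x : Fin (finrank ℝ E) → ℝ}
    (hx : coords E x ∈ U.carrier) :
    (dirDeriv Y f).1 (coords E x) = fderiv ℝ (f.1 ∘ coords E) x ((coords E).symm Y) :=
  (if_pos hx).trans (SmoothFun.lineDeriv_eq f Y hx)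

theorem dirDeriv_dirDeriv (Y Z : E) (f : SmoothFun U) {x : Fin (finrank ℝ E) → ℝ}
    (hx : coords E x ∈ U.carrier) :
    (dirDeriv Y (dirDeriv Z f)).1 (coords E x) =
      fderiv ℝ (fderiv ℝ (f.1 ∘ coords E)) x ((coords E).symm Y) ((coords E).symm Z) := by
  rw [dirDeriv_apply _ _ hx]
  have h : (dirDeriv Z f).1 ∘ coords E =ᶠ[nhds x]
      fun y => fderiv ℝ (f.1 ∘ coords E) y ((coords E).symm Z) := by
    filter_upwards [U.isOpen.mem_nhds hx] with y hy
    exact dirDeriv_apply Z f hy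
  rw [h.fderiv_eq]
  have hd : DifferentiableAt ℝ (fderiv ℝ (f.1 ∘ coords E)) x :=
    ((SmoothFun.contDiffAt f hx).fderiv_right (m := 1) (by norm_cast)).differentiableAt (by simp)
  rw [fderiv_clm_apply hd (differentiableAt_const _)]
  simp

theorem dirDeriv_comm (Y Z : E) (f : SmoothFun U) :
    dirDeriv Y (dirDeriv Z f) = dirDeriv Z (dirDeriv Y f) := by
  ext x
  obtain ⟨x, rfl⟩ := (coords E).surjective x
  by_cases hx : coords E x ∈ U.carrier
  · rw [dirDeriv_dirDeriv Y Z f hx, dirDeriv_dirDeriv Z Y f hx]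
    exact ((SmoothFun.contDiffAt f hx).isSymmSndFDerivAt (by
      simp only [minSmoothness_of_isRCLikeNormedField]; norm_cast)).eq _ _
  · rw [(dirDeriv Y (dirDeriv Z f)).2.2 _ hx, (dirDeriv Z (dirDeriv Y f)).2.2 _ hx]

theorem dirDeriv_add (Y Z : E) (f : SmoothFun U) :
    dirDeriv (Y + Z) f = dirDeriv Y f + dirDeriv Z f := by
  ext x
  obtain ⟨x, rfl⟩ := (coords E).surjective x
  by_cases hx : coords E x ∈ U.carrier
  · change (dirDeriv (Y + Z) f).1 _ = (dirDeriv Y f).1 _ + (dirDeriv Z f).1 _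
    rw [dirDeriv_apply _ _ hx, dirDeriv_apply _ _ hx, dirDeriv_apply _ _ hx, map_add, map_add]
  · simp [dirDeriv, hx]

theorem dirDeriv_smul (c : ℝ) (Y : E) (f : SmoothFun U) :
    dirDeriv (c • Y) f = (c : ℂ) • dirDeriv Y f := by
  ext x
  obtain ⟨x, rfl⟩ := (coords E).surjective x
  by_cases hx : coords E x ∈ U.carrier
  · change (dirDeriv (c • Y) f).1 _ = (c : ℂ) • (dirDeriv Y f).1 _
    rw [dirDeriv_apply _ _ hx, dirDeriv_apply _ _ hx, map_smul, map_smul]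
    simp
  · simp [dirDeriv, hx]

end SmoothFun

/-- The open convex cone `𝒱⁺ ⊆ spo(V)₀` of those `X` for which the quadratic form `B(v, Xv)` on
`V₀` is positive definite. -/
def posCone (B : SymplecticForm V₀ V₁) : OpenSubset (SpoEven B) where
  carrier := {X | ∀ v : V₀, v ≠ 0 → 0 < B.even v (X.val (v, 0)).1}
  isOpen := by
    let q : (Fin (finrank ℝ (SpoEven B)) → ℝ) × (Fin (finrank ℝ V₀) → ℝ) → ℝ := fun p =>
      B.even (coords V₀ p.2) ((coords (SpoEven B) p.1).1 (coords V₀ p.2, 0)).1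
    have hc : Continuous q := by
      let β : V₀ →ₗ[ℝ] V₀ →ₗ[ℝ] SpoEven B →ₗ[ℝ] ℝ := LinearMap.mk₂ ℝ
        (fun v w => (B.even v) ∘ₗ LinearMap.fst ℝ V₀ V₁ ∘ₗ
          (LinearMap.applyₗ (R := ℝ) ((w, 0) : V₀ × V₁)) ∘ₗ SpoEven.val)
        (fun v v' w => by ext X; simp)
        (fun c v w => by ext X; simp)
        (fun v w w' => by
          ext X
          have : ((w + w', 0) : V₀ × V₁) = (w, 0) + (w', 0) := by simp
          simp only [this]
          simp [-Prod.mk_add_mk])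
        (fun c v w => by
          ext X
          have : ((c • w, 0) : V₀ × V₁) = c • (w, 0) := by simp
          simp only [this]
          simp [-Prod.smul_mk])
      have hq : q = fun p => ∑ i, ∑ j, p.2 i * (p.2 j * β (finBasis ℝ V₀ i) (finBasis ℝ V₀ j)
          (coords (SpoEven B) p.1)) := by
        funext p
        have h1 : q p = β (coords V₀ p.2) (coords V₀ p.2) (coords (SpoEven B) p.1) := rfl
        have h2 : coords V₀ p.2 = ∑ i, p.2 i • finBasis ℝ V₀ i := by
          simp [coords, Basis.equivFun_symm_apply]
        rw [h1, h2]
        simp only [map_sum, map_smul, LinearMap.sum_apply, LinearMap.smul_apply, smul_eq_mul,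
          Finset.mul_sum]
        rw [Finset.sum_comm]
        exact Finset.sum_congr rfl fun i _ => Finset.sum_congr rfl fun j _ => by ring
      rw [hq]
      refine continuous_finsetSum _ fun i _ => continuous_finsetSum _ fun j _ => ?_
      have h3 : Continuous fun t : Fin (finrank ℝ (SpoEven B)) → ℝ =>
          β (finBasis ℝ V₀ i) (finBasis ℝ V₀ j) (coords (SpoEven B) t) :=
        LinearMap.continuous_of_finiteDimensional
          (β (finBasis ℝ V₀ i) (finBasis ℝ V₀ j) ∘ₗ (coords (SpoEven B)).toLinearMap)
      have h4 := h3.comp (continuous_fst (X := Fin (finrank ℝ (SpoEven B)) → ℝ)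
        (Y := Fin (finrank ℝ V₀) → ℝ))
      have h5 (l) : Continuous fun p : (Fin (finrank ℝ (SpoEven B)) → ℝ) ×
          (Fin (finrank ℝ V₀) → ℝ) => p.2 l := (continuous_apply l).comp continuous_snd
      exact (h5 i).mul ((h5 j).mul h4)
    have hset : coords (SpoEven B) ⁻¹'
        {X : SpoEven B | ∀ v : V₀, v ≠ 0 → 0 < B.even v (X.val (v, 0)).1} =
        {t | ∀ x ∈ Metric.sphere (0 : Fin (finrank ℝ V₀) → ℝ) 1, 0 < q (t, x)} := by
      ext t
      constructor
      · intro h x hx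
        exact h (coords V₀ x) (by
          rw [Ne, LinearEquiv.map_eq_zero_iff]
          rintro rfl
          simp at hx)
      · intro h v hv
        obtain ⟨x, rfl⟩ := (coords V₀).surjective v
        have hx : x ≠ 0 := fun h0 => hv (by rw [h0, map_zero])
        have hn : 0 < ‖x‖ := norm_pos_iff.2 hx
        have h1 := h (‖x‖⁻¹ • x) (by
          rw [mem_sphere_zero_iff_norm, norm_smul, norm_inv, norm_norm]
          exact inv_mul_cancel₀ hn.ne')
        have h2 : q (t, ‖x‖⁻¹ • x) = ‖x‖⁻¹ * (‖x‖⁻¹ * q (t, x)) := by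
          have h3 : ((‖x‖⁻¹ • coords V₀ x, 0) : V₀ × V₁) = ‖x‖⁻¹ • (coords V₀ x, 0) := by simp
          simp only [q, map_smul, h3, LinearMap.smul_apply, Prod.smul_fst, smul_eq_mul]
        rw [h2] at h1
        have hi : 0 < ‖x‖⁻¹ := inv_pos.2 hn
        exact (mul_pos_iff_of_pos_left hi).1 ((mul_pos_iff_of_pos_left hi).1 h1)
    rw [hset, isOpen_iff_mem_nhds]
    intro t ht
    exact (isCompact_sphere (0 : Fin (finrank ℝ V₀) → ℝ) 1).eventually_forall_of_forall_eventually
      fun x hx => (hc.tendsto (t, x)).eventually (lt_mem_nhds (ht x hx))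

/-- The complexified exterior algebra `Λ(spo(V)₁*) ⊗ ℂ`. -/
abbrev OddForms (B : SymplecticForm V₀ V₁) : Type _ := ExteriorAlgebra ℂ (SpoOdd B →ₗ[ℝ] ℂ)

/-- The superalgebra `C^∞_{spo(V)}(𝒱⁺, ℂ) = C^∞(𝒱⁺, ℂ) ⊗ Λ(spo(V)₁*)` of complex smooth functions
on the supermanifold `spo(V)` defined in `𝒱⁺`. -/
def SuperFun (B : SymplecticForm V₀ V₁) : Type _ := SmoothFun (posCone B) ⊗[ℂ] OddForms B

instance (B : SymplecticForm V₀ V₁) : AddCommGroup (SuperFun B) :=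
  inferInstanceAs (AddCommGroup (SmoothFun (posCone B) ⊗[ℂ] OddForms B))

instance (B : SymplecticForm V₀ V₁) : Module ℂ (SuperFun B) :=
  inferInstanceAs (Module ℂ (SmoothFun (posCone B) ⊗[ℂ] OddForms B))

/-- The superfunction `f ⊗ η`. -/
def SuperFun.tmul {B : SymplecticForm V₀ V₁} (f : SmoothFun (posCone B)) (η : OddForms B) :
    SuperFun B :=
  f ⊗ₜ[ℂ] η

theorem SuperFun.hom_ext {B : SymplecticForm V₀ V₁} {M : Type*} [AddCommMonoid M] [Module ℂ M]
    {S T : SuperFun B →ₗ[ℂ] M} (h : ∀ f η, S (.tmul f η) = T (.tmul f η)) : S = T :=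
  TensorProduct.ext' (R := ℂ) (M := SmoothFun (posCone B)) (N := OddForms B) h

theorem SuperFun.smul_tmul {B : SymplecticForm V₀ V₁} (c : ℂ) (f : SmoothFun (posCone B))
    (η : OddForms B) : SuperFun.tmul (c • f) η = c • SuperFun.tmul f η :=
  (TensorProduct.smul_tmul' c f η).symm

theorem SuperFun.tmul_smul {B : SymplecticForm V₀ V₁} (c : ℂ) (f : SmoothFun (posCone B))
    (η : OddForms B) : SuperFun.tmul f (c • η) = c • SuperFun.tmul f η :=
  TensorProduct.tmul_smul c f η

/-- The value in `Λ(spo(V)₁*) ⊗ ℂ` of a superfunction at `X + Ξ`, where `X ∈ spo(V)₀` and `Ξ` is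
the generic point of `spo(V)₁`. -/
def evalAt {B : SymplecticForm V₀ V₁} (X : SpoEven B) : SuperFun B →ₗ[ℂ] OddForms B :=
  (TensorProduct.lid ℂ (OddForms B)).toLinearMap ∘ₗ
    LinearMap.rTensor (OddForms B) (LinearMap.proj X ∘ₗ (SmoothFun (posCone B)).subtype)

theorem evalAt_tmul {B : SymplecticForm V₀ V₁} (X : SpoEven B) (f : SmoothFun (posCone B))
    (η : OddForms B) : evalAt X (.tmul f η) = f.1 X • η :=
  rfl

/-- The linear form `ψ ↦ ψ(X)` on the (complexified) dual of a real vector space. -/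
def evalDual {W : Type*} [AddCommGroup W] [Module ℝ W] (X : W) : Dual ℂ (W →ₗ[ℝ] ℂ) where
  toFun ψ := ψ X
  map_add' _ _ := rfl
  map_smul' _ _ := rfl

/-- The antiderivation `∂` of an exterior algebra with `∂ψ = d(ψ)` on generators. -/
def antiderivation {M : Type*} [AddCommGroup M] [Module ℂ M] (d : Dual ℂ M) :
    ExteriorAlgebra ℂ M →ₗ[ℂ] ExteriorAlgebra ℂ M :=
  CliffordAlgebra.contractLeft d

/-- The operator `f ⊗ η ↦ ∂_Y f ⊗ η` for even `Y`. -/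
def partialEvenAux {B : SymplecticForm V₀ V₁} (Y : SpoEven B) : Module.End ℂ (SuperFun B) :=
  LinearMap.rTensor (OddForms B) (dirDeriv (U := posCone B) Y)

/-- The operator `f ⊗ η ↦ f ⊗ ∂_Y η` for odd `Y`, where `∂_Y` is the antiderivation of
`Λ(spo(V)₁*) ⊗ ℂ` with `∂_Y ψ = (-1)^{p(Y) p(ψ)} ψ(Y) = -ψ(Y)` for `ψ ∈ spo(V)₁*`. -/
def partialOddAux {B : SymplecticForm V₀ V₁} (Y : SpoOdd B) : Module.End ℂ (SuperFun B) :=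
  LinearMap.lTensor (SmoothFun (posCone B)) (antiderivation (-evalDual Y))

theorem partialEvenAux_tmul {B : SymplecticForm V₀ V₁} (Y : SpoEven B)
    (f : SmoothFun (posCone B)) (η : OddForms B) :
    partialEvenAux Y (.tmul f η) = .tmul (dirDeriv Y f) η :=
  rfl

theorem partialOddAux_tmul {B : SymplecticForm V₀ V₁} (Y : SpoOdd B)
    (f : SmoothFun (posCone B)) (η : OddForms B) :
    partialOddAux Y (.tmul f η) = .tmul f (antiderivation (-evalDual Y) η) :=
  rfl

/-- The derivation `∂_Y` of the algebra of superfunctions for even `Y`. -/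
def partialEven (B : SymplecticForm V₀ V₁) : SpoEven B →ₗ[ℝ] Module.End ℂ (SuperFun B) where
  toFun := partialEvenAux
  map_add' Y Z := by
    refine SuperFun.hom_ext fun f η => ?_
    rw [LinearMap.add_apply]
    simp only [partialEvenAux_tmul, dirDeriv_add]
    exact TensorProduct.add_tmul _ _ _
  map_smul' c Y := by
    refine SuperFun.hom_ext fun f η => ?_
    rw [RingHom.id_apply, LinearMap.smul_apply]
    simp only [partialEvenAux_tmul, dirDeriv_smul, SuperFun.smul_tmul]
    rfl

/-- The odd superderivation `∂_Y` of the algebra of superfunctions for odd `Y`. -/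
def partialOdd (B : SymplecticForm V₀ V₁) : SpoOdd B →ₗ[ℝ] Module.End ℂ (SuperFun B) where
  toFun := partialOddAux
  map_add' Y Z := by
    refine SuperFun.hom_ext fun f η => ?_
    have h : (-evalDual (Y + Z) : Dual ℂ (SpoOdd B →ₗ[ℝ] ℂ)) = -evalDual Y + -evalDual Z := by
      ext ψ
      simp [evalDual]
      ring
    rw [LinearMap.add_apply]
    simp only [partialOddAux_tmul, h, antiderivation, map_add, LinearMap.add_apply]
    exact TensorProduct.tmul_add _ _ _
  map_smul' c Y := by
    refine SuperFun.hom_ext fun f η => ?_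
    have h : (-evalDual (c • Y) : Dual ℂ (SpoOdd B →ₗ[ℝ] ℂ)) = (c : ℂ) • (-evalDual Y) := by
      ext ψ
      simp [evalDual]
    rw [RingHom.id_apply, LinearMap.smul_apply]
    simp only [partialOddAux_tmul, h, antiderivation, map_smul, LinearMap.smul_apply,
      SuperFun.tmul_smul]
    rfl

theorem partialEven_commute (B : SymplecticForm V₀ V₁) (Y Z : SpoEven B) :
    Commute (partialEven B Y) (partialEven B Z) := by
  refine SuperFun.hom_ext fun f η => ?_
  change SuperFun.tmul (dirDeriv Y (dirDeriv Z f)) η = .tmul (dirDeriv Z (dirDeriv Y f)) η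
  rw [dirDeriv_comm]

theorem partialOdd_sq (B : SymplecticForm V₀ V₁) (Y : SpoOdd B) :
    partialOdd B Y * partialOdd B Y = 0 := by
  refine SuperFun.hom_ext fun f η => ?_
  change SuperFun.tmul f (CliffordAlgebra.contractLeft (-evalDual Y)
    (CliffordAlgebra.contractLeft (-evalDual Y) η)) = 0
  rw [CliffordAlgebra.contractLeft_contractLeft]
  exact TensorProduct.tmul_zero _ _

theorem partialEven_partialOdd_commute (B : SymplecticForm V₀ V₁) (Y : SpoEven B)
    (Z : SpoOdd B) : Commute (partialEven B Y) (partialOdd B Z) :=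
  SuperFun.hom_ext fun _ _ => rfl

/-- The morphism `D ↦ ∂_D` from `S(spo(V))` to the differential operators with constant
coefficients, extending `X ↦ ∂_X`. -/
def diffOp (B : SymplecticForm V₀ V₁) : SSpo B →ₐ[ℝ] Module.End ℂ (SuperFun B) :=
  SuperSym.lift (A := Module.End ℂ (SuperFun B)) (partialEven B) (partialOdd B) (partialEven_commute B) (partialOdd_sq B)
    (partialEven_partialOdd_commute B)

/-! ### The superPfaffian -/

/-- An oriented symplectic system of coordinates on `V`, where `dim V = (2r, n)`: a symplectic
basis of `V₀`, and a basis `(ξ¹, …, ξⁿ)` of `V₁* ⊗ ℂ` dual to an orthonormal basis of `V₁ ⊗ ℂ`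
whose elements belong to `V₁ ∪ i V₁`. The orientation of `V₁` is `ξ¹ ⋯ ξⁿ`. -/
structure OrientedCoordinates (B : SymplecticForm V₀ V₁) (r n : ℕ) where
  e : Basis (Fin r ⊕ Fin r) ℝ V₀
  ξ : Basis (Fin n) ℂ (V₁ →ₗ[ℝ] ℂ)
  left_left : ∀ i j, B.even (e (.inl i)) (e (.inl j)) = 0
  right_right : ∀ i j, B.even (e (.inr i)) (e (.inr j)) = 0
  left_right : ∀ i j, B.even (e (.inl i)) (e (.inr j)) = if i = j then 1 else 0
  real_or_imaginary : ∀ j, (∀ v, (ξ j v).im = 0) ∨ (∀ v, (ξ j v).re = 0)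
  orthonormal : ∀ v w, (B.odd v w : ℂ) = ∑ j, ξ j v * ξ j w

/-- The complexified exterior algebra of `spo(V)₁* ⊕ V₁*`: functions of the odd variables. -/
abbrev OddForms₂ (B : SymplecticForm V₀ V₁) : Type _ :=
  ExteriorAlgebra ℂ ((SpoOdd B →ₗ[ℝ] ℂ) × (V₁ →ₗ[ℝ] ℂ))

/-- A real linear form as a complex valued one. -/
def complexify {W : Type*} [AddCommGroup W] [Module ℝ W] (φ : Dual ℝ W) : W →ₗ[ℝ] ℂ :=
  Algebra.linearMap ℝ ℂ ∘ₗ φ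

/-- An odd coordinate `ζʲ` of `V`, dual to a basis `(gⱼ)` of `V₁`. -/
def vCoord (B : SymplecticForm V₀ V₁) (j : Fin (finrank ℝ V₁)) : OddForms₂ B :=
  ExteriorAlgebra.ι ℂ (0, complexify ((finBasis ℝ V₁).coord j))

/-- An odd coordinate `Z^k` of `spo(V)`, dual to a basis `(G_k)` of `spo(V)₁`. -/
def spoCoord (B : SymplecticForm V₀ V₁) (k : Fin (finrank ℝ (SpoOdd B))) : OddForms₂ B :=
  ExteriorAlgebra.ι ℂ (complexify ((finBasis ℝ (SpoOdd B)).coord k), 0)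

/-- The value of `B(v, X̂v) - B(v₀, X v₀)` at `X̂ = X + Ξ` and `v = v₀ + v₁`, where `X ∈ spo(V)₀`
and `v₀ ∈ V₀`, and where `Ξ = ∑ G_k Z^k` and `v₁ = ∑ gⱼ ζʲ` are the generic points of `spo(V)₁`
and of `V₁`. It is obtained from the rule `B(gᵢ ζⁱ, (G_k Z^k) gⱼ ζʲ) = B(gᵢ, G_k gⱼ) ζʲ Z^k ζⁱ`. -/
def nilpotentPart (B : SymplecticForm V₀ V₁) (X : SpoEven B) (v₀ : V₀) : OddForms₂ B :=
  (∑ i, ∑ j, (B.odd (finBasis ℝ V₁ i) (X.val (0, finBasis ℝ V₁ j)).2 : ℂ) •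
      (vCoord B j * vCoord B i)) +
    (∑ i, ∑ k, (B.odd (finBasis ℝ V₁ i) ((finBasis ℝ (SpoOdd B) k).1 (v₀, 0)).2 : ℂ) •
      (spoCoord B k * vCoord B i)) +
    ∑ j, ∑ k, (B.even v₀ ((finBasis ℝ (SpoOdd B) k).1 (0, finBasis ℝ V₁ j)).1 : ℂ) •
      (vCoord B j * spoCoord B k)

/-- The exponential of a nilpotent element. -/
def nilExp {A : Type*} [Ring A] [Algebra ℂ A] (a : A) : A :=
  ∑ᶠ k : ℕ, (k.factorial : ℂ)⁻¹ • a ^ k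

/-- The value of `exp(μ(X̂, v)) = exp(-½ B(v, X̂v))` at `X̂ = X + Ξ` and `v = v₀ + v₁`, where
`X ∈ spo(V)₀`, `v₀ ∈ V₀`, and `Ξ`, `v₁` are the generic points of `spo(V)₁` and `V₁`. -/
def expMoment (B : SymplecticForm V₀ V₁) (X : SpoEven B) (v₀ : V₀) : OddForms₂ B :=
  (Real.exp (-(1 / 2) * B.even v₀ (X.val (v₀, 0)).1) : ℂ) •
    nilExp ((-1 / 2 : ℂ) • nilpotentPart B X v₀)

/-- The Berezin integral `φ ↦ (∂/∂ξ¹ ⋯ ∂/∂ξⁿ φ)|_{ξ = 0}` over `V₁`, with values in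
`Λ(spo(V)₁*) ⊗ ℂ`. -/
def berezin {B : SymplecticForm V₀ V₁} {r n : ℕ} (c : OrientedCoordinates B r n) :
    OddForms₂ B →ₗ[ℂ] OddForms B :=
  (ExteriorAlgebra.map (LinearMap.fst ℂ (SpoOdd B →ₗ[ℝ] ℂ) (V₁ →ₗ[ℝ] ℂ))).toLinearMap ∘ₗ
    (List.ofFn fun j => (antiderivation (c.ξ.coord j ∘ₗ LinearMap.snd ℂ _ _) :
      Module.End ℂ (OddForms₂ B))).prod

/-- `F ∈ C^∞_{spo(V)}(𝒱⁺, ℂ)` is the superPfaffian: its value at the generic point `X̂ = X + Ξ`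
over any `X ∈ 𝒱⁺` is the (convergent) Liouville integral `∫_V d_V(v) exp(-½ B(v, X̂v))`, where
`d_V = (2π)^{-r} |dx¹ ⋯ dx^{2r}| d_ξ`. An integral with values in the finite dimensional space
`Λ(spo(V)₁*) ⊗ ℂ` is computed after composition with arbitrary linear forms `ℓ`. -/
def IsSuperPfaffian {B : SymplecticForm V₀ V₁} {r n : ℕ} (c : OrientedCoordinates B r n)
    (F : SuperFun B) : Prop :=
  ∀ X ∈ (posCone B).carrier, ∀ ℓ : Dual ℂ (OddForms B),
    MeasureTheory.Integrable (fun x : Fin r ⊕ Fin r → ℝ =>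
      ℓ (berezin c (expMoment B X (c.e.equivFun.symm x)))) ∧
    ℓ (evalAt X F) = ((2 * Real.pi) ^ r : ℂ)⁻¹ *
      ∫ x : Fin r ⊕ Fin r → ℝ, ℓ (berezin c (expMoment B X (c.e.equivFun.symm x)))

/-! ### The Casimir Laplacian -/

/-- The supertrace of an endomorphism of `V = V₀ ⊕ V₁`. -/
def str (M : EndV V₀ V₁) : ℝ :=
  LinearMap.trace ℝ V₀ (LinearMap.fst ℝ V₀ V₁ ∘ₗ M ∘ₗ LinearMap.inl ℝ V₀ V₁) -
    LinearMap.trace ℝ V₁ (LinearMap.snd ℝ V₀ V₁ ∘ₗ M ∘ₗ LinearMap.inr ℝ V₀ V₁)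

/-- The bilinear form `K(X, Y) = str(XY)` on `spo(V) = spo(V)₀ ⊕ spo(V)₁`. -/
def K (B : SymplecticForm V₀ V₁) (X Y : SpoEven B × SpoOdd B) : ℝ :=
  str ((X.1.val + X.2.val) * (Y.1.val + Y.2.val))

/-- `□_K = ∑ X'ᵢ Xᵢ ∈ S²(spo(V))`, for families `(Xᵢ)` and `(X'ᵢ)` in `spo(V)`. -/
def casimir (B : SymplecticForm V₀ V₁) {N : ℕ} (X X' : Fin N → SpoEven B × SpoOdd B) : SSpo B :=
  ∑ i, SuperSym.ι (X' i) * SuperSym.ι (X i)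

end SuperPfaffian

end

/-! The mechanism is differentiation under the integral sign. For `X` in `spo(V)` the derivation
`∂_X` multiplies `exp(μ(·, v))` by the function `μ̌(X)(v)`, so by induction on `D` the superfunction
`∂_D Spf` is the Liouville integral of `μ̌(D)(v) exp(-½ B(v, X̂v))`. This is
`IsLiouvilleIntegral.diffOp`. An odd `∂_X` must be moved past the `n` odd derivatives of the Berezin
integral, which costs `(-1)^n`; here `n` is even. Hence `∂_D Spf = 0` as soon as `μ̌(D) = 0`, and
the other assertions only require showing that certain `D` lie in the kernel of `μ̌`.

The map `μ̌` is equivariant and doubles degrees, so an invariant `D` of degree `k ≥ 1` gives an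
invariant `f = μ̌(D)` of degree `2k` in `S(V*)`. If `V₀ ≠ 0`, the rank one element attached to `v ∈
V₀` acts as a multiple of the field `B(v, ·) ∂_v`. A nonzero even linear form is not a zero divisor,
so `∂_v f = 0`; odd elements attached to `v ∈ V₀` and `w ∈ V₁` then give `∂_w f = 0`. All partial
derivatives of `f` vanish, and Euler's identity in positive degree gives `f = 0`
(`moment_eq_zero_of_even_ne_zero`).

If `V = V₁`, take an orthogonal basis and let `Nᵢ` be the projection onto the forms divisible by the
`i`-th coordinate. Invariance under rotations forces all `Nᵢ f` to coincide, and Euler's identity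
becomes `2k f = (dim V) Nᵢ f`. Since `Nᵢ` is idempotent, `Nᵢ f = 0` unless `2k = dim V`. When `2k =
dim V`, one has `Nᵢ f = f`, while the reflection in the `i`-th basis vector acts as `1 - 2Nᵢ`, that
is, by `-1` on `f`; invariance under `O(V)` kills `f` (`moment_eq_zero_of_even_eq_zero`).

For the Casimir element, pairing with `K` reads off the matrix coefficients of `X`, so `μ̌(□_K)` is
a combination of products of the even and odd parts of `B(v, v)` at the generic point. Both parts
vanish: one pairs an alternating form with commuting coordinates, the other a symmetric form with
anticommuting ones (`moment_casimir`).

The analytic side separates a real Gaussian from a factor of temperate growth. Positivity is uniform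
near each point of the cone, which gives integrable majorants. Differentiation in the parameter only
replaces one tempered factor by another, so smoothness follows by induction. The remaining values
lie in finite-dimensional exterior algebras and are tested against linear forms. -/

noncomputable section

namespace SuperPfaffian

/-! ### Induction principles for the symmetric superalgebra -/

namespace SuperSym

variable {W₀ W₁ A : Type*} [AddCommGroup W₀] [Module ℝ W₀] [AddCommGroup W₁] [Module ℝ W₁]
  [Ring A] [Algebra ℝ A]

/-- Induction on products of generators, for multiplicative predicates. -/
theorem gen_induction {p : SuperSym W₀ W₁ → Prop} (x : SuperSym W₀ W₁)
    (algebraMap : ∀ r : ℝ, p (algebraMap ℝ _ r)) (add : ∀ x y, p x → p y → p (x + y))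
    (mul : ∀ x y, p x → p y → p (x * y)) (gen₀ : ∀ y, p (ι₀ y)) (gen₁ : ∀ z, p (ι₁ z)) :
    p x := by
  induction x using induction_on with
  | zero => simpa using algebraMap 0
  | add a b ha hb => exact add _ _ ha hb
  | mul a b =>
    refine mul _ _ ?_ ?_
    · induction a using SymmetricAlgebra.induction with
      | algebraMap r => rw [AlgHom.commutes]; exact algebraMap r
      | mul a b ha hb => rw [map_mul]; exact mul _ _ ha hb
      | add a b ha hb => rw [map_add]; exact add _ _ ha hb
      | ι w => exact gen₀ w
    · induction b using ExteriorAlgebra.induction with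
      | algebraMap r => rw [AlgHom.commutes]; exact algebraMap r
      | mul a b ha hb => rw [map_mul]; exact mul _ _ ha hb
      | add a b ha hb => rw [map_add]; exact add _ _ ha hb
      | ι w => exact gen₁ w

/-- Induction on left multiplication by generators. -/
theorem left_induction {p : SuperSym W₀ W₁ → Prop} (x : SuperSym W₀ W₁)
    (algebraMap : ∀ r : ℝ, p (algebraMap ℝ _ r)) (add : ∀ x y, p x → p y → p (x + y))
    (mul₀ : ∀ y x, p x → p (ι₀ y * x)) (mul₁ : ∀ z x, p x → p (ι₁ z * x)) : p x := by
  -- The predicate is not assumed stable under products or scalars. The property "left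
  -- multiplication by `x` carries elements all of whose multiples satisfy `p` to elements of the
  -- same kind" is multiplicative in `x`, so `gen_induction` applies to it; the claim is the case `y
  -- = 1`.
  suffices h : ∀ y, (∀ r : ℝ, p (r • y)) → ∀ r : ℝ, p (r • (x * y)) by
    simpa using h 1 (fun r => by simpa [Algebra.algebraMap_eq_smul_one] using algebraMap r) 1
  induction x using gen_induction with
  | algebraMap s =>
    intro y hy r
    rw [← Algebra.smul_def, smul_smul]
    exact hy _
  | add a b ha hb =>
    intro y hy r
    rw [add_mul, smul_add]
    exact add _ _ (ha y hy r) (hb y hy r)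
  | mul a b ha hb =>
    intro y hy r
    rw [mul_assoc]
    exact ha _ (hb y hy) r
  | gen₀ w =>
    intro y hy r
    rw [← smul_mul_assoc, ← map_smul]
    exact mul₀ _ _ (by simpa using hy 1)
  | gen₁ w =>
    intro y hy r
    rw [← smul_mul_assoc, ← map_smul]
    exact mul₁ _ _ (by simpa using hy 1)

theorem algHom_ext {φ ψ : SuperSym W₀ W₁ →ₐ[ℝ] A} (h₀ : ∀ y, φ (ι₀ y) = ψ (ι₀ y))
    (h₁ : ∀ z, φ (ι₁ z) = ψ (ι₁ z)) : φ = ψ := by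
  ext x
  induction x using gen_induction with
  | algebraMap r => rw [AlgHom.commutes, AlgHom.commutes]
  | add a b ha hb => rw [map_add, map_add, ha, hb]
  | mul a b ha hb => rw [map_mul, map_mul, ha, hb]
  | gen₀ y => exact h₀ y
  | gen₁ z => exact h₁ z

theorem ι₀_eq_inl (y : W₀) : (ι₀ y : SuperSym W₀ W₁) = inl (SymmetricAlgebra.ι ℝ W₀ y) := rfl

theorem map_ι₀ (a : W₀ →ₗ[ℝ] W₀) (b : W₁ →ₗ[ℝ] W₁) (y : W₀) :
    map a b (ι₀ y) = ι₀ (a y) := lift_ι₀ _ _ _ _ _ _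

theorem map_ι₁ (a : W₀ →ₗ[ℝ] W₀) (b : W₁ →ₗ[ℝ] W₁) (z : W₁) :
    map a b (ι₁ z) = ι₁ (b z) := lift_ι₁ _ _ _ _ _ _

/-! #### Derivations read off from upper triangular representations -/

/-- The lower right entry of an upper triangular representation is multiplicative, so it is the
identity once it is so on generators. This is what turns the upper right entry into a derivation. -/
theorem upper_one_one (M : SuperSym W₀ W₁ →ₐ[ℝ] Matrix (Fin 2) (Fin 2) (SuperSym W₀ W₁))
    (h₀ : ∀ y, M (ι₀ y) 1 0 = 0 ∧ M (ι₀ y) 1 1 = ι₀ y)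
    (h₁ : ∀ z, M (ι₁ z) 1 0 = 0 ∧ M (ι₁ z) 1 1 = ι₁ z) (x : SuperSym W₀ W₁) : M x 1 1 = x := by
  induction x using left_induction with
  | algebraMap r => simp [Matrix.algebraMap_matrix_apply]
  | add a b ha hb => simp [ha, hb]
  | mul₀ y x hx => simp [Matrix.mul_apply, Fin.sum_univ_two, (h₀ y).1, (h₀ y).2, hx]
  | mul₁ z x hx => simp [Matrix.mul_apply, Fin.sum_univ_two, (h₁ z).1, (h₁ z).2, hx]

/-- A Leibniz rule twisted by the upper left entry: that entry is the identity for even derivations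
and the parity automorphism for odd ones. -/
theorem upper_mul_zero_one (M : SuperSym W₀ W₁ →ₐ[ℝ] Matrix (Fin 2) (Fin 2) (SuperSym W₀ W₁))
    (h₀ : ∀ y, M (ι₀ y) 1 0 = 0 ∧ M (ι₀ y) 1 1 = ι₀ y)
    (h₁ : ∀ z, M (ι₁ z) 1 0 = 0 ∧ M (ι₁ z) 1 1 = ι₁ z) (x y : SuperSym W₀ W₁) :
    M (x * y) 0 1 = M x 0 0 * M y 0 1 + M x 0 1 * y := by
  rw [map_mul, Matrix.mul_apply, Fin.sum_univ_two, upper_one_one M h₀ h₁ y]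

theorem upper_one_zero (M : SuperSym W₀ W₁ →ₐ[ℝ] Matrix (Fin 2) (Fin 2) (SuperSym W₀ W₁))
    (h₀ : ∀ y, M (ι₀ y) 1 0 = 0 ∧ M (ι₀ y) 1 1 = ι₀ y)
    (h₁ : ∀ z, M (ι₁ z) 1 0 = 0 ∧ M (ι₁ z) 1 1 = ι₁ z) (x : SuperSym W₀ W₁) : M x 1 0 = 0 := by
  induction x using left_induction with
  | algebraMap r => simp [Matrix.algebraMap_matrix_apply]
  | add a b ha hb => simp [ha, hb]
  | mul₀ y x hx => simp [Matrix.mul_apply, Fin.sum_univ_two, (h₀ y).1, hx]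
  | mul₁ z x hx => simp [Matrix.mul_apply, Fin.sum_univ_two, (h₁ z).1, hx]

theorem upper_mul_zero_zero (M : SuperSym W₀ W₁ →ₐ[ℝ] Matrix (Fin 2) (Fin 2) (SuperSym W₀ W₁))
    (h₀ : ∀ y, M (ι₀ y) 1 0 = 0 ∧ M (ι₀ y) 1 1 = ι₀ y)
    (h₁ : ∀ z, M (ι₁ z) 1 0 = 0 ∧ M (ι₁ z) 1 1 = ι₁ z) (x y : SuperSym W₀ W₁) :
    M (x * y) 0 0 = M x 0 0 * M y 0 0 := by
  rw [map_mul, Matrix.mul_apply, Fin.sum_univ_two, upper_one_zero M h₀ h₁ y, mul_zero, add_zero]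

section EvenDer

variable (a : W₀ →ₗ[ℝ] W₀) (b : W₁ →ₗ[ℝ] W₁)

theorem evenDerMatrix_ι₀ (y : W₀) :
    evenDerMatrix a b (ι₀ y) = !![ι₀ y, ι₀ (a y); 0, ι₀ y] := lift_ι₀ _ _ _ _ _ _

theorem evenDerMatrix_ι₁ (z : W₁) :
    evenDerMatrix a b (ι₁ z) = !![ι₁ z, ι₁ (b z); 0, ι₁ z] := lift_ι₁ _ _ _ _ _ _

theorem evenDerMatrix_mul_zero_one (x y : SuperSym W₀ W₁) :
    evenDerMatrix a b (x * y) 0 1 =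
      evenDerMatrix a b x 0 0 * evenDerMatrix a b y 0 1 + evenDerMatrix a b x 0 1 * y :=
  upper_mul_zero_one _ (fun y => by simp [evenDerMatrix_ι₀])
    (fun z => by simp [evenDerMatrix_ι₁]) x y

/-- Makes the twist in the Leibniz rule trivial for even linear maps. -/
theorem evenDerMatrix_zero_zero (x : SuperSym W₀ W₁) : evenDerMatrix a b x 0 0 = x := by
  induction x using left_induction with
  | algebraMap r => simp [Matrix.algebraMap_matrix_apply]
  | add x y hx hy => simp [hx, hy]
  | mul₀ y x hx =>
    rw [upper_mul_zero_zero _ (fun y => by simp [evenDerMatrix_ι₀])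
      (fun z => by simp [evenDerMatrix_ι₁]), hx]
    simp [evenDerMatrix_ι₀]
  | mul₁ z x hx =>
    rw [upper_mul_zero_zero _ (fun y => by simp [evenDerMatrix_ι₀])
      (fun z => by simp [evenDerMatrix_ι₁]), hx]
    simp [evenDerMatrix_ι₁]

theorem evenDer_mul (x y : SuperSym W₀ W₁) :
    evenDer a b (x * y) = x * evenDer a b y + evenDer a b x * y := by
  refine (evenDerMatrix_mul_zero_one a b x y).trans ?_
  rw [evenDerMatrix_zero_zero]
  rfl

@[simp] theorem evenDer_algebraMap (r : ℝ) : evenDer a b (algebraMap ℝ _ r) = 0 := by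
  simp [evenDer, Matrix.algebraMap_matrix_apply]

theorem evenDer_ι₀ (y : W₀) : evenDer a b (ι₀ y) = ι₀ (a y) := by
  simp [evenDer, evenDerMatrix_ι₀]

theorem evenDer_ι₁ (z : W₁) : evenDer a b (ι₁ z) = ι₁ (b z) := by
  simp [evenDer, evenDerMatrix_ι₁]

theorem evenDer_ι₀_mul (y : W₀) (x : SuperSym W₀ W₁) :
    evenDer a b (ι₀ y * x) = ι₀ y * evenDer a b x + ι₀ (a y) * x := by
  refine (evenDerMatrix_mul_zero_one a b (ι₀ y) x).trans ?_
  simp [evenDerMatrix_ι₀, evenDer]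

theorem evenDer_ι₁_mul (z : W₁) (x : SuperSym W₀ W₁) :
    evenDer a b (ι₁ z * x) = ι₁ z * evenDer a b x + ι₁ (b z) * x := by
  refine (evenDerMatrix_mul_zero_one a b (ι₁ z) x).trans ?_
  simp [evenDerMatrix_ι₁, evenDer]

end EvenDer

section OddDer

variable (a : W₀ →ₗ[ℝ] W₁) (b : W₁ →ₗ[ℝ] W₀)

theorem oddDerMatrix_ι₀ (y : W₀) :
    oddDerMatrix a b (ι₀ y) = !![ι₀ y, ι₁ (a y); 0, ι₀ y] := lift_ι₀ _ _ _ _ _ _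

theorem oddDerMatrix_ι₁ (z : W₁) :
    oddDerMatrix a b (ι₁ z) = !![-ι₁ z, ι₀ (b z); 0, ι₁ z] := by
  rw [oddDerMatrix, lift_ι₁]
  simp [upper]

theorem oddDerMatrix_mul_zero_one (x y : SuperSym W₀ W₁) :
    oddDerMatrix a b (x * y) 0 1 =
      oddDerMatrix a b x 0 0 * oddDerMatrix a b y 0 1 + oddDerMatrix a b x 0 1 * y :=
  upper_mul_zero_one _ (fun y => by simp [oddDerMatrix_ι₀])
    (fun z => by simp [oddDerMatrix_ι₁]) x y

theorem oddDerMatrix_mul_zero_zero (x y : SuperSym W₀ W₁) :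
    oddDerMatrix a b (x * y) 0 0 = oddDerMatrix a b x 0 0 * oddDerMatrix a b y 0 0 :=
  upper_mul_zero_zero _ (fun y => by simp [oddDerMatrix_ι₀])
    (fun z => by simp [oddDerMatrix_ι₁]) x y

/-- The upper left entry plays the role of the sign `(-1)^{p(x)}` and makes sense for inhomogeneous
`x`. -/
theorem oddDer_mul (x y : SuperSym W₀ W₁) :
    oddDer a b (x * y) = oddDerMatrix a b x 0 0 * oddDer a b y + oddDer a b x * y :=
  oddDerMatrix_mul_zero_one a b x y

theorem oddDer_ι₀ (y : W₀) : oddDer a b (ι₀ y) = ι₁ (a y) := by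
  simp [oddDer, oddDerMatrix_ι₀]

theorem oddDer_ι₁ (z : W₁) : oddDer a b (ι₁ z) = ι₀ (b z) := by
  simp [oddDer, oddDerMatrix_ι₁]

@[simp] theorem oddDer_algebraMap (r : ℝ) : oddDer a b (algebraMap ℝ _ r) = 0 := by
  simp [oddDer, Matrix.algebraMap_matrix_apply]

theorem oddDer_ι₀_mul (y : W₀) (x : SuperSym W₀ W₁) :
    oddDer a b (ι₀ y * x) = ι₀ y * oddDer a b x + ι₁ (a y) * x := by
  refine (oddDerMatrix_mul_zero_one a b (ι₀ y) x).trans ?_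
  simp [oddDerMatrix_ι₀, oddDer]

theorem oddDer_ι₁_mul (z : W₁) (x : SuperSym W₀ W₁) :
    oddDer a b (ι₁ z * x) = -(ι₁ z * oddDer a b x) + ι₀ (b z) * x := by
  refine (oddDerMatrix_mul_zero_one a b (ι₁ z) x).trans ?_
  simp [oddDerMatrix_ι₁, oddDer]

end OddDer

/-! #### Partial derivatives -/

/-- The scalar valued linear map `x ↦ l x` into an algebra. -/
def scalar {W : Type*} [AddCommGroup W] [Module ℝ W] (l : Dual ℝ W) : W →ₗ[ℝ] A :=
  Algebra.linearMap ℝ A ∘ₗ l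

/-- The algebra morphism `x ↦ !![x, ∂ x; 0, x]`, where `∂` is the derivation of `S(W)` that
vanishes on `W₁` and is equal to `l` on `W₀`. -/
def evenPartialMatrix (l : Dual ℝ W₀) :
    SuperSym W₀ W₁ →ₐ[ℝ] Matrix (Fin 2) (Fin 2) (SuperSym W₀ W₁) :=
  lift (upper ι₀ (scalar l) ι₀) (upper ι₁ 0 ι₁)
    (fun x y => upper_commute _ _ _ _ _ _ _ _ (ι₀_commute _ _) (ι₀_commute _ _) (by
      rw [(ι₀_commute x _).eq, (ι₀_commute y _).eq, add_comm]))
    (fun z => upper_sq _ _ _ _ (ι₁_sq z) (ι₁_sq z) (by simp))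
    (fun y z => upper_commute _ _ _ _ _ _ _ _ (ι₀_commute _ _) (ι₀_commute _ _) (by
      simp [scalar, Algebra.commutes]))

/-- The derivation of `S(W)` that vanishes on `W₁` and is equal to `l` on `W₀`. -/
def evenPartial (l : Dual ℝ W₀) : SuperSym W₀ W₁ →ₗ[ℝ] SuperSym W₀ W₁ where
  toFun x := evenPartialMatrix l x 0 1
  map_add' x y := by simp
  map_smul' c x := by simp

/-- The algebra morphism `x ↦ !![σ x, ∂ x; 0, x]`, where `∂` is the odd superderivation of `S(W)`
that vanishes on `W₀` and is equal to `l` on `W₁`. -/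
def oddPartialMatrix (l : Dual ℝ W₁) :
    SuperSym W₀ W₁ →ₐ[ℝ] Matrix (Fin 2) (Fin 2) (SuperSym W₀ W₁) :=
  lift (upper ι₀ 0 ι₀) (upper (-ι₁) (scalar l) ι₁)
    (fun x y => upper_commute _ _ _ _ _ _ _ _ (ι₀_commute _ _) (ι₀_commute _ _) (by simp))
    (fun z => upper_sq _ _ _ _ (by simp [ι₁_sq]) (ι₁_sq z) (by
      simp [scalar, Algebra.commutes]))
    (fun y z => upper_commute _ _ _ _ _ _ _ _ (ι₀_commute _ _) (ι₀_commute _ _) (by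
      simp [scalar, Algebra.commutes]))

/-- The odd superderivation of `S(W)` that vanishes on `W₀` and is equal to `l` on `W₁`. -/
def oddPartial (l : Dual ℝ W₁) : SuperSym W₀ W₁ →ₗ[ℝ] SuperSym W₀ W₁ where
  toFun x := oddPartialMatrix l x 0 1
  map_add' x y := by simp
  map_smul' c x := by simp

section EvenPartial

variable (l : Dual ℝ W₀)

theorem evenPartialMatrix_ι₀ (y : W₀) : (evenPartialMatrix l (ι₀ y) : Matrix _ _ (SuperSym W₀ W₁)) =
    !![ι₀ y, algebraMap ℝ _ (l y); 0, ι₀ y] := lift_ι₀ _ _ _ _ _ _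

theorem evenPartialMatrix_ι₁ (z : W₁) : (evenPartialMatrix l (ι₁ z) : Matrix _ _ (SuperSym W₀ W₁)) =
    !![ι₁ z, 0; 0, ι₁ z] := lift_ι₁ _ _ _ _ _ _

theorem evenPartialMatrix_mul_zero_one (x y : SuperSym W₀ W₁) :
    evenPartialMatrix l (x * y) 0 1 =
      evenPartialMatrix l x 0 0 * evenPartialMatrix l y 0 1 + evenPartialMatrix l x 0 1 * y :=
  upper_mul_zero_one _ (fun y => by simp [evenPartialMatrix_ι₀])
    (fun z => by simp [evenPartialMatrix_ι₁]) x y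

@[simp] theorem evenPartial_algebraMap (r : ℝ) :
    evenPartial l (algebraMap ℝ (SuperSym W₀ W₁) r) = 0 := by
  simp [evenPartial, Matrix.algebraMap_matrix_apply]

theorem evenPartial_ι₀_mul (y : W₀) (x : SuperSym W₀ W₁) :
    evenPartial l (ι₀ y * x) = ι₀ y * evenPartial l x + l y • x := by
  refine (evenPartialMatrix_mul_zero_one l (ι₀ y) x).trans ?_
  simp [evenPartialMatrix_ι₀, evenPartial, Algebra.smul_def]

theorem evenPartial_ι₁_mul (z : W₁) (x : SuperSym W₀ W₁) :
    evenPartial l (ι₁ z * x) = ι₁ z * evenPartial l x := by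
  refine (evenPartialMatrix_mul_zero_one l (ι₁ z) x).trans ?_
  simp [evenPartialMatrix_ι₁, evenPartial]

end EvenPartial

section OddPartial

variable (l : Dual ℝ W₁)

theorem oddPartialMatrix_ι₀ (y : W₀) : (oddPartialMatrix l (ι₀ y) : Matrix _ _ (SuperSym W₀ W₁)) =
    !![ι₀ y, 0; 0, ι₀ y] := lift_ι₀ _ _ _ _ _ _

theorem oddPartialMatrix_ι₁ (z : W₁) : (oddPartialMatrix l (ι₁ z) : Matrix _ _ (SuperSym W₀ W₁)) =
    !![-ι₁ z, algebraMap ℝ _ (l z); 0, ι₁ z] := lift_ι₁ _ _ _ _ _ _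

theorem oddPartialMatrix_mul_zero_one (x y : SuperSym W₀ W₁) :
    oddPartialMatrix l (x * y) 0 1 =
      oddPartialMatrix l x 0 0 * oddPartialMatrix l y 0 1 + oddPartialMatrix l x 0 1 * y :=
  upper_mul_zero_one _ (fun y => by simp [oddPartialMatrix_ι₀])
    (fun z => by simp [oddPartialMatrix_ι₁]) x y

@[simp] theorem oddPartial_algebraMap (r : ℝ) :
    oddPartial l (algebraMap ℝ (SuperSym W₀ W₁) r) = 0 := by
  simp [oddPartial, Matrix.algebraMap_matrix_apply]

theorem oddPartial_ι₀_mul (y : W₀) (x : SuperSym W₀ W₁) :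
    oddPartial l (ι₀ y * x) = ι₀ y * oddPartial l x := by
  refine (oddPartialMatrix_mul_zero_one l (ι₀ y) x).trans ?_
  simp [oddPartialMatrix_ι₀, oddPartial]

theorem oddPartial_ι₁_mul (z : W₁) (x : SuperSym W₀ W₁) :
    oddPartial l (ι₁ z * x) = -(ι₁ z * oddPartial l x) + l z • x := by
  refine (oddPartialMatrix_mul_zero_one l (ι₁ z) x).trans ?_
  simp [oddPartialMatrix_ι₁, oddPartial, Algebra.smul_def]

end OddPartial

theorem ι₁_mul_ι₁_mul (z w : W₁) (x : SuperSym W₀ W₁) :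
    ι₁ z * (ι₁ w * x) = -(ι₁ w * (ι₁ z * x)) := by
  rw [← mul_assoc, eq_neg_of_add_eq_zero_left (ι₁_anticomm z w), neg_mul, mul_assoc]

theorem ι₀_mul_left_comm (y : W₀) (s x : SuperSym W₀ W₁) :
    ι₀ y * (s * x) = s * (ι₀ y * x) := by
  rw [← mul_assoc, (ι₀_commute y s).eq, mul_assoc]

theorem oddPartial_oddPartial (l l' : Dual ℝ W₁) (x : SuperSym W₀ W₁) :
    oddPartial l (oddPartial l' x) = -oddPartial l' (oddPartial l x) := by
  induction x using left_induction with
  | algebraMap r => simp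
  | add x y hx hy => simp only [map_add, hx, hy, neg_add]
  | mul₀ y x hx => simp only [oddPartial_ι₀_mul, hx, mul_neg]
  | mul₁ z x hx =>
    simp only [oddPartial_ι₁_mul, map_add, map_neg, map_smul, hx, mul_neg]
    abel

/-! #### The Euler field -/

section Euler

/-- By the Leibniz rule, each of the `k` factors of a product of generators contributes one copy of
the product. -/
theorem euler_of_mem_homogeneous {k : ℕ} {x : SuperSym W₀ W₁} (hx : x ∈ homogeneous W₀ W₁ k) :
    evenDer LinearMap.id LinearMap.id x = (k : ℝ) • x := by
  induction hx using Submodule.pow_induction_on_left' with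
  | algebraMap r => simp
  | add x y i _ _ hx hy => rw [map_add, hx, hy, smul_add]
  | mem_mul m hm i x _ hx =>
    obtain ⟨w, rfl⟩ := hm
    have h : (ι w : SuperSym W₀ W₁) = ι₀ w.1 + ι₁ w.2 := rfl
    rw [h, add_mul, map_add, evenDer_ι₀_mul, evenDer_ι₁_mul, hx]
    simp only [LinearMap.id_apply, mul_smul_comm, Nat.succ_eq_add_one, Nat.cast_add, Nat.cast_one,
      add_smul, one_smul, smul_add]

/-- Both sides are the derivation that is the identity on generators; the right side is the Euler
field in coordinates. It converts information on partial derivatives into information on the element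
itself. -/
theorem euler_eq_sum {I J : Type*} [Fintype I] [Fintype J] (b₀ : Basis I ℝ W₀) (b₁ : Basis J ℝ W₁)
    (x : SuperSym W₀ W₁) :
    evenDer LinearMap.id LinearMap.id x = ∑ i, ι₀ (b₀ i) * evenPartial (b₀.coord i) x +
      ∑ j, ι₁ (b₁ j) * oddPartial (b₁.coord j) x := by
  induction x using left_induction with
  | algebraMap r => simp
  | add x y hx hy => simp only [map_add, hx, hy, mul_add, Finset.sum_add_distrib]; abel
  | mul₀ y x hx =>
    rw [evenDer_ι₀_mul, hx]
    simp only [evenPartial_ι₀_mul, oddPartial_ι₀_mul, mul_add, Finset.sum_add_distrib,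
      Finset.mul_sum]
    have h : ι₀ y * x = ∑ i, ι₀ (b₀ i) * (b₀.coord i) y • x := by
      have h2 : (ι₀ y : SuperSym W₀ W₁) = ∑ i, b₀.repr y i • ι₀ (b₀ i) := by
        simp only [← map_smul, ← map_sum, b₀.sum_repr]
      rw [h2, Finset.sum_mul]
      exact Finset.sum_congr rfl fun i _ => by rw [smul_mul_assoc, mul_smul_comm]; rfl
    rw [LinearMap.id_apply, h]
    simp only [ι₀_mul_left_comm y]
    abel
  | mul₁ z x hx =>
    rw [evenDer_ι₁_mul, hx]
    simp only [evenPartial_ι₁_mul, oddPartial_ι₁_mul, mul_add, Finset.sum_add_distrib,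
      Finset.mul_sum, ι₀_mul_left_comm, mul_neg]
    have h : ι₁ z * x = ∑ j, ι₁ (b₁ j) * (b₁.coord j) z • x := by
      have h2 : (ι₁ z : SuperSym W₀ W₁) = ∑ j, b₁.repr z j • ι₁ (b₁ j) := by
        simp only [← map_smul, ← map_sum, b₁.sum_repr]
      rw [h2, Finset.sum_mul]
      exact Finset.sum_congr rfl fun j _ => by rw [smul_mul_assoc, mul_smul_comm]; rfl
    rw [LinearMap.id_apply, h]
    simp only [ι₁_mul_ι₁_mul z]
    abel

/-- An element of positive degree all of whose partial derivatives vanish is zero. -/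
theorem eq_zero_of_partials [FiniteDimensional ℝ W₀] [FiniteDimensional ℝ W₁] {k : ℕ}
    (hk : k ≠ 0) {x : SuperSym W₀ W₁} (hx : x ∈ homogeneous W₀ W₁ k)
    (h₀ : ∀ l, evenPartial l x = 0) (h₁ : ∀ l, oddPartial l x = 0) : x = 0 := by
  have h := euler_eq_sum (finBasis ℝ W₀) (finBasis ℝ W₁) x
  simp only [h₀, h₁, mul_zero, Finset.sum_const_zero, add_zero, euler_of_mem_homogeneous hx] at h
  exact (smul_eq_zero.1 h).resolve_left (by exact_mod_cast hk)

end Euler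

/-- Nonzero elements of `W₀` are not zero divisors. -/
theorem eq_zero_of_ι₀_mul [FiniteDimensional ℝ W₀] {y : W₀} (hy : y ≠ 0) {x : SuperSym W₀ W₁}
    (h : ι₀ y * x = 0) : x = 0 := by
  -- `S(W₀)` is a polynomial ring, hence a domain, so multiplication by a nonzero `y` is injective
  -- on it. That `y` remains nonzero there is seen by extending a linear form with `φ y ≠ 0`.
  let e := SymmetricAlgebra.equivMvPolynomial (finBasis ℝ W₀)
  have hne : SymmetricAlgebra.ι ℝ W₀ y ≠ 0 := by
    intro h0
    obtain ⟨φ, hφ⟩ : ∃ φ : Dual ℝ W₀, φ y ≠ 0 := by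
      by_contra! hc
      exact hy ((forall_dual_apply_eq_zero_iff ℝ y).1 hc)
    have := congrArg (SymmetricAlgebra.lift φ) h0
    rw [SymmetricAlgebra.lift_ι_apply, map_zero] at this
    exact hφ this
  have hinj : Function.Injective (LinearMap.mulLeft ℝ (SymmetricAlgebra.ι ℝ W₀ y)) := by
    rw [← LinearMap.ker_eq_bot, LinearMap.ker_eq_bot']
    intro a ha
    have h1 : e (SymmetricAlgebra.ι ℝ W₀ y) * e a = 0 := by
      rw [← map_mul]
      exact (congrArg e ha).trans (map_zero e)
    rcases mul_eq_zero.1 h1 with h2 | h2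
    · exact absurd (e.injective (h2.trans (map_zero e).symm)) hne
    · exact e.injective (h2.trans (map_zero e).symm)
  -- Multiplication by `y` on `S(W₀) ⊗ Λ(W₁)` is its multiplication on the first factor tensored
  -- with the identity, and injectivity survives because `Λ(W₁)` is flat over `ℝ`.
  have hT := Module.Flat.rTensor_preserves_injective_linearMap
    (M := ExteriorAlgebra ℝ W₁) _ hinj
  have key : ∀ x : SuperSym W₀ W₁, equivTensor W₀ W₁ (ι₀ y * x) =
      LinearMap.rTensor (ExteriorAlgebra ℝ W₁)
        (LinearMap.mulLeft ℝ (SymmetricAlgebra.ι ℝ W₀ y)) (equivTensor W₀ W₁ x) := by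
    intro x
    induction x using induction_on with
    | zero => simp
    | add a b ha hb => rw [mul_add, map_add, map_add, ha, hb, map_add]
    | mul a b =>
      rw [ι₀_eq_inl, ← mul_assoc, ← map_mul, inl_mul_inr, inl_mul_inr, AlgEquiv.apply_symm_apply,
        AlgEquiv.apply_symm_apply, LinearMap.rTensor_tmul, LinearMap.mulLeft_apply]
  have h2 := key x
  rw [h, map_zero] at h2
  have h3 := hT (h2.symm.trans (map_zero _).symm)
  exact (equivTensor W₀ W₁).injective (h3.trans (map_zero _).symm)

end SuperSym
end SuperPfaffian
end

noncomputable section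

set_option linter.unusedSectionVars false

namespace SuperPfaffian

variable {V₀ V₁ : Type*} [AddCommGroup V₀] [Module ℝ V₀] [FiniteDimensional ℝ V₀]
  [AddCommGroup V₁] [Module ℝ V₁] [FiniteDimensional ℝ V₁]

/-! ### The moment map in terms of the blocks of an endomorphism -/

/-- The block `V₀ → V₀` of an endomorphism of `V`. -/
def block₀₀ : EndV V₀ V₁ →ₗ[ℝ] V₀ →ₗ[ℝ] V₀ where
  toFun X := LinearMap.fst ℝ V₀ V₁ ∘ₗ X ∘ₗ LinearMap.inl ℝ V₀ V₁
  map_add' _ _ := rfl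
  map_smul' _ _ := rfl

/-- The block `V₀ → V₁` of an endomorphism of `V`. -/
def block₁₀ : EndV V₀ V₁ →ₗ[ℝ] V₀ →ₗ[ℝ] V₁ where
  toFun X := LinearMap.snd ℝ V₀ V₁ ∘ₗ X ∘ₗ LinearMap.inl ℝ V₀ V₁
  map_add' _ _ := rfl
  map_smul' _ _ := rfl

/-- The block `V₁ → V₀` of an endomorphism of `V`. -/
def block₀₁ : EndV V₀ V₁ →ₗ[ℝ] V₁ →ₗ[ℝ] V₀ where
  toFun X := LinearMap.fst ℝ V₀ V₁ ∘ₗ X ∘ₗ LinearMap.inr ℝ V₀ V₁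
  map_add' _ _ := rfl
  map_smul' _ _ := rfl

/-- The block `V₁ → V₁` of an endomorphism of `V`. -/
def block₁₁ : EndV V₀ V₁ →ₗ[ℝ] V₁ →ₗ[ℝ] V₁ where
  toFun X := LinearMap.snd ℝ V₀ V₁ ∘ₗ X ∘ₗ LinearMap.inr ℝ V₀ V₁
  map_add' _ _ := rfl
  map_smul' _ _ := rfl

theorem block₀₀_apply (X : EndV V₀ V₁) (v : V₀) : block₀₀ X v = (X (v, 0)).1 := rfl

theorem block₁₀_apply (X : EndV V₀ V₁) (v : V₀) : block₁₀ X v = (X (v, 0)).2 := rfl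

theorem block₀₁_apply (X : EndV V₀ V₁) (w : V₁) : block₀₁ X w = (X (0, w)).1 := rfl

theorem block₁₁_apply (X : EndV V₀ V₁) (w : V₁) : block₁₁ X w = (X (0, w)).2 := rfl

theorem SpoEven.val_inl {B : SymplecticForm V₀ V₁} (X : SpoEven B) (v : V₀) :
    X.val (v, 0) = (block₀₀ X.val v, 0) := Prod.ext rfl (X.prop.1 v)

theorem SpoEven.val_inr {B : SymplecticForm V₀ V₁} (X : SpoEven B) (w : V₁) :
    X.val (0, w) = (0, block₁₁ X.val w) := Prod.ext (X.prop.2.1 w) rfl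

theorem SpoOdd.val_inl {B : SymplecticForm V₀ V₁} (X : SpoOdd B) (v : V₀) :
    X.val (v, 0) = (0, block₁₀ X.val v) := Prod.ext (X.prop.1 v) rfl

theorem SpoOdd.val_inr {B : SymplecticForm V₀ V₁} (X : SpoOdd B) (w : V₁) :
    X.val (0, w) = (block₀₁ X.val w, 0) := Prod.ext rfl (X.prop.2.1 w)

theorem SpoEven.skew₀ {B : SymplecticForm V₀ V₁} (X : SpoEven B) (v w : V₀) :
    B.even v (block₀₀ X.val w) = -B.even (block₀₀ X.val v) w := by
  have h := X.prop.2.2 (v, 0) (w, 0)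
  rw [X.val_inl, X.val_inl] at h
  simp only [SymplecticForm.form, map_zero, add_zero] at h
  linarith

theorem SpoEven.skew₁ {B : SymplecticForm V₀ V₁} (X : SpoEven B) (v w : V₁) :
    B.odd v (block₁₁ X.val w) = -B.odd (block₁₁ X.val v) w := by
  have h := X.prop.2.2 (0, v) (0, w)
  rw [X.val_inr, X.val_inr] at h
  simp only [SymplecticForm.form, map_zero, zero_add] at h
  linarith

theorem SpoOdd.skew₀ {B : SymplecticForm V₀ V₁} (X : SpoOdd B) (v : V₀) (w : V₁) :
    B.even v (block₀₁ X.val w) = -B.odd (block₁₀ X.val v) w := by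
  have h := X.prop.2.2 (v, 0) (0, w)
  rw [X.val_inl, X.val_inr] at h
  simp only [SymplecticForm.form, map_zero, add_zero, zero_add] at h
  linarith

theorem SpoOdd.skew₁ {B : SymplecticForm V₀ V₁} (X : SpoOdd B) (w : V₁) (v : V₀) :
    B.odd w (block₁₀ X.val v) = B.even (block₀₁ X.val w) v := by
  have h := X.prop.2.2 (0, w) (v, 0)
  rw [X.val_inl, X.val_inr] at h
  simp only [SymplecticForm.form, map_zero, add_zero, zero_add, map_neg,
    LinearMap.neg_apply] at h
  linarith

/-- The isomorphism `v ↦ B(v, ·)` of `V₀` with `V₀*`, with values in `S(V*)`. -/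
def low₀ (B : SymplecticForm V₀ V₁) : V₀ →ₗ[ℝ] SDual V₀ V₁ := SuperSym.ι₀ ∘ₗ B.even

/-- The isomorphism `v ↦ B(v, ·)` of `V₁` with `V₁*`, with values in `S(V*)`. -/
def low₁ (B : SymplecticForm V₀ V₁) : V₁ →ₗ[ℝ] SDual V₀ V₁ := SuperSym.ι₁ ∘ₗ B.odd

/-- The contraction `∑ L(gᵢ) zⁱ`, where `(zⁱ)` is the basis dual to the basis `(gᵢ)` of `V₀`. -/
def contr₀ : (V₀ →ₗ[ℝ] SDual V₀ V₁) →ₗ[ℝ] SDual V₀ V₁ where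
  toFun L := ∑ i, L (finBasis ℝ V₀ i) * evenCoord i
  map_add' L L' := by simp [add_mul, Finset.sum_add_distrib]
  map_smul' c L := by simp [Finset.smul_sum]

/-- The contraction `∑ L(gᵢ) zⁱ`, where `(zⁱ)` is the basis dual to the basis `(gᵢ)` of `V₁`. -/
def contr₁ : (V₁ →ₗ[ℝ] SDual V₀ V₁) →ₗ[ℝ] SDual V₀ V₁ where
  toFun L := ∑ i, L (finBasis ℝ V₁ i) * oddCoord i
  map_add' L L' := by simp [add_mul, Finset.sum_add_distrib]
  map_smul' c L := by simp [Finset.smul_sum]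

theorem contr₀_apply (L : V₀ →ₗ[ℝ] SDual V₀ V₁) :
    contr₀ L = ∑ i, L (finBasis ℝ V₀ i) * evenCoord i := rfl

theorem contr₁_apply (L : V₁ →ₗ[ℝ] SDual V₀ V₁) :
    contr₁ L = ∑ i, L (finBasis ℝ V₁ i) * oddCoord i := rfl

/-- A linear form on `W` is expressed in the basis dual to a basis of `W`. -/
theorem sum_apply_smul_map_coord {W I A : Type*} [AddCommGroup W] [Module ℝ W] [Fintype I]
    [AddCommGroup A] [Module ℝ A] (g : Basis I ℝ W) (F : Dual ℝ W →ₗ[ℝ] A) (c : Dual ℝ W) :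
    ∑ i, c (g i) • F (g.coord i) = F c := by
  classical
  have h := congrArg F (g.sum_dual_apply_smul_coord c)
  rwa [map_sum, Finset.sum_congr rfl fun i _ => F.map_smul (c (g i)) (g.coord i)] at h

/-- The canonical tensor `∑ gᵢ ⊗ zⁱ` intertwines a linear map and its transpose. -/
theorem sum_mul_map_coord_comp {U W I J A : Type*} [AddCommGroup U] [Module ℝ U] [AddCommGroup W]
    [Module ℝ W] [Fintype I] [Fintype J] [Ring A] [Algebra ℝ A] (g : Basis I ℝ W)
    (h : Basis J ℝ U) (L : W →ₗ[ℝ] A) (F : Dual ℝ U →ₗ[ℝ] A) (t : U →ₗ[ℝ] W) :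
    ∑ i, L (g i) * F (g.coord i ∘ₗ t) = ∑ j, L (t (h j)) * F (h.coord j) := by
  simp_rw [← sum_apply_smul_map_coord h F (g.coord _ ∘ₗ t), Finset.mul_sum]
  rw [Finset.sum_comm]
  refine Finset.sum_congr rfl fun j _ => ?_
  conv_rhs => rw [← g.sum_repr (t (h j)), map_sum, Finset.sum_mul]
  exact Finset.sum_congr rfl fun i _ => by
    rw [map_smul, smul_mul_assoc, mul_smul_comm]; rfl

/-- Summing over `j` first and using skewness of `X` turns the quadratic form into the contraction
of `B(X ·, ·)` with the canonical tensor `∑ gᵢ ⊗ zⁱ`. In this form derivations act by composition of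
endomorphisms, independently of the basis. -/
theorem momentEven_eq (B : SymplecticForm V₀ V₁) (X : SpoEven B) :
    momentEven B X = (1 / 2 : ℝ) • (contr₀ (low₀ B ∘ₗ block₀₀ X.val) +
      contr₁ (low₁ B ∘ₗ block₁₁ X.val)) := by
  have h₀ (i) : (∑ j, B.even (finBasis ℝ V₀ i) (X.val (finBasis ℝ V₀ j, 0)).1 •
      (evenCoord j * evenCoord i : SDual V₀ V₁)) =
      -(low₀ B (block₀₀ X.val (finBasis ℝ V₀ i)) * evenCoord i) := by
    rw [low₀, LinearMap.comp_apply,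
      ← sum_apply_smul_map_coord (finBasis ℝ V₀) (SuperSym.ι₀ (W₁ := Dual ℝ V₁)),
      Finset.sum_mul, ← Finset.sum_neg_distrib]
    refine Finset.sum_congr rfl fun j _ => ?_
    rw [← block₀₀_apply, X.skew₀, neg_smul, smul_mul_assoc]
    rfl
  have h₁ (i) : (∑ j, B.odd (finBasis ℝ V₁ i) (X.val (0, finBasis ℝ V₁ j)).2 •
      (oddCoord j * oddCoord i : SDual V₀ V₁)) =
      -(low₁ B (block₁₁ X.val (finBasis ℝ V₁ i)) * oddCoord i) := by
    rw [low₁, LinearMap.comp_apply,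
      ← sum_apply_smul_map_coord (finBasis ℝ V₁) (SuperSym.ι₁ (W₀ := Dual ℝ V₀)),
      Finset.sum_mul, ← Finset.sum_neg_distrib]
    refine Finset.sum_congr rfl fun j _ => ?_
    rw [← block₁₁_apply, X.skew₁, neg_smul, smul_mul_assoc]
    rfl
  change (-1 / 2 : ℝ) • (_ : SDual V₀ V₁) = _
  simp only [h₀, h₁, contr₀_apply, contr₁_apply, Finset.sum_neg_distrib, LinearMap.comp_apply]
  module

/-- The two off-diagonal blocks of an odd `X` determine each other, and skewness makes the two terms
of the difference equal; the resulting factor `-2` cancels `-½`. -/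
theorem momentOdd_eq₀ (B : SymplecticForm V₀ V₁) (X : SpoOdd B) :
    momentOdd B X = contr₀ (low₁ B ∘ₗ block₁₀ X.val) := by
  change (-1 / 2 : ℝ) • (_ : SDual V₀ V₁) = _
  rw [contr₀_apply, Finset.smul_sum]
  refine Finset.sum_congr rfl fun i _ => ?_
  rw [← mul_smul_comm, evenCoord, (SuperSym.ι₀_commute _ _).eq]
  congr 1
  rw [low₁, LinearMap.comp_apply, LinearMap.comp_apply,
    ← sum_apply_smul_map_coord (finBasis ℝ V₁) SuperSym.ι₁, Finset.smul_sum]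
  refine Finset.sum_congr rfl fun j _ => ?_
  rw [← block₁₀_apply, ← block₀₁_apply, X.skew₀, ← B.odd_symm.eq, smul_smul,
    oddCoord]
  congr 1
  ring

/-- The same moment written with the other block. Both forms are needed: an odd derivation mixes
contractions over `V₀` with contractions over `V₁`. -/
theorem momentOdd_eq₁ (B : SymplecticForm V₀ V₁) (X : SpoOdd B) :
    momentOdd B X = contr₁ (low₀ B ∘ₗ block₀₁ X.val) := by
  rw [momentOdd_eq₀, contr₀_apply, contr₁_apply]
  have h₀ (i) : low₁ B (block₁₀ X.val (finBasis ℝ V₀ i)) = ∑ j, B.even (block₀₁ X.val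
      (finBasis ℝ V₁ j)) (finBasis ℝ V₀ i) • (oddCoord j : SDual V₀ V₁) := by
    rw [low₁, LinearMap.comp_apply,
      ← sum_apply_smul_map_coord (finBasis ℝ V₁) SuperSym.ι₁]
    refine Finset.sum_congr rfl fun j _ => ?_
    rw [← X.skew₁, ← B.odd_symm.eq]
    rfl
  have h₁ (j) : low₀ B (block₀₁ X.val (finBasis ℝ V₁ j)) = ∑ i, B.even (block₀₁ X.val
      (finBasis ℝ V₁ j)) (finBasis ℝ V₀ i) • (evenCoord i : SDual V₀ V₁) :=
    (sum_apply_smul_map_coord (finBasis ℝ V₀) SuperSym.ι₀ _).symm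
  simp only [LinearMap.comp_apply, h₀, h₁, Finset.sum_mul]
  rw [Finset.sum_comm]
  refine Finset.sum_congr rfl fun j _ => Finset.sum_congr rfl fun i _ => ?_
  rw [smul_mul_assoc, smul_mul_assoc, evenCoord, (SuperSym.ι₀_commute _ _).eq]

theorem moment_ι₀ (B : SymplecticForm V₀ V₁) (X : SpoEven B) :
    moment B (SuperSym.ι₀ X) = momentEven B X := SuperSym.lift_ι₀ _ _ _ _ _ _

theorem moment_ι₁ (B : SymplecticForm V₀ V₁) (X : SpoOdd B) :
    moment B (SuperSym.ι₁ X) = momentOdd B X := SuperSym.lift_ι₁ _ _ _ _ _ _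

/-! ### Equivariance of the moment map -/

/-- The action of `spo(V)₀` on `V₀*`. -/
def coad₀₀ {B : SymplecticForm V₀ V₁} (X : SpoEven B) : Dual ℝ V₀ →ₗ[ℝ] Dual ℝ V₀ :=
  -LinearMap.lcomp ℝ ℝ (block₀₀ X.val)

/-- The action of `spo(V)₀` on `V₁*`. -/
def coad₁₁ {B : SymplecticForm V₀ V₁} (X : SpoEven B) : Dual ℝ V₁ →ₗ[ℝ] Dual ℝ V₁ :=
  -LinearMap.lcomp ℝ ℝ (block₁₁ X.val)

/-- The action of `spo(V)₁` on `V₀*`. -/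
def coad₁₀ {B : SymplecticForm V₀ V₁} (X : SpoOdd B) : Dual ℝ V₀ →ₗ[ℝ] Dual ℝ V₁ :=
  -LinearMap.lcomp ℝ ℝ (block₀₁ X.val)

/-- The action of `spo(V)₁` on `V₁*`. -/
def coad₀₁ {B : SymplecticForm V₀ V₁} (X : SpoOdd B) : Dual ℝ V₁ →ₗ[ℝ] Dual ℝ V₀ :=
  LinearMap.lcomp ℝ ℝ (block₁₀ X.val)

/-- Skewness of `X` for `B` says exactly that `v ↦ B(v, ·)` is equivariant. The lone plus sign in
`coad₀₁` is the one that makes the analogous identities hold for odd `X`. -/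
theorem coad₀₀_low {B : SymplecticForm V₀ V₁} (X : SpoEven B) (v : V₀) :
    coad₀₀ X (B.even v) = B.even (block₀₀ X.val v) := by
  ext w; simp [coad₀₀, X.skew₀]

theorem coad₁₁_low {B : SymplecticForm V₀ V₁} (X : SpoEven B) (v : V₁) :
    coad₁₁ X (B.odd v) = B.odd (block₁₁ X.val v) := by
  ext w; simp [coad₁₁, X.skew₁]

theorem coad₁₀_low {B : SymplecticForm V₀ V₁} (X : SpoOdd B) (v : V₀) :
    coad₁₀ X (B.even v) = B.odd (block₁₀ X.val v) := by
  ext w; simp [coad₁₀, X.skew₀]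

theorem coad₀₁_low {B : SymplecticForm V₀ V₁} (X : SpoOdd B) (v : V₁) :
    coad₀₁ X (B.odd v) = B.even (block₀₁ X.val v) := by
  ext w; simp [coad₀₁, X.skew₁]

theorem coad₀₀_apply {B : SymplecticForm V₀ V₁} (X : SpoEven B) (φ : Dual ℝ V₀) :
    coad₀₀ X φ = -(φ ∘ₗ block₀₀ X.val) := rfl

theorem coad₁₁_apply {B : SymplecticForm V₀ V₁} (X : SpoEven B) (φ : Dual ℝ V₁) :
    coad₁₁ X φ = -(φ ∘ₗ block₁₁ X.val) := rfl

theorem coad₁₀_apply {B : SymplecticForm V₀ V₁} (X : SpoOdd B) (φ : Dual ℝ V₀) :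
    coad₁₀ X φ = -(φ ∘ₗ block₀₁ X.val) := rfl

theorem coad₀₁_apply {B : SymplecticForm V₀ V₁} (X : SpoOdd B) (φ : Dual ℝ V₁) :
    coad₀₁ X φ = φ ∘ₗ block₁₀ X.val := rfl

/-! ### Coadjoint derivations of contractions -/

section ContrDer

variable {B : SymplecticForm V₀ V₁}

/-- Moves `t` from the vector side of the canonical tensor to the covector side, where the coadjoint
action of a derivation on `zⁱ` appears. -/
theorem contr₀_comp {W : Type*} [AddCommGroup W] [Module ℝ W] (L : W →ₗ[ℝ] SDual V₀ V₁)
    (t : V₀ →ₗ[ℝ] W) {I : Type*} [Fintype I] (g : Basis I ℝ W) :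
    contr₀ (L ∘ₗ t) = ∑ i, L (g i) * SuperSym.ι₀ (g.coord i ∘ₗ t) :=
  (sum_mul_map_coord_comp g (finBasis ℝ V₀) L SuperSym.ι₀ t).symm

theorem contr₁_comp {W : Type*} [AddCommGroup W] [Module ℝ W] (L : W →ₗ[ℝ] SDual V₀ V₁)
    (t : V₁ →ₗ[ℝ] W) {I : Type*} [Fintype I] (g : Basis I ℝ W) :
    contr₁ (L ∘ₗ t) = ∑ i, L (g i) * SuperSym.ι₁ (g.coord i ∘ₗ t) :=
  (sum_mul_map_coord_comp g (finBasis ℝ V₁) L SuperSym.ι₁ t).symm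

/-- By the Leibniz rule, the action on `B(a gᵢ, ·)` composes `a` with `X` on the left, and the
action on `zⁱ` composes it on the right with a minus sign: the derivation of a contraction is the
contraction of a commutator. -/
theorem evenDer_contr₀ (X : SpoEven B) (a : V₀ →ₗ[ℝ] V₀) :
    SuperSym.evenDer (coad₀₀ X) (coad₁₁ X) (contr₀ (low₀ B ∘ₗ a)) =
      contr₀ (low₀ B ∘ₗ block₀₀ X.val ∘ₗ a) - contr₀ ((low₀ B ∘ₗ a) ∘ₗ block₀₀ X.val) := by
  rw [contr₀_comp (low₀ B ∘ₗ a) _ (finBasis ℝ V₀), contr₀_apply, contr₀_apply, map_sum,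
    ← Finset.sum_sub_distrib]
  refine Finset.sum_congr rfl fun i _ => ?_
  simp only [LinearMap.comp_apply, low₀, evenCoord, SuperSym.evenDer_ι₀_mul, coad₀₀_low,
    SuperSym.evenDer_ι₀]
  simp only [coad₀₀_apply, map_neg, mul_neg]
  abel

theorem evenDer_contr₁ (X : SpoEven B) (a : V₁ →ₗ[ℝ] V₁) :
    SuperSym.evenDer (coad₀₀ X) (coad₁₁ X) (contr₁ (low₁ B ∘ₗ a)) =
      contr₁ (low₁ B ∘ₗ block₁₁ X.val ∘ₗ a) - contr₁ ((low₁ B ∘ₗ a) ∘ₗ block₁₁ X.val) := by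
  rw [contr₁_comp (low₁ B ∘ₗ a) _ (finBasis ℝ V₁), contr₁_apply, contr₁_apply, map_sum,
    ← Finset.sum_sub_distrib]
  refine Finset.sum_congr rfl fun i _ => ?_
  simp only [LinearMap.comp_apply, low₁, oddCoord, SuperSym.evenDer_ι₁_mul, coad₁₁_low,
    SuperSym.evenDer_ι₁]
  simp only [coad₁₁_apply, map_neg, mul_neg]
  abel

theorem evenDer_contr₀_low₁ (X : SpoEven B) (a : V₀ →ₗ[ℝ] V₁) :
    SuperSym.evenDer (coad₀₀ X) (coad₁₁ X) (contr₀ (low₁ B ∘ₗ a)) =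
      contr₀ (low₁ B ∘ₗ block₁₁ X.val ∘ₗ a) - contr₀ ((low₁ B ∘ₗ a) ∘ₗ block₀₀ X.val) := by
  rw [contr₀_comp (low₁ B ∘ₗ a) _ (finBasis ℝ V₀), contr₀_apply, contr₀_apply, map_sum,
    ← Finset.sum_sub_distrib]
  refine Finset.sum_congr rfl fun i _ => ?_
  simp only [LinearMap.comp_apply, low₁, evenCoord, SuperSym.evenDer_ι₁_mul, coad₁₁_low,
    SuperSym.evenDer_ι₀]
  simp only [coad₀₀_apply, map_neg, mul_neg]
  abel

theorem oddDer_contr₀ (X : SpoOdd B) (a : V₀ →ₗ[ℝ] V₀) :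
    SuperSym.oddDer (coad₁₀ X) (coad₀₁ X) (contr₀ (low₀ B ∘ₗ a)) =
      contr₀ (low₁ B ∘ₗ block₁₀ X.val ∘ₗ a) - contr₁ ((low₀ B ∘ₗ a) ∘ₗ block₀₁ X.val) := by
  rw [contr₁_comp (low₀ B ∘ₗ a) _ (finBasis ℝ V₀), contr₀_apply, contr₀_apply, map_sum,
    ← Finset.sum_sub_distrib]
  refine Finset.sum_congr rfl fun i _ => ?_
  simp only [LinearMap.comp_apply, low₀, low₁, evenCoord, SuperSym.oddDer_ι₀_mul, coad₁₀_low,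
    SuperSym.oddDer_ι₀]
  simp only [coad₁₀_apply, map_neg, mul_neg]
  abel

theorem oddDer_contr₁ (X : SpoOdd B) (a : V₁ →ₗ[ℝ] V₁) :
    SuperSym.oddDer (coad₁₀ X) (coad₀₁ X) (contr₁ (low₁ B ∘ₗ a)) =
      contr₁ (low₀ B ∘ₗ block₀₁ X.val ∘ₗ a) - contr₀ ((low₁ B ∘ₗ a) ∘ₗ block₁₀ X.val) := by
  rw [contr₀_comp (low₁ B ∘ₗ a) _ (finBasis ℝ V₁), contr₁_apply, contr₁_apply, map_sum,
    ← Finset.sum_sub_distrib]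
  refine Finset.sum_congr rfl fun i _ => ?_
  simp only [LinearMap.comp_apply, low₀, low₁, oddCoord, SuperSym.oddDer_ι₁_mul, coad₀₁_low,
    SuperSym.oddDer_ι₁]
  simp only [coad₀₁_apply]
  abel

/-- The sign from passing the odd factor `B(a gᵢ, ·)` cancels the sign in `coad₁₀`, so that
anticommutators appear, as they must for the bracket of two odd elements. -/
theorem oddDer_contr₀_low₁ (X : SpoOdd B) (a : V₀ →ₗ[ℝ] V₁) :
    SuperSym.oddDer (coad₁₀ X) (coad₀₁ X) (contr₀ (low₁ B ∘ₗ a)) =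
      contr₀ (low₀ B ∘ₗ block₀₁ X.val ∘ₗ a) + contr₁ ((low₁ B ∘ₗ a) ∘ₗ block₀₁ X.val) := by
  rw [contr₁_comp (low₁ B ∘ₗ a) _ (finBasis ℝ V₀), contr₀_apply, contr₀_apply, map_sum,
    ← Finset.sum_add_distrib]
  refine Finset.sum_congr rfl fun i _ => ?_
  simp only [LinearMap.comp_apply, low₀, low₁, evenCoord, SuperSym.oddDer_ι₁_mul, coad₀₁_low,
    SuperSym.oddDer_ι₀]
  simp only [coad₁₀_apply, map_neg, mul_neg]
  abel

theorem oddDer_contr₁_low₀ (X : SpoOdd B) (a : V₁ →ₗ[ℝ] V₀) :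
    SuperSym.oddDer (coad₁₀ X) (coad₀₁ X) (contr₁ (low₀ B ∘ₗ a)) =
      contr₁ (low₁ B ∘ₗ block₁₀ X.val ∘ₗ a) + contr₀ ((low₀ B ∘ₗ a) ∘ₗ block₁₀ X.val) := by
  rw [contr₀_comp (low₀ B ∘ₗ a) _ (finBasis ℝ V₁), contr₁_apply, contr₁_apply, map_sum,
    ← Finset.sum_add_distrib]
  refine Finset.sum_congr rfl fun i _ => ?_
  simp only [LinearMap.comp_apply, low₀, low₁, oddCoord, SuperSym.oddDer_ι₀_mul, coad₁₀_low,
    SuperSym.oddDer_ι₁]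
  simp only [coad₀₁_apply]
  abel

end ContrDer

section Equivariance

variable {B : SymplecticForm V₀ V₁}

theorem evenDer_momentEven (X Y : SpoEven B) :
    SuperSym.evenDer (coad₀₀ X) (coad₁₁ X) (momentEven B Y) = momentEven B (adEE B X Y) := by
  have h₀ : block₀₀ (adEE B X Y).val =
      block₀₀ X.val ∘ₗ block₀₀ Y.val - block₀₀ Y.val ∘ₗ block₀₀ X.val := by
    ext v
    change (X.val (Y.val (v, 0))).1 - (Y.val (X.val (v, 0))).1 = _
    rw [X.val_inl, Y.val_inl]
    rfl
  have h₁ : block₁₁ (adEE B X Y).val =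
      block₁₁ X.val ∘ₗ block₁₁ Y.val - block₁₁ Y.val ∘ₗ block₁₁ X.val := by
    ext v
    change (X.val (Y.val (0, v))).2 - (Y.val (X.val (0, v))).2 = _
    rw [X.val_inr, Y.val_inr]
    rfl
  rw [momentEven_eq, momentEven_eq, map_smul, map_add, evenDer_contr₀, evenDer_contr₁, h₀, h₁]
  simp only [LinearMap.comp_sub, map_sub, LinearMap.comp_assoc]

theorem evenDer_momentOdd (X : SpoEven B) (Y : SpoOdd B) :
    SuperSym.evenDer (coad₀₀ X) (coad₁₁ X) (momentOdd B Y) = momentOdd B (adEO B X Y) := by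
  have h : block₁₀ (adEO B X Y).val =
      block₁₁ X.val ∘ₗ block₁₀ Y.val - block₁₀ Y.val ∘ₗ block₀₀ X.val := by
    ext v
    change (X.val (Y.val (v, 0))).2 - (Y.val (X.val (v, 0))).2 = _
    rw [X.val_inl, Y.val_inl]
    rfl
  rw [momentOdd_eq₀, momentOdd_eq₀, evenDer_contr₀_low₁, h]
  simp only [LinearMap.comp_sub, map_sub, LinearMap.comp_assoc]

theorem oddDer_momentEven (X : SpoOdd B) (Y : SpoEven B) :
    SuperSym.oddDer (coad₁₀ X) (coad₀₁ X) (momentEven B Y) = momentOdd B (adOE B X Y) := by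
  have h₀ : block₁₀ (adOE B X Y).val =
      block₁₀ X.val ∘ₗ block₀₀ Y.val - block₁₁ Y.val ∘ₗ block₁₀ X.val := by
    ext v
    change (X.val (Y.val (v, 0))).2 - (Y.val (X.val (v, 0))).2 = _
    rw [X.val_inl, Y.val_inl]
    rfl
  have h₁ : block₀₁ (adOE B X Y).val =
      block₀₁ X.val ∘ₗ block₁₁ Y.val - block₀₀ Y.val ∘ₗ block₀₁ X.val := by
    ext v
    change (X.val (Y.val (0, v))).1 - (Y.val (X.val (0, v))).1 = _
    rw [X.val_inr, Y.val_inr]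
    rfl
  -- Each of the two contractions in the even moment of `Y` contributes one term to each of the two
  -- expressions of the odd moment, so their average is the form that matches.
  have h : momentOdd B (adOE B X Y) = (1 / 2 : ℝ) •
      (contr₀ (low₁ B ∘ₗ block₁₀ (adOE B X Y).val) +
        contr₁ (low₀ B ∘ₗ block₀₁ (adOE B X Y).val)) := by
    rw [← momentOdd_eq₀, ← momentOdd_eq₁]
    module
  rw [h, momentEven_eq, map_smul, map_add, oddDer_contr₀, oddDer_contr₁, h₀, h₁]
  simp only [LinearMap.comp_sub, map_sub, LinearMap.comp_assoc]
  congr 1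
  abel

theorem oddDer_momentOdd (X Y : SpoOdd B) :
    SuperSym.oddDer (coad₁₀ X) (coad₀₁ X) (momentOdd B Y) = momentEven B (adOO B X Y) := by
  have h₀ : block₀₀ (adOO B X Y).val =
      block₀₁ X.val ∘ₗ block₁₀ Y.val + block₀₁ Y.val ∘ₗ block₁₀ X.val := by
    ext v
    change (X.val (Y.val (v, 0))).1 + (Y.val (X.val (v, 0))).1 = _
    rw [X.val_inl, Y.val_inl]
    rfl
  have h₁ : block₁₁ (adOO B X Y).val =
      block₁₀ X.val ∘ₗ block₀₁ Y.val + block₁₀ Y.val ∘ₗ block₀₁ X.val := by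
    ext v
    change (X.val (Y.val (0, v))).2 + (Y.val (X.val (0, v))).2 = _
    rw [X.val_inr, Y.val_inr]
    rfl
  have h : momentOdd B Y = (1 / 2 : ℝ) •
      (contr₀ (low₁ B ∘ₗ block₁₀ Y.val) + contr₁ (low₀ B ∘ₗ block₀₁ Y.val)) := by
    rw [← momentOdd_eq₀, ← momentOdd_eq₁]
    module
  rw [h, momentEven_eq, map_smul, map_add, oddDer_contr₀_low₁, oddDer_contr₁_low₀, h₀, h₁]
  simp only [LinearMap.comp_add, map_add, LinearMap.comp_assoc]
  congr 1
  abel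

/-- The upper left entry is the parity automorphism. This lemma and the next say that `μ̌` preserves
parity on generators, which matches the signs of the twisted Leibniz rules on the two sides. -/
theorem oddDerMatrix_momentEven (X : SpoOdd B) (Y : SpoEven B) :
    SuperSym.oddDerMatrix (coad₁₀ X) (coad₀₁ X) (momentEven B Y) 0 0 = momentEven B Y := by
  simp only [momentEven_eq, contr₀_apply, contr₁_apply, map_smul, map_add, map_sum, Matrix.smul_apply,
    Matrix.add_apply, Matrix.sum_apply, SuperSym.oddDerMatrix_mul_zero_zero, low₀, low₁, evenCoord,
    oddCoord, LinearMap.comp_apply, SuperSym.oddDerMatrix_ι₀, SuperSym.oddDerMatrix_ι₁]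
  simp

theorem oddDerMatrix_momentOdd (X Y : SpoOdd B) :
    SuperSym.oddDerMatrix (coad₁₀ X) (coad₀₁ X) (momentOdd B Y) 0 0 = -momentOdd B Y := by
  simp only [momentOdd_eq₀, contr₀_apply, map_sum, Matrix.sum_apply,
    SuperSym.oddDerMatrix_mul_zero_zero, low₁, evenCoord,
    LinearMap.comp_apply, SuperSym.oddDerMatrix_ι₀, SuperSym.oddDerMatrix_ι₁]
  simp

/-- The moment map intertwines the actions of `spo(V)₀`. -/
theorem evenDer_moment (X : SpoEven B) (D : SSpo B) :
    SuperSym.evenDer (coad₀₀ X) (coad₁₁ X) (moment B D) =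
      moment B (SuperSym.evenDer (adEE B X) (adEO B X) D) := by
  induction D using SuperSym.left_induction with
  | algebraMap r => simp [AlgHom.commutes]
  | add x y hx hy => simp only [map_add, hx, hy]
  | mul₀ Y x hx =>
    rw [map_mul, SuperSym.evenDer_mul, hx, moment_ι₀, evenDer_momentEven, SuperSym.evenDer_ι₀_mul,
      map_add, map_mul, map_mul, moment_ι₀, moment_ι₀]
  | mul₁ Y x hx =>
    rw [map_mul, SuperSym.evenDer_mul, hx, moment_ι₁, evenDer_momentOdd, SuperSym.evenDer_ι₁_mul,
      map_add, map_mul, map_mul, moment_ι₁, moment_ι₁]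

/-- The moment map intertwines the actions of `spo(V)₁`. -/
theorem oddDer_moment (X : SpoOdd B) (D : SSpo B) :
    SuperSym.oddDer (coad₁₀ X) (coad₀₁ X) (moment B D) =
      moment B (SuperSym.oddDer (adOE B X) (adOO B X) D) := by
  induction D using SuperSym.left_induction with
  | algebraMap r => simp [AlgHom.commutes]
  | add x y hx hy => simp only [map_add, hx, hy]
  | mul₀ Y x hx =>
    rw [map_mul, SuperSym.oddDer_mul, hx, moment_ι₀, oddDer_momentEven, oddDerMatrix_momentEven,
      SuperSym.oddDer_ι₀_mul, map_add, map_mul, map_mul, moment_ι₀, moment_ι₁]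
  | mul₁ Y x hx =>
    rw [map_mul, SuperSym.oddDer_mul, hx, moment_ι₁, oddDer_momentOdd, oddDerMatrix_momentOdd,
      SuperSym.oddDer_ι₁_mul, map_add, map_neg, map_mul, map_mul, moment_ι₁, moment_ι₀, neg_mul]

/-- An isometry `h` satisfies `B(v, h⁻¹ ·) = B(hv, ·)`, so transporting both factors of the
contraction amounts to conjugating the endomorphism. -/
theorem map_contr₀ (h : EvenIsometry B) (a : V₀ →ₗ[ℝ] V₀) :
    SuperSym.map (LinearMap.lcomp ℝ ℝ (h.even.symm : V₀ →ₗ[ℝ] V₀))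
      (LinearMap.lcomp ℝ ℝ (h.odd.symm : V₁ →ₗ[ℝ] V₁)) (contr₀ (low₀ B ∘ₗ a)) =
      contr₀ ((low₀ B ∘ₗ (h.even : V₀ →ₗ[ℝ] V₀) ∘ₗ a) ∘ₗ (h.even.symm : V₀ →ₗ[ℝ] V₀)) := by
  rw [contr₀_comp (low₀ B ∘ₗ (h.even : V₀ →ₗ[ℝ] V₀) ∘ₗ a) _ (finBasis ℝ V₀), contr₀_apply, map_sum]
  refine Finset.sum_congr rfl fun i _ => ?_
  simp only [LinearMap.comp_apply, low₀, evenCoord, map_mul, SuperSym.map_ι₀]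
  congr 2
  ext w
  have := h.map_even (a (finBasis ℝ V₀ i)) (h.even.symm w)
  simpa using this.symm

theorem map_contr₁ (h : EvenIsometry B) (a : V₁ →ₗ[ℝ] V₁) :
    SuperSym.map (LinearMap.lcomp ℝ ℝ (h.even.symm : V₀ →ₗ[ℝ] V₀))
      (LinearMap.lcomp ℝ ℝ (h.odd.symm : V₁ →ₗ[ℝ] V₁)) (contr₁ (low₁ B ∘ₗ a)) =
      contr₁ ((low₁ B ∘ₗ (h.odd : V₁ →ₗ[ℝ] V₁) ∘ₗ a) ∘ₗ (h.odd.symm : V₁ →ₗ[ℝ] V₁)) := by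
  rw [contr₁_comp (low₁ B ∘ₗ (h.odd : V₁ →ₗ[ℝ] V₁) ∘ₗ a) _ (finBasis ℝ V₁), contr₁_apply, map_sum]
  refine Finset.sum_congr rfl fun i _ => ?_
  simp only [LinearMap.comp_apply, low₁, oddCoord, map_mul, SuperSym.map_ι₁]
  congr 2
  ext w
  have := h.map_odd (a (finBasis ℝ V₁ i)) (h.odd.symm w)
  simpa using this.symm

theorem map_contr₀_low₁ (h : EvenIsometry B) (a : V₀ →ₗ[ℝ] V₁) :
    SuperSym.map (LinearMap.lcomp ℝ ℝ (h.even.symm : V₀ →ₗ[ℝ] V₀))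
      (LinearMap.lcomp ℝ ℝ (h.odd.symm : V₁ →ₗ[ℝ] V₁)) (contr₀ (low₁ B ∘ₗ a)) =
      contr₀ ((low₁ B ∘ₗ (h.odd : V₁ →ₗ[ℝ] V₁) ∘ₗ a) ∘ₗ (h.even.symm : V₀ →ₗ[ℝ] V₀)) := by
  rw [contr₀_comp (low₁ B ∘ₗ (h.odd : V₁ →ₗ[ℝ] V₁) ∘ₗ a) _ (finBasis ℝ V₀), contr₀_apply, map_sum]
  refine Finset.sum_congr rfl fun i _ => ?_
  simp only [LinearMap.comp_apply, low₁, evenCoord, map_mul, SuperSym.map_ι₀, SuperSym.map_ι₁]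
  congr 2
  ext w
  have := h.map_odd (a (finBasis ℝ V₀ i)) (h.odd.symm w)
  simpa using this.symm

/-- The moment map intertwines the actions of the even isometries. -/
theorem map_moment (h : EvenIsometry B) (D : SSpo B) :
    SuperSym.map (LinearMap.lcomp ℝ ℝ (h.even.symm : V₀ →ₗ[ℝ] V₀))
      (LinearMap.lcomp ℝ ℝ (h.odd.symm : V₁ →ₗ[ℝ] V₁)) (moment B D) =
      moment B (SuperSym.map h.conjEven h.conjOdd D) := by
  have h₀₀ (Y : SpoEven B) : block₀₀ (h.conjEven Y).val =
      ((h.even : V₀ →ₗ[ℝ] V₀) ∘ₗ block₀₀ Y.val) ∘ₗ (h.even.symm : V₀ →ₗ[ℝ] V₀) := by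
    ext v
    change h.even (Y.val (h.even.symm v, h.odd.symm 0)).1 = _
    rw [map_zero]
    rfl
  have h₁₁ (Y : SpoEven B) : block₁₁ (h.conjEven Y).val =
      ((h.odd : V₁ →ₗ[ℝ] V₁) ∘ₗ block₁₁ Y.val) ∘ₗ (h.odd.symm : V₁ →ₗ[ℝ] V₁) := by
    ext v
    change h.odd (Y.val (h.even.symm 0, h.odd.symm v)).2 = _
    rw [map_zero]
    rfl
  have h₁₀ (Y : SpoOdd B) : block₁₀ (h.conjOdd Y).val =
      ((h.odd : V₁ →ₗ[ℝ] V₁) ∘ₗ block₁₀ Y.val) ∘ₗ (h.even.symm : V₀ →ₗ[ℝ] V₀) := by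
    ext v
    change h.odd (Y.val (h.even.symm v, h.odd.symm 0)).2 = _
    rw [map_zero]
    rfl
  rw [← AlgHom.comp_apply, ← AlgHom.comp_apply]
  congr 1
  refine SuperSym.algHom_ext (fun Y => ?_) (fun Y => ?_)
  · rw [AlgHom.comp_apply, AlgHom.comp_apply, moment_ι₀, SuperSym.map_ι₀, moment_ι₀, momentEven_eq,
      map_smul, map_add, map_contr₀, map_contr₁, momentEven_eq, h₀₀, h₁₁]
    rfl
  · rw [AlgHom.comp_apply, AlgHom.comp_apply, moment_ι₁, SuperSym.map_ι₁, moment_ι₁, momentOdd_eq₀,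
      map_contr₀_low₁, momentOdd_eq₀, h₁₀]
    rfl

end Equivariance

/-! ### Homogeneity -/

/-- Generators have quadratic moments, so `k`-fold products of generators go to `2k`-fold products.
-/
theorem moment_mem_homogeneous (B : SymplecticForm V₀ V₁) {k : ℕ} {D : SSpo B}
    (hD : D ∈ SuperSym.homogeneous (SpoEven B) (SpoOdd B) k) :
    moment B D ∈ SuperSym.homogeneous (Dual ℝ V₀) (Dual ℝ V₁) (2 * k) := by
  have h₀ (φ : Dual ℝ V₀) : (SuperSym.ι₀ φ : SDual V₀ V₁) ∈ LinearMap.range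
      (SuperSym.ι : Dual ℝ V₀ × Dual ℝ V₁ →ₗ[ℝ] SDual V₀ V₁) := ⟨(φ, 0), by simp [SuperSym.ι]⟩
  have h₁ (φ : Dual ℝ V₁) : (SuperSym.ι₁ φ : SDual V₀ V₁) ∈ LinearMap.range
      (SuperSym.ι : Dual ℝ V₀ × Dual ℝ V₁ →ₗ[ℝ] SDual V₀ V₁) := ⟨(0, φ), by simp [SuperSym.ι]⟩
  have h : Submodule.map (moment B).toLinearMap (LinearMap.range SuperSym.ι) ≤
      LinearMap.range (SuperSym.ι : Dual ℝ V₀ × Dual ℝ V₁ →ₗ[ℝ] SDual V₀ V₁) ^ 2 := by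
    rintro _ ⟨_, ⟨X, rfl⟩, rfl⟩
    have e : (SuperSym.ι X : SSpo B) = SuperSym.ι₀ X.1 + SuperSym.ι₁ X.2 := rfl
    rw [e, AlgHom.toLinearMap_apply, map_add, moment_ι₀, moment_ι₁, momentEven_eq, momentOdd_eq₀,
      pow_two, contr₀_apply, contr₁_apply, contr₀_apply]
    refine add_mem (Submodule.smul_mem _ _ (add_mem ?_ ?_)) ?_
    · exact Submodule.sum_mem _ fun i _ => Submodule.mul_mem_mul (h₀ _) (h₀ _)
    · exact Submodule.sum_mem _ fun i _ => Submodule.mul_mem_mul (h₁ _) (h₁ _)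
    · exact Submodule.sum_mem _ fun i _ => Submodule.mul_mem_mul (h₁ _) (h₀ _)
  have h2 := Submodule.mem_map_of_mem (f := (moment B).toLinearMap) hD
  rw [SuperSym.homogeneous, Submodule.map_pow] at h2
  rw [SuperSym.homogeneous, pow_mul]
  exact pow_le_pow_left' h k h2

end SuperPfaffian
end

noncomputable section

set_option linter.unusedSectionVars false

namespace SuperPfaffian

variable {V₀ V₁ : Type*} [AddCommGroup V₀] [Module ℝ V₀] [FiniteDimensional ℝ V₀]
  [AddCommGroup V₁] [Module ℝ V₁] [FiniteDimensional ℝ V₁]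

/-! ### Elementary elements of `spo(V)` -/

/-- The endomorphism `u ↦ B(v, u) w + B(w, u) v` of `V`, where `v, w ∈ V₀`. -/
def elem₀₀ (B : SymplecticForm V₀ V₁) (v w : V₀) : SpoEven B :=
  .mk (LinearMap.inl ℝ V₀ V₁ ∘ₗ
    ((B.even v).smulRight w + (B.even w).smulRight v) ∘ₗ LinearMap.fst ℝ V₀ V₁) (by
    refine ⟨fun u => by simp, fun u => by simp, fun u u' => ?_⟩
    change B.even (B.even v u.1 • w + B.even w u.1 • v) u'.1 + B.odd 0 u'.2 +
      (B.even u.1 (B.even v u'.1 • w + B.even w u'.1 • v) + B.odd u.2 0) = 0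
    simp only [map_add, map_smul, LinearMap.add_apply, LinearMap.smul_apply, smul_eq_mul, map_zero,
      LinearMap.zero_apply, ← B.even_alt.neg_eq v u.1, ← B.even_alt.neg_eq w u.1]
    ring)

/-- The endomorphism `u ↦ B(v, u) w - B(w, u) v` of `V`, where `v, w ∈ V₁`. -/
def elem₁₁ (B : SymplecticForm V₀ V₁) (v w : V₁) : SpoEven B :=
  .mk (LinearMap.inr ℝ V₀ V₁ ∘ₗ
    ((B.odd v).smulRight w - (B.odd w).smulRight v) ∘ₗ LinearMap.snd ℝ V₀ V₁) (by
    refine ⟨fun u => by simp, fun u => by simp, fun u u' => ?_⟩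
    change B.even 0 u'.1 + B.odd (B.odd v u.2 • w - B.odd w u.2 • v) u'.2 +
      (B.even u.1 0 + B.odd u.2 (B.odd v u'.2 • w - B.odd w u'.2 • v)) = 0
    have h : B.odd u.2 v = B.odd v u.2 := B.odd_symm.eq u.2 v
    have h' : B.odd u.2 w = B.odd w u.2 := B.odd_symm.eq u.2 w
    simp only [map_sub, map_smul, LinearMap.sub_apply, LinearMap.smul_apply, smul_eq_mul, map_zero,
      LinearMap.zero_apply, h, h']
    ring)

/-- The endomorphism `u ↦ B(w, u₁) v + B(v, u₀) w` of `V`, where `v ∈ V₀` and `w ∈ V₁`. -/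
def elem₀₁ (B : SymplecticForm V₀ V₁) (v : V₀) (w : V₁) : SpoOdd B :=
  .mk (LinearMap.inl ℝ V₀ V₁ ∘ₗ (B.odd w).smulRight v ∘ₗ LinearMap.snd ℝ V₀ V₁ +
    LinearMap.inr ℝ V₀ V₁ ∘ₗ (B.even v).smulRight w ∘ₗ LinearMap.fst ℝ V₀ V₁) (by
    refine ⟨fun u => by simp, fun u => by simp, fun u u' => ?_⟩
    have h : B.odd u.2 w = B.odd w u.2 := B.odd_symm.eq u.2 w
    simp only [SymplecticForm.form, LinearMap.comp_apply, LinearMap.add_apply,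
      LinearMap.smulRight_apply, LinearMap.inl_apply, LinearMap.inr_apply, LinearMap.fst_apply,
      LinearMap.snd_apply, Prod.fst_add, Prod.snd_add, Prod.smul_mk, smul_zero, add_zero, zero_add,
      map_smul, LinearMap.smul_apply, smul_eq_mul, map_neg, LinearMap.neg_apply, h,
      ← B.even_alt.neg_eq v u.1]
    ring)

section Elem

variable (B : SymplecticForm V₀ V₁)

theorem block₀₀_elem₀₀ (v w : V₀) :
    block₀₀ (elem₀₀ B v w).val = (B.even v).smulRight w + (B.even w).smulRight v := rfl

theorem block₁₁_elem₀₀ (v w : V₀) : block₁₁ (elem₀₀ B v w).val = 0 := rfl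

theorem block₀₀_elem₁₁ (v w : V₁) : block₀₀ (elem₁₁ B v w).val = 0 := rfl

theorem block₁₁_elem₁₁ (v w : V₁) :
    block₁₁ (elem₁₁ B v w).val = (B.odd v).smulRight w - (B.odd w).smulRight v := rfl

theorem block₁₀_elem₀₁ (v : V₀) (w : V₁) :
    block₁₀ (elem₀₁ B v w).val = (B.even v).smulRight w := by
  ext u; exact zero_add _

theorem block₀₁_elem₀₁ (v : V₀) (w : V₁) :
    block₀₁ (elem₀₁ B v w).val = (B.odd w).smulRight v := by
  ext u; exact add_zero _

/-- A rank one element acts as a field with a single partial derivative, so invariance under it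
isolates `∂_v`. -/
theorem evenDer_elem₀₀ (v : V₀) (f : SDual V₀ V₁) :
    SuperSym.evenDer (coad₀₀ (elem₀₀ B v v)) (coad₁₁ (elem₀₀ B v v)) f =
      (-2 : ℝ) • (SuperSym.ι₀ (B.even v) * SuperSym.evenPartial (Dual.eval ℝ V₀ v) f) := by
  induction f using SuperSym.left_induction with
  | algebraMap r => simp
  | add x y hx hy => simp only [map_add, hx, hy, mul_add, smul_add]
  | mul₀ φ x hx =>
    have h : coad₀₀ (elem₀₀ B v v) φ = (-2 * φ v) • B.even v := by
      rw [coad₀₀_apply, block₀₀_elem₀₀]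
      ext u
      simp
      ring
    rw [SuperSym.evenDer_ι₀_mul, hx, h, SuperSym.evenPartial_ι₀_mul, map_smul, mul_add,
      SuperSym.ι₀_mul_left_comm (B.even v) (SuperSym.ι₀ φ), mul_smul_comm, smul_mul_assoc, mul_smul_comm,
      Dual.eval_apply]
    module
  | mul₁ φ x hx =>
    have h : coad₁₁ (elem₀₀ B v v) φ = 0 := by
      rw [coad₁₁_apply, block₁₁_elem₀₀, LinearMap.comp_zero, neg_zero]
    rw [SuperSym.evenDer_ι₁_mul, hx, h, SuperSym.evenPartial_ι₁_mul, map_zero, zero_mul, add_zero,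
      SuperSym.ι₀_mul_left_comm (B.even v) (SuperSym.ι₁ φ), mul_smul_comm]

/-- The infinitesimal rotation in the plane of `v` and `w`, as a vector field in the odd
coordinates. -/
theorem evenDer_elem₁₁ (v w : V₁) (f : SDual V₀ V₁) :
    SuperSym.evenDer (coad₀₀ (elem₁₁ B v w)) (coad₁₁ (elem₁₁ B v w)) f =
      SuperSym.ι₁ (B.odd w) * SuperSym.oddPartial (Dual.eval ℝ V₁ v) f -
        SuperSym.ι₁ (B.odd v) * SuperSym.oddPartial (Dual.eval ℝ V₁ w) f := by
  induction f using SuperSym.left_induction with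
  | algebraMap r => simp
  | add x y hx hy => simp only [map_add, hx, hy, mul_add]; abel
  | mul₀ φ x hx =>
    have h : coad₀₀ (elem₁₁ B v w) φ = 0 := by
      rw [coad₀₀_apply, block₀₀_elem₁₁, LinearMap.comp_zero, neg_zero]
    rw [SuperSym.evenDer_ι₀_mul, hx, h, SuperSym.oddPartial_ι₀_mul, SuperSym.oddPartial_ι₀_mul, map_zero, zero_mul, add_zero,
      ← SuperSym.ι₀_mul_left_comm, ← SuperSym.ι₀_mul_left_comm, mul_sub]
  | mul₁ φ x hx =>
    have h : coad₁₁ (elem₁₁ B v w) φ = φ v • B.odd w - φ w • B.odd v := by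
      rw [coad₁₁_apply, block₁₁_elem₁₁]
      ext u
      simp
      ring
    rw [SuperSym.evenDer_ι₁_mul, hx, h, SuperSym.oddPartial_ι₁_mul, SuperSym.oddPartial_ι₁_mul,
      map_sub, map_smul, map_smul, mul_add, mul_add, mul_neg, mul_neg,
      SuperSym.ι₁_mul_ι₁_mul (B.odd v) φ, SuperSym.ι₁_mul_ι₁_mul (B.odd w) φ, sub_mul, mul_sub,
      smul_mul_assoc, smul_mul_assoc, mul_smul_comm, mul_smul_comm, Dual.eval_apply,
      Dual.eval_apply]
    abel

/-- The odd field that exchanges the directions `v` and `w`; once the even partial derivatives of an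
invariant vanish, it isolates `∂_w`. -/
theorem oddDer_elem₀₁ (v : V₀) (w : V₁) (f : SDual V₀ V₁) :
    SuperSym.oddDer (coad₁₀ (elem₀₁ B v w)) (coad₀₁ (elem₀₁ B v w)) f =
      SuperSym.ι₀ (B.even v) * SuperSym.oddPartial (Dual.eval ℝ V₁ w) f -
        SuperSym.ι₁ (B.odd w) * SuperSym.evenPartial (Dual.eval ℝ V₀ v) f := by
  induction f using SuperSym.left_induction with
  | algebraMap r => simp
  | add x y hx hy => simp only [map_add, hx, hy, mul_add]; abel
  | mul₀ φ x hx =>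
    have h : coad₁₀ (elem₀₁ B v w) φ = -φ v • B.odd w := by
      rw [coad₁₀_apply, block₀₁_elem₀₁]
      ext u
      simp
      ring
    rw [SuperSym.oddDer_ι₀_mul, hx, h, SuperSym.oddPartial_ι₀_mul, SuperSym.evenPartial_ι₀_mul,
      map_smul, mul_add, mul_sub, SuperSym.ι₀_mul_left_comm φ, SuperSym.ι₀_mul_left_comm φ,
      smul_mul_assoc, mul_smul_comm, Dual.eval_apply]
    module
  | mul₁ φ x hx =>
    have h : coad₀₁ (elem₀₁ B v w) φ = φ w • B.even v := by
      rw [coad₀₁_apply, block₁₀_elem₀₁]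
      ext u
      simp
      ring
    rw [SuperSym.oddDer_ι₁_mul, hx, h, SuperSym.oddPartial_ι₁_mul, SuperSym.evenPartial_ι₁_mul,
      map_smul, mul_add, mul_neg, mul_sub, SuperSym.ι₀_mul_left_comm _ (SuperSym.ι₁ φ),
      SuperSym.ι₁_mul_ι₁_mul (B.odd w) φ, smul_mul_assoc, mul_smul_comm, Dual.eval_apply]
    abel

end Elem

/-! ### The moments of invariants -/

theorem even_injective (B : SymplecticForm V₀ V₁) {v : V₀} (hv : v ≠ 0) : B.even v ≠ 0 :=
  fun h => hv (B.even_nondegenerate.1 v fun w => by rw [h, LinearMap.zero_apply])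

theorem evenPartial_zero (f : SDual V₀ V₁) : SuperSym.evenPartial (0 : Dual ℝ (Dual ℝ V₀)) f = 0 := by
  induction f using SuperSym.left_induction with
  | algebraMap r => simp
  | add x y hx hy => rw [map_add, hx, hy, add_zero]
  | mul₀ φ x hx => rw [SuperSym.evenPartial_ι₀_mul, hx]; simp
  | mul₁ φ x hx => rw [SuperSym.evenPartial_ι₁_mul, hx, mul_zero]

/-- If `V₀ ≠ 0`, then the invariants of positive degree belong to the kernel of `μ̌`. -/
theorem moment_eq_zero_of_even_ne_zero (B : SymplecticForm V₀ V₁) (h₀ : 0 < finrank ℝ V₀) {k : ℕ}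
    (hk : 0 < k) {D : SSpo B} (hD : D ∈ homogeneousInvariants B k) : moment B D = 0 := by
  obtain ⟨hDk, hDe, hDo⟩ := hD
  have hE (X : SpoEven B) := evenDer_moment X D
  have hO (X : SpoOdd B) := oddDer_moment X D
  have hDe' (X : SpoEven B) : SuperSym.evenDer (adEE B X) (adEO B X) D = 0 :=
    (Submodule.mem_iInf _).1 hDe X
  have hDo' (X : SpoOdd B) : SuperSym.oddDer (adOE B X) (adOO B X) D = 0 :=
    (Submodule.mem_iInf _).1 hDo X
  simp only [hDe', hDo', map_zero] at hE hO
  -- Every `l` is the evaluation at some `v ∈ V₀`. Invariance under `elem₀₀ B v v` reads `B(v, ·)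
  -- ∂_v f = 0`, and for `v ≠ 0` the form `B(v, ·)` can be cancelled.
  have hp : ∀ l, SuperSym.evenPartial l (moment B D) = 0 := by
    intro l
    obtain ⟨v, rfl⟩ := (evalEquiv ℝ V₀).surjective l
    by_cases hv : v = 0
    · rw [hv, map_zero, evenPartial_zero]
    have h := hE (elem₀₀ B v v)
    rw [evenDer_elem₀₀] at h
    exact SuperSym.eq_zero_of_ι₀_mul (even_injective B hv)
      ((smul_eq_zero.1 h).resolve_left (by norm_num))
  refine SuperSym.eq_zero_of_partials (k := 2 * k) (by omega) (moment_mem_homogeneous B hDk) hp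
    fun l => ?_
  obtain ⟨w, rfl⟩ := (evalEquiv ℝ V₁).surjective l
  -- A nonzero even vector provides a form `B(v, ·)` that can be cancelled from `B(v, ·) ∂_w f = 0`;
  -- this is the use of `V₀ ≠ 0`.
  obtain ⟨v, hv⟩ := (finrank_pos_iff_exists_ne_zero (R := ℝ) (M := V₀)).1 h₀
  have h := hO (elem₀₁ B v w)
  rw [oddDer_elem₀₁, hp, mul_zero, sub_zero] at h
  exact SuperSym.eq_zero_of_ι₀_mul (even_injective B hv) h

/-- The reflection of `V₁` in a non isotropic vector. -/
def reflectionIsometry (B : SymplecticForm V₀ V₁) (w : V₁) (hw : B.odd w w ≠ 0) :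
    EvenIsometry B where
  even := LinearEquiv.refl ℝ V₀
  odd := Module.reflection (x := w) (f := (2 * (B.odd w w)⁻¹) • B.odd w) (by
    simp [hw])
  map_even _ _ := rfl
  map_odd v v' := by
    have h : B.odd v w = B.odd w v := B.odd_symm.eq v w
    rw [Module.reflection_apply, Module.reflection_apply]
    simp only [LinearMap.smul_apply, smul_eq_mul, map_sub, map_smul, LinearMap.sub_apply, h]
    field_simp
    ring

theorem reflectionIsometry_symm_apply (B : SymplecticForm V₀ V₁) (w : V₁) (hw : B.odd w w ≠ 0)
    (u : V₁) : (reflectionIsometry B w hw).odd.symm u =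
      u - (2 * (B.odd w w)⁻¹ * B.odd w u) • w := by
  rw [reflectionIsometry, Module.reflection_symm, Module.reflection_apply]
  rfl

/-- A reflection changes a linear form by a multiple of `ξ = B(w, ·)`. Since `ξ² = 0`, no higher
order terms occur in a product, and the induced automorphism is `1 - 2N`, where `N = B(w, w)⁻¹ ξ
∂_w`. -/
theorem map_reflection (B : SymplecticForm V₀ V₁) (w : V₁) (hw : B.odd w w ≠ 0)
    (f : SDual V₀ V₁) :
    SuperSym.map (LinearMap.lcomp ℝ ℝ ((reflectionIsometry B w hw).even.symm : V₀ →ₗ[ℝ] V₀))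
      (LinearMap.lcomp ℝ ℝ ((reflectionIsometry B w hw).odd.symm : V₁ →ₗ[ℝ] V₁)) f =
      f - (2 * (B.odd w w)⁻¹) •
        (SuperSym.ι₁ (B.odd w) * SuperSym.oddPartial (Dual.eval ℝ V₁ w) f) := by
  induction f using SuperSym.left_induction with
  | algebraMap r => simp
  | add x y hx hy => simp only [map_add, hx, hy, mul_add, smul_add]; abel
  | mul₀ φ x hx =>
    have h : LinearMap.lcomp ℝ ℝ ((reflectionIsometry B w hw).even.symm : V₀ →ₗ[ℝ] V₀) φ = φ := rfl
    rw [map_mul, hx, SuperSym.map_ι₀, h, SuperSym.oddPartial_ι₀_mul, ← SuperSym.ι₀_mul_left_comm,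
      mul_sub, mul_smul_comm]
  | mul₁ φ x hx =>
    have h : LinearMap.lcomp ℝ ℝ ((reflectionIsometry B w hw).odd.symm : V₁ →ₗ[ℝ] V₁) φ =
        φ - (2 * (B.odd w w)⁻¹ * φ w) • B.odd w := by
      ext u
      change φ ((reflectionIsometry B w hw).odd.symm u) = _
      rw [reflectionIsometry_symm_apply]
      simp
      ring
    rw [map_mul, hx, SuperSym.map_ι₁, h, SuperSym.oddPartial_ι₁_mul, map_sub, map_smul, mul_add,
      mul_neg, SuperSym.ι₁_mul_ι₁_mul (B.odd w) φ, sub_mul, mul_sub, mul_sub, smul_mul_assoc,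
      smul_mul_assoc, mul_smul_comm, mul_smul_comm, mul_smul_comm, Dual.eval_apply,
      ← mul_assoc (SuperSym.ι₁ (B.odd w)) (SuperSym.ι₁ (B.odd w)), SuperSym.ι₁_sq]
    simp only [zero_mul, smul_zero, smul_add, smul_smul, neg_neg]
    abel

/-- If `V = V₁`, then the invariants of degree `k ≥ 1` belong to the kernel of `μ̌` when
`k ≠ dim V / 2`, and when they are invariant under `O(V)`. -/
theorem moment_eq_zero_of_even_eq_zero (B : SymplecticForm V₀ V₁) (h₀ : finrank ℝ V₀ = 0) {k : ℕ}
    (hk : 0 < k) {D : SSpo B} (hD : D ∈ homogeneousInvariants B k)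
    (h : 2 * k ≠ finrank ℝ V₁ ∨ IsIsometryInvariant D) : moment B D = 0 := by
  obtain ⟨hDk, hDe, -⟩ := hD
  have hE (X : SpoEven B) := evenDer_moment X D
  have hDe' (X : SpoEven B) : SuperSym.evenDer (adEE B X) (adEO B X) D = 0 :=
    (Submodule.mem_iInf _).1 hDe X
  simp only [hDe', map_zero] at hE
  set f := moment B D with hf
  have hfk : f ∈ SuperSym.homogeneous (Dual ℝ V₀) (Dual ℝ V₁) (2 * k) :=
    moment_mem_homogeneous B hDk
  obtain ⟨w, hw⟩ := LinearMap.BilinForm.exists_orthogonal_basis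
    (LinearMap.BilinForm.isSymm_iff.1 B.odd_symm)
  have hε (i) : B.odd (w i) (w i) ≠ 0 :=
    hw.not_isOrtho_basis_self_of_separatingLeft B.odd_nondegenerate.1 i
  let ξ (i) : SDual V₀ V₁ := SuperSym.ι₁ (B.odd (w i))
  let d (i) : SDual V₀ V₁ →ₗ[ℝ] SDual V₀ V₁ := SuperSym.oddPartial (Dual.eval ℝ V₁ (w i))
  -- The projection onto the multiples of `ξ i`; the factor normalizes `∂ᵢ ξᵢ = B(wᵢ, wᵢ)`, the
  -- basis being orthogonal but not normalized.
  let N (i) : SDual V₀ V₁ →ₗ[ℝ] SDual V₀ V₁ :=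
    (B.odd (w i) (w i))⁻¹ • (LinearMap.mulLeft ℝ (ξ i) ∘ₗ d i)
  have hN (i x) : N i x = (B.odd (w i) (w i))⁻¹ • (ξ i * d i x) := rfl
  have hξξ (i x) : ξ i * (ξ i * x) = 0 := by rw [← mul_assoc, SuperSym.ι₁_sq, zero_mul]
  have hdξ (i x) : d i (ξ i * x) = -(ξ i * d i x) + B.odd (w i) (w i) • x :=
    SuperSym.oddPartial_ι₁_mul _ _ _
  have hdξ' (i j x) (hij : i ≠ j) : d i (ξ j * x) = -(ξ j * d i x) := by
    have h1 : B.odd (w j) (w i) = 0 := hw hij.symm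
    have h2 := SuperSym.oddPartial_ι₁_mul (W₀ := Dual ℝ V₀) (Dual.eval ℝ V₁ (w i)) (B.odd (w j)) x
    rwa [Dual.eval_apply, h1, zero_smul, add_zero] at h2
  -- Invariance of `f` under the rotation in the plane of `w i` and `w j`.
  have hsymm (i j) : ξ i * d j f = ξ j * d i f := by
    have h1 := hE (elem₁₁ B (w i) (w j))
    rw [evenDer_elem₁₁, sub_eq_zero] at h1
    exact h1.symm
  have hNN (i x) : N i (N i x) = N i x := by
    rw [hN i (N i x), hN, map_smul, hdξ, mul_smul_comm, mul_add, mul_neg, hξξ, neg_zero, zero_add,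
      mul_smul_comm, smul_smul (B.odd (w i) (w i))⁻¹ (B.odd (w i) (w i)), inv_mul_cancel₀ (hε i),
      one_smul]
  -- By the symmetry above, `ξᵢ ξⱼ ∂ᵢ f = ξᵢ ξᵢ ∂ⱼ f = 0`; applying `∂ⱼ` to this relation gives the
  -- identity.
  have hkey (i j) (hij : i ≠ j) : B.odd (w j) (w j) • (ξ i * d i f) = ξ i * (ξ j * d j (d i f)) := by
    have h1 : ξ i * (ξ j * d i f) = 0 := by rw [← hsymm i j, hξξ]
    have h2 := congrArg (d j) h1
    rw [map_zero, hdξ' j i _ hij.symm, hdξ, mul_add, mul_smul_comm, mul_neg, neg_add, neg_neg,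
      ← sub_eq_add_neg, sub_eq_zero] at h2
    exact h2.symm
  have hNf (i j) : N i f = N j f := by
    by_cases hij : i = j
    · rw [hij]
    have h1 := hkey i j hij
    have h2 := hkey j i (Ne.symm hij)
    have h3 : ξ j * (ξ i * d i (d j f)) = ξ i * (ξ j * d j (d i f)) := by
      rw [SuperSym.ι₁_mul_ι₁_mul]
      change -(ξ i * (ξ j * SuperSym.oddPartial _ (SuperSym.oddPartial _ f))) = _
      rw [SuperSym.oddPartial_oddPartial, mul_neg, mul_neg, neg_neg]
    rw [h3, ← h1] at h2
    rw [hN, hN]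
    have h4 := congrArg (fun x => ((B.odd (w i) (w i))⁻¹ * (B.odd (w j) (w j))⁻¹) • x) h2
    simp only [smul_smul] at h4
    rw [mul_right_comm, inv_mul_cancel₀ (hε i), one_mul, mul_assoc, inv_mul_cancel₀ (hε j),
      mul_one] at h4
    exact h4.symm
  -- Euler's identity in the coordinates dual to `w`, which are `B(wᵢ, wᵢ)⁻¹ B(wᵢ, ·)`. The even
  -- variables contribute an empty sum because `V₀ = 0`.
  have hEuler : ((2 * k : ℕ) : ℝ) • f = ∑ i, N i f := by
    rw [← SuperSym.euler_of_mem_homogeneous hfk,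
      SuperSym.euler_eq_sum (finBasis ℝ (Dual ℝ V₀)) w.dualBasis]
    have h1 : IsEmpty (Fin (finrank ℝ (Dual ℝ V₀))) := by
      rw [Subspace.dual_finrank_eq, h₀]
      infer_instance
    rw [Finset.univ_eq_empty, Finset.sum_empty, zero_add]
    refine Finset.sum_congr rfl fun i _ => ?_
    have h2 : w.dualBasis.coord i = Dual.eval ℝ V₁ (w i) := by
      ext φ
      simp
    have h3 : w.dualBasis i = (B.odd (w i) (w i))⁻¹ • B.odd (w i) := by
      refine w.ext fun j => ?_
      rw [Basis.dualBasis_apply_self, LinearMap.smul_apply, smul_eq_mul]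
      by_cases hij : j = i
      · subst hij
        rw [if_pos rfl, inv_mul_cancel₀ (hε j)]
      · have h4 : B.odd (w i) (w j) = 0 := hw (Ne.symm hij)
        rw [if_neg hij, h4, mul_zero]
    rw [h2, h3, map_smul, smul_mul_assoc]
    rfl
  have hk' : ((2 * k : ℕ) : ℝ) ≠ 0 := by exact_mod_cast (by omega : 2 * k ≠ 0)
  by_cases hn : finrank ℝ V₁ = 0
  · have h1 : IsEmpty (Fin (finrank ℝ V₁)) := by
      rw [hn]
      infer_instance
    rw [Finset.univ_eq_empty, Finset.sum_empty] at hEuler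
    exact (smul_eq_zero.1 hEuler).resolve_left hk'
  have i₀ : Fin (finrank ℝ V₁) := ⟨0, Nat.pos_of_ne_zero hn⟩
  rw [Finset.sum_congr rfl fun i _ => hNf i i₀, Finset.sum_const, Finset.card_univ,
    Fintype.card_fin, ← Nat.cast_smul_eq_nsmul ℝ] at hEuler
  -- Apply the idempotent `N i₀` to `2k f = (dim V₁) N i₀ f`.
  have hNf0 : (((2 * k : ℕ) : ℝ) - (finrank ℝ V₁ : ℝ)) • N i₀ f = 0 := by
    have h1 := congrArg (N i₀) hEuler
    rw [map_smul, map_smul, hNN] at h1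
    rw [sub_smul, h1, sub_self]
  by_cases h2k : 2 * k = finrank ℝ V₁
  · have h1 : N i₀ f = f := by
      rw [← h2k] at hEuler
      exact (smul_right_injective _ hk' hEuler).symm
    -- In half the dimension `f = N i₀ f`, so the reflection sends `f` to `f - 2f = -f`, while
    -- isometry invariance fixes it.
    have hinv := h.resolve_left (not_not.2 h2k) (reflectionIsometry B (w i₀) (hε i₀))
    have h2 := map_moment (reflectionIsometry B (w i₀) (hε i₀)) D
    rw [hinv, map_reflection, mul_smul] at h2
    change f - (2 : ℝ) • N i₀ f = f at h2
    rw [h1, sub_eq_self] at h2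
    exact (smul_eq_zero.1 h2).resolve_left two_ne_zero
  · have h1 : N i₀ f = 0 := (smul_eq_zero.1 hNf0).resolve_left (by
      rw [sub_eq_zero]
      exact_mod_cast h2k)
    rw [h1, smul_zero] at hEuler
    exact (smul_eq_zero.1 hEuler).resolve_left hk'

/-! ### The Casimir element -/

section Casimir

variable (B : SymplecticForm V₀ V₁)

/-- The `V₀` block of the product is a sum of two rank one maps and its `V₁` block is zero. The two
traces agree by skewness, so `K` against elementary elements reads off the matrix coefficients of
`X`. -/
theorem K_elem₀₀ (X : SpoEven B × SpoOdd B) (v w : V₀) :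
    K B X (elem₀₀ B v w, 0) = -2 * B.even (block₀₀ X.1.val v) w := by
  have h1 : LinearMap.fst ℝ V₀ V₁ ∘ₗ ((X.1.val + X.2.val) * ((elem₀₀ B v w).val +
      (0 : SpoOdd B).val)) ∘ₗ LinearMap.inl ℝ V₀ V₁ =
      (B.even v).smulRight (block₀₀ X.1.val w) + (B.even w).smulRight (block₀₀ X.1.val v) := by
    rw [map_zero, add_zero]
    ext u
    change (X.1.val (B.even v u • w + B.even w u • v, 0)).1 +
      (X.2.val (B.even v u • w + B.even w u • v, 0)).1 = _
    rw [X.1.val_inl, X.2.val_inl]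
    simp
  have h2 : LinearMap.snd ℝ V₀ V₁ ∘ₗ ((X.1.val + X.2.val) * ((elem₀₀ B v w).val +
      (0 : SpoOdd B).val)) ∘ₗ LinearMap.inr ℝ V₀ V₁ = 0 := by
    rw [map_zero, add_zero]
    ext u
    change (X.1.val (B.even v 0 • w + B.even w 0 • v, 0)).2 +
      (X.2.val (B.even v 0 • w + B.even w 0 • v, 0)).2 = _
    rw [X.1.val_inl, X.2.val_inl]
    simp
  rw [K, str, h1, h2, map_zero, map_add, LinearMap.trace_smulRight, LinearMap.trace_smulRight,
    X.1.skew₀ v w, ← B.even_alt.neg_eq]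
  ring

theorem K_elem₁₁ (X : SpoEven B × SpoOdd B) (v w : V₁) :
    K B X (elem₁₁ B v w, 0) = 2 * B.odd (block₁₁ X.1.val v) w := by
  have h1 : LinearMap.snd ℝ V₀ V₁ ∘ₗ ((X.1.val + X.2.val) * ((elem₁₁ B v w).val +
      (0 : SpoOdd B).val)) ∘ₗ LinearMap.inr ℝ V₀ V₁ =
      (B.odd v).smulRight (block₁₁ X.1.val w) - (B.odd w).smulRight (block₁₁ X.1.val v) := by
    rw [map_zero, add_zero]
    ext u
    change (X.1.val (0, B.odd v u • w - B.odd w u • v)).2 +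
      (X.2.val (0, B.odd v u • w - B.odd w u • v)).2 = _
    rw [X.1.val_inr, X.2.val_inr]
    simp
  have h2 : LinearMap.fst ℝ V₀ V₁ ∘ₗ ((X.1.val + X.2.val) * ((elem₁₁ B v w).val +
      (0 : SpoOdd B).val)) ∘ₗ LinearMap.inl ℝ V₀ V₁ = 0 := by
    rw [map_zero, add_zero]
    ext u
    change (X.1.val (0, B.odd v 0 • w - B.odd w 0 • v)).1 +
      (X.2.val (0, B.odd v 0 • w - B.odd w 0 • v)).1 = _
    rw [X.1.val_inr, X.2.val_inr]
    simp
  have h3 : B.odd w (block₁₁ X.1.val v) = B.odd (block₁₁ X.1.val v) w := B.odd_symm.eq _ _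
  rw [K, str, h1, h2, map_zero, map_sub, LinearMap.trace_smulRight, LinearMap.trace_smulRight,
    X.1.skew₁ v w, h3]
  ring

/-- Each diagonal block of the product contributes one rank one trace; by skewness, the sign of the
supertrace makes the two contributions add. -/
theorem K_elem₀₁ (X : SpoEven B × SpoOdd B) (v : V₀) (w : V₁) :
    K B X (0, elem₀₁ B v w) = -2 * B.odd (block₁₀ X.2.val v) w := by
  have h1 : LinearMap.fst ℝ V₀ V₁ ∘ₗ ((X.1.val + X.2.val) * ((0 : SpoEven B).val +
      (elem₀₁ B v w).val)) ∘ₗ LinearMap.inl ℝ V₀ V₁ =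
      (B.even v).smulRight (block₀₁ X.2.val w) := by
    rw [map_zero, zero_add]
    ext u
    change ((X.1.val + X.2.val) ((elem₀₁ B v w).val (u, 0))).1 = _
    rw [SpoOdd.val_inl, block₁₀_elem₀₁, LinearMap.add_apply, X.1.val_inr, X.2.val_inr]
    simp
  have h2 : LinearMap.snd ℝ V₀ V₁ ∘ₗ ((X.1.val + X.2.val) * ((0 : SpoEven B).val +
      (elem₀₁ B v w).val)) ∘ₗ LinearMap.inr ℝ V₀ V₁ =
      (B.odd w).smulRight (block₁₀ X.2.val v) := by
    rw [map_zero, zero_add]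
    ext u
    change ((X.1.val + X.2.val) ((elem₀₁ B v w).val (0, u))).2 = _
    rw [SpoOdd.val_inr, block₀₁_elem₀₁, LinearMap.add_apply, X.1.val_inl, X.2.val_inl]
    simp
  have h3 : B.odd w (block₁₀ X.2.val v) = B.odd (block₁₀ X.2.val v) w := B.odd_symm.eq _ _
  rw [K, str, h1, h2, LinearMap.trace_smulRight, LinearMap.trace_smulRight, X.2.skew₀ v w, h3]
  ring

theorem low₀_eq_sum (v : V₀) :
    low₀ B v = ∑ k, B.even v (finBasis ℝ V₀ k) • (evenCoord k : SDual V₀ V₁) :=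
  (sum_apply_smul_map_coord (finBasis ℝ V₀) SuperSym.ι₀ _).symm

theorem low₁_eq_sum (v : V₁) :
    low₁ B v = ∑ k, B.odd v (finBasis ℝ V₁ k) • (oddCoord k : SDual V₀ V₁) :=
  (sum_apply_smul_map_coord (finBasis ℝ V₁) SuperSym.ι₁ _).symm

theorem contr₀_comp_smulRight {W : Type*} [AddCommGroup W] [Module ℝ W]
    (L : W →ₗ[ℝ] SDual V₀ V₁) (φ : Dual ℝ V₀) (w : W) :
    contr₀ (L ∘ₗ φ.smulRight w) = L w * SuperSym.ι₀ φ := by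
  rw [contr₀_apply, ← sum_apply_smul_map_coord (finBasis ℝ V₀) SuperSym.ι₀ φ, Finset.mul_sum]
  exact Finset.sum_congr rfl fun i _ => by
    rw [LinearMap.comp_apply, LinearMap.smulRight_apply, map_smul, smul_mul_assoc, mul_smul_comm]
    rfl

theorem contr₁_comp_smulRight {W : Type*} [AddCommGroup W] [Module ℝ W]
    (L : W →ₗ[ℝ] SDual V₀ V₁) (φ : Dual ℝ V₁) (w : W) :
    contr₁ (L ∘ₗ φ.smulRight w) = L w * SuperSym.ι₁ φ := by
  rw [contr₁_apply, ← sum_apply_smul_map_coord (finBasis ℝ V₁) SuperSym.ι₁ φ, Finset.mul_sum]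
  exact Finset.sum_congr rfl fun i _ => by
    rw [LinearMap.comp_apply, LinearMap.smulRight_apply, map_smul, smul_mul_assoc, mul_smul_comm]
    rfl

/-- Rank one maps contract to products of linear forms, so elementary elements have decomposable
moments. This is what lets the Casimir sum factor. -/
theorem momentEven_elem₀₀ (v w : V₀) : momentEven B (elem₀₀ B v w) = low₀ B v * low₀ B w := by
  rw [momentEven_eq, block₀₀_elem₀₀, block₁₁_elem₀₀, LinearMap.comp_zero, map_zero, add_zero,
    LinearMap.comp_add, map_add, contr₀_comp_smulRight,
    contr₀_comp_smulRight]
  change (1 / 2 : ℝ) • (low₀ B w * low₀ B v + low₀ B v * low₀ B w) = _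
  rw [show low₀ B w * low₀ B v = low₀ B v * low₀ B w from SuperSym.ι₀_commute _ _]
  module

theorem low₁_anticomm (v w : V₁) : low₁ B v * low₁ B w = -(low₁ B w * low₁ B v) :=
  eq_neg_of_add_eq_zero_left (SuperSym.ι₁_anticomm _ _)

theorem momentEven_elem₁₁ (v w : V₁) : momentEven B (elem₁₁ B v w) = low₁ B w * low₁ B v := by
  rw [momentEven_eq, block₀₀_elem₁₁, block₁₁_elem₁₁, LinearMap.comp_zero, map_zero, zero_add,
    LinearMap.comp_sub, map_sub, contr₁_comp_smulRight,
    contr₁_comp_smulRight]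
  change (1 / 2 : ℝ) • (low₁ B w * low₁ B v - low₁ B v * low₁ B w) = _
  rw [low₁_anticomm B v w]
  module

theorem momentOdd_elem₀₁ (v : V₀) (w : V₁) :
    momentOdd B (elem₀₁ B v w) = low₁ B w * low₀ B v := by
  rw [momentOdd_eq₀, block₁₀_elem₀₁, contr₀_comp_smulRight]
  rfl

theorem eq_zero_of_eq_neg {A : Type*} [AddCommGroup A] [Module ℝ A] {x : A} (h : x = -x) :
    x = 0 := by
  have h2 : (2 : ℝ) • x = 0 := by
    rw [two_smul]
    nth_rewrite 2 [h]
    exact add_neg_cancel x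
  exact (smul_eq_zero.1 h2).resolve_left two_ne_zero

/-- The tensor `∑ B(gᵢ, ·) zⁱ`, the value of `B` on `V₀` at the generic point, vanishes. -/
theorem contr₀_low₀ : contr₀ (low₀ B) = 0 := by
  rw [contr₀_apply]
  simp only [low₀_eq_sum, Finset.sum_mul, smul_mul_assoc]
  -- Exchanging the two summation indices changes the sign of the alternating form and leaves the
  -- product of commuting coordinates unchanged.
  refine eq_zero_of_eq_neg ?_
  conv_lhs => rw [Finset.sum_comm]
  rw [← Finset.sum_neg_distrib]
  refine Finset.sum_congr rfl fun i _ => ?_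
  rw [← Finset.sum_neg_distrib]
  refine Finset.sum_congr rfl fun j _ => ?_
  rw [← B.even_alt.neg_eq, neg_smul]
  congr 2
  exact SuperSym.ι₀_commute _ _

/-- The tensor `∑ B(gᵢ, ·) zⁱ`, the value of `B` on `V₁` at the generic point, vanishes. -/
theorem contr₁_low₁ : contr₁ (low₁ B) = 0 := by
  rw [contr₁_apply]
  simp only [low₁_eq_sum, Finset.sum_mul, smul_mul_assoc]
  -- Here the form is symmetric and the sign comes from the anticommuting coordinates.
  refine eq_zero_of_eq_neg ?_
  conv_lhs => rw [Finset.sum_comm]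
  rw [← Finset.sum_neg_distrib]
  refine Finset.sum_congr rfl fun i _ => ?_
  rw [← Finset.sum_neg_distrib]
  refine Finset.sum_congr rfl fun j _ => ?_
  have h : B.odd (finBasis ℝ V₁ j) (finBasis ℝ V₁ i) =
    B.odd (finBasis ℝ V₁ i) (finBasis ℝ V₁ j) := B.odd_symm.eq _ _
  rw [h, ← smul_neg]
  congr 1
  exact eq_neg_of_add_eq_zero_left (SuperSym.ι₁_anticomm _ _)

/-- The moment map in terms of `K`. -/
theorem moment_ι_eq_sum (X : SpoEven B × SpoOdd B) : moment B (SuperSym.ι X) =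
    (∑ i, ∑ k, K B X (elem₀₀ B (finBasis ℝ V₀ i) (finBasis ℝ V₀ k), 0) •
      ((-1 / 4 : ℝ) • (evenCoord k * evenCoord i : SDual V₀ V₁))) +
    (∑ i, ∑ k, K B X (elem₁₁ B (finBasis ℝ V₁ i) (finBasis ℝ V₁ k), 0) •
      ((1 / 4 : ℝ) • (oddCoord k * oddCoord i : SDual V₀ V₁))) +
    ∑ i, ∑ k, K B X (0, elem₀₁ B (finBasis ℝ V₀ i) (finBasis ℝ V₁ k)) •
      ((-1 / 2 : ℝ) • (oddCoord k * evenCoord i : SDual V₀ V₁)) := by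
  -- The constants `-1/4`, `1/4`, `-1/2` are the factors `1/2`, `1/2`, `1` of the three
  -- contractions, divided by the factors `-2`, `2`, `-2` in the values of `K`.
  have e : (SuperSym.ι X : SSpo B) = SuperSym.ι₀ X.1 + SuperSym.ι₁ X.2 := rfl
  rw [e, map_add, moment_ι₀, moment_ι₁, momentEven_eq, momentOdd_eq₀, contr₀_apply, contr₁_apply,
    contr₀_apply, smul_add, Finset.smul_sum, Finset.smul_sum]
  simp only [LinearMap.comp_apply, low₀_eq_sum, low₁_eq_sum, Finset.sum_mul, Finset.smul_sum,
    K_elem₀₀, K_elem₁₁, K_elem₀₁, smul_mul_assoc, smul_smul]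
  refine congrArg₂ _ (congrArg₂ _ ?_ ?_) ?_ <;>
    exact Finset.sum_congr rfl fun i _ => Finset.sum_congr rfl fun k _ => by
      congr 1
      ring

/-- The Casimir element belongs to the kernel of `μ̌`, because `B(v, v) = 0` at the generic
point. -/
theorem moment_casimir {N : ℕ} (X X' : Basis (Fin N) ℝ (SpoEven B × SpoOdd B))
    (h : ∀ i j, K B (X i) (X' j) = if i = j then 1 else 0) : moment B (casimir B X X') = 0 := by
  have hlin (Z : SpoEven B × SpoOdd B) : ∃ κ : Dual ℝ (SpoEven B × SpoOdd B), ∀ Y, κ Y = K B Z Y :=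
    ⟨{ toFun := K B Z
       map_add' := fun Y Y' => by
        simp only [K, str, Prod.fst_add, Prod.snd_add, map_add, mul_add, add_mul,
          LinearMap.add_comp, LinearMap.comp_add]
        ring
       map_smul' := fun c Y => by
        simp only [K, str, Prod.smul_fst, Prod.smul_snd, map_smul, ← smul_add, mul_smul_comm,
          LinearMap.smul_comp, LinearMap.comp_smul, smul_eq_mul, RingHom.id_apply]
        ring }, fun Y => rfl⟩
  -- Biorthogonality makes the forms `K(Xᵢ, ·)` the coordinates in the basis `X'`. Only linearity of
  -- `K` in its second argument is used.
  have hexp (Y : SpoEven B × SpoOdd B) : ∑ i, K B (X i) Y • X' i = Y := by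
    conv_rhs => rw [← X'.sum_repr Y]
    refine Finset.sum_congr rfl fun i _ => ?_
    congr 1
    obtain ⟨κ, hκ⟩ := hlin (X i)
    rw [← hκ]
    conv_lhs => rw [← X'.sum_repr Y, map_sum]
    simp_rw [map_smul, hκ, h]
    simp
  let Φ : SpoEven B × SpoOdd B →ₗ[ℝ] SDual V₀ V₁ := (moment B).toLinearMap ∘ₗ SuperSym.ι
  have hΦ (Y) (s : SDual V₀ V₁) : ∑ i, Φ (X' i) * (K B (X i) Y • s) = Φ Y * s := by
    conv_rhs => rw [← hexp Y, map_sum, Finset.sum_mul]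
    exact Finset.sum_congr rfl fun i _ => by rw [map_smul, smul_mul_assoc, mul_smul_comm]
  have hstep : moment B (casimir B X X') = ∑ i, Φ (X' i) * moment B (SuperSym.ι (X i)) := by
    simp only [casimir, map_sum, map_mul]
    rfl
  have hE (v w) : Φ (elem₀₀ B v w, 0) = low₀ B v * low₀ B w := by
    change moment B (SuperSym.ι₀ (elem₀₀ B v w) + SuperSym.ι₁ 0) = _
    rw [map_zero, add_zero, moment_ι₀, momentEven_elem₀₀]
  have hE' (v w) : Φ (elem₁₁ B v w, 0) = low₁ B w * low₁ B v := by
    change moment B (SuperSym.ι₀ (elem₁₁ B v w) + SuperSym.ι₁ 0) = _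
    rw [map_zero, add_zero, moment_ι₀, momentEven_elem₁₁]
  have hO (v w) : Φ (0, elem₀₁ B v w) = low₁ B w * low₀ B v := by
    change moment B (SuperSym.ι₀ 0 + SuperSym.ι₁ (elem₀₁ B v w)) = _
    rw [map_zero, zero_add, moment_ι₁, momentOdd_elem₀₁]
  -- Summing over the Casimir index replaces `X' i` by the elementary element paired with `X i`, so
  -- that both bases disappear from the formula.
  have hswap {I J : Type} [Fintype I] [Fintype J] (Y : I → J → SpoEven B × SpoOdd B)
      (s : I → J → SDual V₀ V₁) :
      ∑ i, Φ (X' i) * ∑ a, ∑ b, K B (X i) (Y a b) • s a b = ∑ a, ∑ b, Φ (Y a b) * s a b := by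
    simp only [Finset.mul_sum]
    rw [Finset.sum_comm]
    refine Finset.sum_congr rfl fun a _ => ?_
    rw [Finset.sum_comm]
    exact Finset.sum_congr rfl fun b _ => hΦ _ _
  rw [hstep]
  simp only [moment_ι_eq_sum, mul_add, Finset.sum_add_distrib, hswap, hE, hE', hO, mul_smul_comm,
    ← Finset.smul_sum]
  -- The three double sums factor, up to sign, into products of `contr₀ (low₀ B)` and `contr₁ (low₁
  -- B)`, the two parts of `B(v, v)` at the generic point.
  have h1 : ∑ i, ∑ k, low₀ B (finBasis ℝ V₀ i) * low₀ B (finBasis ℝ V₀ k) *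
      (evenCoord k * evenCoord i : SDual V₀ V₁) = contr₀ (low₀ B) * contr₀ (low₀ B) := by
    rw [contr₀_apply, Finset.sum_mul_sum]
    refine Finset.sum_congr rfl fun i _ => Finset.sum_congr rfl fun k _ => ?_
    have c : Commute (low₀ B (finBasis ℝ V₀ k)) (evenCoord i : SDual V₀ V₁) :=
      SuperSym.ι₀_commute _ _
    rw [c.symm.mul_mul_mul_comm, show (evenCoord k * evenCoord i : SDual V₀ V₁) =
      evenCoord i * evenCoord k from SuperSym.ι₀_commute _ _]
  have h2 : ∑ i, ∑ k, low₁ B (finBasis ℝ V₁ k) * low₁ B (finBasis ℝ V₁ i) *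
      (oddCoord k * oddCoord i : SDual V₀ V₁) = -(contr₁ (low₁ B) * contr₁ (low₁ B)) := by
    rw [contr₁_apply, Finset.sum_mul_sum, Finset.sum_comm, ← Finset.sum_neg_distrib]
    refine Finset.sum_congr rfl fun i _ => ?_
    rw [← Finset.sum_neg_distrib]
    refine Finset.sum_congr rfl fun k _ => ?_
    have c : low₁ B (finBasis ℝ V₁ k) * (oddCoord i : SDual V₀ V₁) =
        -(oddCoord i * low₁ B (finBasis ℝ V₁ k)) :=
      eq_neg_of_add_eq_zero_left (SuperSym.ι₁_anticomm _ _)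
    simp only [mul_assoc]
    rw [← mul_assoc (low₁ B (finBasis ℝ V₁ k)), c, neg_mul, mul_neg, mul_assoc]
  have h3 : ∑ i, ∑ k, low₁ B (finBasis ℝ V₁ k) * low₀ B (finBasis ℝ V₀ i) *
      (oddCoord k * evenCoord i : SDual V₀ V₁) = contr₁ (low₁ B) * contr₀ (low₀ B) := by
    rw [contr₁_apply, contr₀_apply, Finset.sum_mul_sum, Finset.sum_comm]
    refine Finset.sum_congr rfl fun i _ => Finset.sum_congr rfl fun k _ => ?_
    have c : Commute (low₀ B (finBasis ℝ V₀ k)) (oddCoord i : SDual V₀ V₁) :=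
      SuperSym.ι₀_commute _ _
    rw [c.mul_mul_mul_comm]
  rw [h1, h2, h3, contr₀_low₀, contr₁_low₁]
  simp

end Casimir

end SuperPfaffian
end

noncomputable section

set_option linter.unusedSectionVars false
set_option maxSynthPendingDepth 3

namespace SuperPfaffian

/-! ### Gaussian integrals depending on parameters -/

section Gaussian

open MeasureTheory

/-- Since `1 + y ≤ e^y`, the left side is at most `exp(my - cy²)`, and completing the square bounds
the exponent by `m²/(4c)`. -/
theorem one_add_pow_mul_exp_neg_le {c : ℝ} (hc : 0 < c) (m : ℕ) {y : ℝ} (hy : 0 ≤ y) :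
    (1 + y) ^ m * Real.exp (-(c * y ^ 2)) ≤ Real.exp ((m : ℝ) ^ 2 / (4 * c)) := by
  have h1 : (1 + y) ^ m ≤ Real.exp (m * y) := by
    rw [Real.exp_nat_mul]
    exact pow_le_pow_left₀ (by positivity) (by linarith [Real.add_one_le_exp y]) m
  calc (1 + y) ^ m * Real.exp (-(c * y ^ 2)) ≤ Real.exp (m * y) * Real.exp (-(c * y ^ 2)) := by
        gcongr
    _ = Real.exp (m * y - c * y ^ 2) := by rw [← Real.exp_add]; ring_nf
    _ ≤ Real.exp ((m : ℝ) ^ 2 / (4 * c)) := by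
        refine Real.exp_le_exp.2 ?_
        rw [le_div_iff₀ (by positivity)]
        nlinarith [sq_nonneg ((m : ℝ) - 2 * c * y)]

variable {T U : Type*} [NormedAddCommGroup T] [NormedSpace ℝ T] [FiniteDimensional ℝ T]
  [NormedAddCommGroup U] [NormedSpace ℝ U] [FiniteDimensional ℝ U] [MeasurableSpace U]
  [BorelSpace U]

theorem integrable_one_add_pow_mul_exp_neg (μ : Measure U) [μ.IsAddHaarMeasure] {c : ℝ}
    (hc : 0 < c) (m : ℕ) :
    Integrable (fun x : U => (1 + ‖x‖) ^ m * Real.exp (-(c * ‖x‖ ^ 2))) μ := by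
  -- An exponent larger than the dimension makes `(1 + ‖x‖)^(-d)` integrable; the Gaussian absorbs
  -- the extra factor `(1 + ‖x‖)^d`.
  set d := finrank ℝ U + 1
  have hd : Integrable (fun x : U => (1 + ‖x‖) ^ (-(d : ℝ))) μ :=
    integrable_one_add_norm (by simp [d])
  refine (hd.const_mul (Real.exp (((m + d : ℕ) : ℝ) ^ 2 / (4 * c)))).mono'
    (Continuous.aestronglyMeasurable (by fun_prop)) (Filter.Eventually.of_forall fun x => ?_)
  have h1 : 0 < 1 + ‖x‖ := by positivity
  have h := one_add_pow_mul_exp_neg_le hc (m + d) (norm_nonneg x)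
  rw [Real.norm_of_nonneg (by positivity), Real.rpow_neg h1.le, Real.rpow_natCast,
    ← div_eq_mul_inv, le_div_iff₀ (by positivity)]
  calc (1 + ‖x‖) ^ m * Real.exp (-(c * ‖x‖ ^ 2)) * (1 + ‖x‖) ^ d =
        (1 + ‖x‖) ^ (m + d) * Real.exp (-(c * ‖x‖ ^ 2)) := by ring
    _ ≤ _ := h

theorem HasTemperateGrowth.fderiv {E F : Type*} [NormedAddCommGroup E] [NormedSpace ℝ E]
    [NormedAddCommGroup F] [NormedSpace ℝ F] {f : E → F} (hf : f.HasTemperateGrowth) :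
    (fderiv ℝ f).HasTemperateGrowth := by
  refine ⟨hf.1.fderiv_right (by simp), fun n => ?_⟩
  obtain ⟨k, C, h⟩ := hf.2 (n + 1)
  exact ⟨k, C, fun x => by rw [norm_iteratedFDeriv_fderiv]; exact h x⟩

variable (Q : T →L[ℝ] U →L[ℝ] U →L[ℝ] ℝ) (P : T × U → ℂ)

/-- The function `exp(-½ Q_t(x, x)) P(t, x)`. -/
def gaussian (t : T) (x : U) : ℂ := (Real.exp (-(1 / 2) * Q t x x) : ℂ) * P (t, x)

/-- The polynomial factor in the derivative of `exp(-½ Q_t(x, x)) P(t, x)` along `Y`. -/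
def gaussianDer (Y : T) (p : T × U) : ℂ :=
  fderiv ℝ P p (Y, 0) - ((1 / 2 * Q Y p.2 p.2 : ℝ) : ℂ) * P p

/-- The polynomial factor in the derivative of `exp(-½ Q_t(x, x)) P(t, x)` in `t`. -/
def gaussianFactor (p : T × U) : T →L[ℝ] ℂ :=
  (fderiv ℝ P p).comp (ContinuousLinearMap.inl ℝ T U) -
    P p • Complex.ofRealCLM.comp ((1 / 2 : ℝ) • (Q.flip p.2).flip p.2)

theorem gaussianFactor_apply (p : T × U) (Y : T) : gaussianFactor Q P p Y = gaussianDer Q P Y p := by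
  simp [gaussianFactor, gaussianDer, mul_comm]

variable {P}

/-- Tempered factors are stable under differentiation of the Gaussian in the parameter. This lets a
single result on first derivatives be iterated. -/
theorem gaussianDer_hasTemperateGrowth (hP : P.HasTemperateGrowth) (Y : T) :
    (gaussianDer Q P Y).HasTemperateGrowth := by
  have h1 : Function.HasTemperateGrowth fun p : T × U => fderiv ℝ P p (Y, 0) :=
    (ContinuousLinearMap.apply ℝ ℂ ((Y, 0) : T × U)).hasTemperateGrowth.comp
      (HasTemperateGrowth.fderiv hP)
  have h2 : Function.HasTemperateGrowth fun p : T × U => p.2 :=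
    (ContinuousLinearMap.snd ℝ T U).hasTemperateGrowth
  have h3 : Function.HasTemperateGrowth fun p : T × U => Q Y p.2 p.2 :=
    (Q Y).bilinear_hasTemperateGrowth h2 h2
  have h4 : Function.HasTemperateGrowth fun p : T × U => ((1 / 2 * Q Y p.2 p.2 : ℝ) : ℂ) :=
    (Complex.ofRealCLM.comp ((1 / 2 : ℝ) • ContinuousLinearMap.id ℝ ℝ)).hasTemperateGrowth.comp h3
  exact h1.sub (h4.mul hP)

theorem hasFDerivAt_gaussian (hP : P.HasTemperateGrowth) (t : T) (x : U) :
    HasFDerivAt (fun t => gaussian Q P t x)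
      ((Real.exp (-(1 / 2) * Q t x x) : ℂ) • gaussianFactor Q P (t, x)) t := by
  have h1 : HasFDerivAt (fun t => P (t, x))
      ((fderiv ℝ P (t, x)).comp (ContinuousLinearMap.inl ℝ T U)) t :=
    ((hP.1.differentiable (by simp)) (t, x)).hasFDerivAt.comp t (hasFDerivAt_prodMk_left t x)
  have h2 : HasFDerivAt (fun t => -(1 / 2) * Q t x x) (-(1 / 2 : ℝ) • (Q.flip x).flip x) t :=
    (((Q.flip x).flip x).hasFDerivAt (x := t)).const_mul (-(1 / 2 : ℝ))
  have h3 := Complex.ofRealCLM.hasFDerivAt.comp t h2.exp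
  refine (h3.mul h1).congr_fderiv ?_
  ext Y
  simp [gaussianFactor]
  ring

theorem norm_gaussianFactor_le (hP : P.HasTemperateGrowth) : ∃ (k : ℕ) (C : ℝ), 0 ≤ C ∧
    ∀ p, ‖gaussianFactor Q P p‖ ≤ C * (1 + ‖p‖) ^ k ∧ ‖P p‖ ≤ C * (1 + ‖p‖) ^ k := by
  obtain ⟨k, C, hC, h⟩ := hP.norm_iteratedFDeriv_le_uniform 1
  -- The two additional powers come from the quadratic form `Q_t(x, x)` brought down from the
  -- exponent.
  refine ⟨k + 2, C + C * ‖Q‖, by positivity, fun p => ?_⟩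
  have h0 : ‖P p‖ ≤ C * (1 + ‖p‖) ^ k := by simpa using h 0 (by simp) p
  have h1 : ‖fderiv ℝ P p‖ ≤ C * (1 + ‖p‖) ^ k := by
    simpa [norm_iteratedFDeriv_one] using h 1 le_rfl p
  have hone : (1 : ℝ) ≤ (1 + ‖p‖) := by linarith [norm_nonneg p]
  have hpow : (1 + ‖p‖) ^ k ≤ (1 + ‖p‖) ^ (k + 2) := pow_le_pow_right₀ hone (by omega)
  constructor
  · have h2 : ‖(fderiv ℝ P p).comp (ContinuousLinearMap.inl ℝ T U)‖ ≤ C * (1 + ‖p‖) ^ (k + 2) := by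
      refine (ContinuousLinearMap.opNorm_comp_le _ _).trans ?_
      calc _ ≤ (C * (1 + ‖p‖) ^ k) * 1 := by
            gcongr
            exact ContinuousLinearMap.norm_inl_le_one ℝ T U
        _ ≤ _ := by rw [mul_one]; gcongr
    have h3 : ‖Complex.ofRealCLM.comp ((1 / 2 : ℝ) • (Q.flip p.2).flip p.2)‖ ≤
        ‖Q‖ * (1 + ‖p‖) ^ 2 := by
      refine ContinuousLinearMap.opNorm_le_bound _ (by positivity) fun Y => ?_
      have h4 : ‖Q Y p.2 p.2‖ ≤ ‖Q‖ * ‖Y‖ * ‖p.2‖ * ‖p.2‖ :=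
        (Q Y p.2).le_of_opNorm_le ((Q Y).le_of_opNorm_le (Q.le_opNorm Y) _) _
      have h5 : ‖p.2‖ ≤ 1 + ‖p‖ := (norm_snd_le p).trans (by linarith)
      calc ‖Complex.ofRealCLM.comp ((1 / 2 : ℝ) • (Q.flip p.2).flip p.2) Y‖
          = 1 / 2 * ‖Q Y p.2 p.2‖ := by simp
        _ ≤ 1 * (‖Q‖ * ‖Y‖ * ‖p.2‖ * ‖p.2‖) := by gcongr; norm_num
        _ ≤ 1 * (‖Q‖ * ‖Y‖ * (1 + ‖p‖) * (1 + ‖p‖)) := by gcongr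
        _ = ‖Q‖ * (1 + ‖p‖) ^ 2 * ‖Y‖ := by ring
    refine (norm_sub_le _ _).trans ?_
    rw [norm_smul]
    calc _ ≤ C * (1 + ‖p‖) ^ (k + 2) + C * (1 + ‖p‖) ^ k * (‖Q‖ * (1 + ‖p‖) ^ 2) := by gcongr
      _ = _ := by ring
  · calc ‖P p‖ ≤ C * (1 + ‖p‖) ^ (k + 2) := h0.trans (by gcongr)
      _ ≤ _ := by
        gcongr
        linarith [mul_nonneg hC (norm_nonneg Q)]

/-- Near a point where `Q_t` is positive definite, it is uniformly so. -/
theorem exists_coercive {t₀ : T} (h : ∀ x, x ≠ 0 → 0 < Q t₀ x x) :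
    ∃ δ > 0, ∃ c > 0, ∀ t ∈ Metric.ball t₀ δ, ∀ x, c * ‖x‖ ^ 2 ≤ Q t x x := by
  obtain ⟨ε, hε, hε'⟩ := (isCompact_sphere (0 : U) 1).exists_forall_le' (f := fun x => Q t₀ x x)
    (by fun_prop) (a := 0) (fun x hx => h x (by
      rintro rfl
      simp at hx))
  -- On this ball `‖Q‖ ‖t - t₀‖ ≤ ε/2`, so half of the lower bound `ε` on the unit sphere survives;
  -- the `+ 1` keeps the radius defined when `Q = 0`.
  refine ⟨ε / (2 * (‖Q‖ + 1)), by positivity, ε / 2, by positivity, fun t ht x => ?_⟩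
  by_cases hx : x = 0
  · simp [hx]
  have hn : 0 < ‖x‖ := norm_pos_iff.2 hx
  have h1 : ε * ‖x‖ ^ 2 ≤ Q t₀ x x := by
    have h2 := hε' (‖x‖⁻¹ • x) (by
      rw [mem_sphere_zero_iff_norm, norm_smul, norm_inv, norm_norm, inv_mul_cancel₀ hn.ne'])
    simp only [map_smul, smul_apply, smul_eq_mul] at h2
    calc ε * ‖x‖ ^ 2 ≤ (‖x‖⁻¹ * (‖x‖⁻¹ * Q t₀ x x)) * ‖x‖ ^ 2 := by gcongr
      _ = Q t₀ x x := by field_simp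
  have h2 : ‖Q (t - t₀) x x‖ ≤ ‖Q‖ * ‖t - t₀‖ * ‖x‖ * ‖x‖ :=
    (Q (t - t₀) x).le_of_opNorm_le ((Q (t - t₀)).le_of_opNorm_le (Q.le_opNorm _) _) _
  have h3 : ‖Q‖ * ‖t - t₀‖ ≤ ε / 2 := by
    rw [mem_ball_iff_norm] at ht
    calc ‖Q‖ * ‖t - t₀‖ ≤ (‖Q‖ + 1) * (ε / (2 * (‖Q‖ + 1))) := by gcongr; linarith
      _ = ε / 2 := by field_simp
  have h4 : Q t x x = Q t₀ x x + Q (t - t₀) x x := by simp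
  have h5 : ‖Q (t - t₀) x x‖ ≤ ε / 2 * ‖x‖ ^ 2 := by
    refine h2.trans ?_
    calc ‖Q‖ * ‖t - t₀‖ * ‖x‖ * ‖x‖ ≤ ε / 2 * ‖x‖ * ‖x‖ := by gcongr
      _ = _ := by ring
  rw [Real.norm_eq_abs] at h5
  have h6 := (abs_le.1 h5).1
  linarith

theorem continuous_gaussian (hP : P.HasTemperateGrowth) (t : T) : Continuous (gaussian Q P t) := by
  have := hP.1.continuous
  unfold gaussian
  fun_prop

variable (μ : Measure U) [μ.IsAddHaarMeasure]

theorem integrable_gaussian (hP : P.HasTemperateGrowth) {t₀ : T} (h : ∀ x, x ≠ 0 → 0 < Q t₀ x x) :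
    Integrable (gaussian Q P t₀) μ := by
  obtain ⟨δ, hδ, c, hc, hQ⟩ := exists_coercive Q h
  obtain ⟨k, C, hC, hb⟩ := norm_gaussianFactor_le Q hP
  refine ((integrable_one_add_pow_mul_exp_neg μ (half_pos hc) k).const_mul
    (C * (1 + ‖t₀‖) ^ k)).mono' (continuous_gaussian Q hP t₀).aestronglyMeasurable
    (Filter.Eventually.of_forall fun x => ?_)
  have h1 := hQ t₀ (Metric.mem_ball_self hδ) x
  have h2 : 1 + ‖(t₀, x)‖ ≤ (1 + ‖t₀‖) * (1 + ‖x‖) := by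
    rw [Prod.norm_mk]
    rcases max_choice ‖t₀‖ ‖x‖ with hm | hm <;> rw [hm] <;>
      nlinarith [norm_nonneg t₀, norm_nonneg x, mul_nonneg (norm_nonneg t₀) (norm_nonneg x)]
  rw [gaussian, norm_mul, Complex.norm_real, Real.norm_of_nonneg (Real.exp_pos _).le]
  calc Real.exp (-(1 / 2) * Q t₀ x x) * ‖P (t₀, x)‖ ≤
        Real.exp (-(c / 2 * ‖x‖ ^ 2)) * (C * ((1 + ‖t₀‖) * (1 + ‖x‖)) ^ k) := by
        gcongr
        · linarith
        · exact (hb _).2.trans (by gcongr)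
    _ = _ := by rw [mul_pow]; ring

/-- Coercivity holds uniformly on a ball around `t₀`, so one majorant, polynomial times
`exp(-c‖x‖²/2)`, dominates all derivatives in `t` there. The derivative along `Y` is again a
Gaussian integral, with the factor `gaussianDer Q P Y`. -/
theorem hasFDerivAt_integral_gaussian (hP : P.HasTemperateGrowth) {t₀ : T}
    (h : ∀ x, x ≠ 0 → 0 < Q t₀ x x) : ∃ L : T →L[ℝ] ℂ,
    HasFDerivAt (fun t => ∫ x, gaussian Q P t x ∂μ) L t₀ ∧
      ∀ Y, L Y = ∫ x, gaussian Q (gaussianDer Q P Y) t₀ x ∂μ := by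
  obtain ⟨δ, hδ, c, hc, hQ⟩ := exists_coercive Q h
  obtain ⟨k, C, hC, hb⟩ := norm_gaussianFactor_le Q hP
  have hbound : ∀ x, ∀ t ∈ Metric.ball t₀ δ,
      ‖(Real.exp (-(1 / 2) * Q t x x) : ℂ) • gaussianFactor Q P (t, x)‖ ≤
        (C * (1 + ‖t₀‖ + δ) ^ k) * ((1 + ‖x‖) ^ k * Real.exp (-(c / 2 * ‖x‖ ^ 2))) := by
    intro x t ht
    have h1 := hQ t ht x
    have ht' : ‖t‖ ≤ ‖t₀‖ + δ := by
      rw [mem_ball_iff_norm] at ht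
      linarith [norm_le_norm_add_norm_sub' t t₀]
    have h2 : 1 + ‖(t, x)‖ ≤ (1 + ‖t₀‖ + δ) * (1 + ‖x‖) := by
      rw [Prod.norm_mk]
      have := norm_nonneg t₀
      rcases max_choice ‖t‖ ‖x‖ with hm | hm <;> rw [hm] <;>
        nlinarith [norm_nonneg t, norm_nonneg x, mul_nonneg (add_nonneg this hδ.le) (norm_nonneg x)]
    rw [norm_smul, Complex.norm_real, Real.norm_of_nonneg (Real.exp_pos _).le]
    calc Real.exp (-(1 / 2) * Q t x x) * ‖gaussianFactor Q P (t, x)‖ ≤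
          Real.exp (-(c / 2 * ‖x‖ ^ 2)) * (C * ((1 + ‖t₀‖ + δ) * (1 + ‖x‖)) ^ k) := by
          gcongr
          · linarith
          · exact (hb _).1.trans (by gcongr)
      _ = _ := by rw [mul_pow]; ring
  have hmeas : AEStronglyMeasurable (fun x =>
      (Real.exp (-(1 / 2) * Q t₀ x x) : ℂ) • gaussianFactor Q P (t₀, x)) μ := by
    refine Continuous.aestronglyMeasurable ?_
    rw [continuous_clm_apply]
    intro Y
    have h1 := (gaussianDer_hasTemperateGrowth Q hP Y).1.continuous
    simp only [smul_apply, gaussianFactor_apply]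
    fun_prop
  have hint := (integrable_one_add_pow_mul_exp_neg μ (half_pos hc) k).const_mul
    (C * (1 + ‖t₀‖ + δ) ^ k)
  refine ⟨_, hasFDerivAt_integral_of_dominated_of_fderiv_le (Metric.ball_mem_nhds t₀ hδ)
    (Filter.Eventually.of_forall fun t => (continuous_gaussian Q hP t).aestronglyMeasurable)
    (integrable_gaussian Q μ hP h) hmeas
    (Filter.Eventually.of_forall fun x t ht => hbound x t ht) hint
    (Filter.Eventually.of_forall fun x t _ => hasFDerivAt_gaussian Q hP t x), fun Y => ?_⟩
  rw [ContinuousLinearMap.integral_apply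
    (hint.mono' hmeas (Filter.Eventually.of_forall fun x =>
      hbound x t₀ (Metric.mem_ball_self hδ))) Y]
  refine integral_congr_ae (Filter.Eventually.of_forall fun x => ?_)
  simp [gaussianFactor_apply, gaussian]

/-- Gaussian integrals are smooth functions of the parameter. -/
theorem contDiffOn_integral_gaussian {Ω : Set T} (hΩ : IsOpen Ω)
    (h : ∀ t ∈ Ω, ∀ x, x ≠ 0 → 0 < Q t x x) (hP : P.HasTemperateGrowth) :
    ContDiffOn ℝ ∞ (fun t => ∫ x, gaussian Q P t x ∂μ) Ω := by
  rw [contDiffOn_infty]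
  intro n
  -- The factor must vary, since each directional derivative is an integral of the same type with
  -- another tempered factor.
  induction n generalizing P with
  | zero =>
    refine contDiffOn_zero.2 fun t ht => ?_
    obtain ⟨L, hL, -⟩ := hasFDerivAt_integral_gaussian Q μ hP (h t ht)
    exact hL.continuousAt.continuousWithinAt
  | succ n ih =>
    push_cast
    rw [contDiffOn_succ_iff_fderiv_of_isOpen hΩ]
    refine ⟨fun t ht => ?_, by simp, ?_⟩
    · obtain ⟨L, hL, -⟩ := hasFDerivAt_integral_gaussian Q μ hP (h t ht)
      exact hL.differentiableAt.differentiableWithinAt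
    · rw [contDiffOn_clm_apply]
      intro Y
      refine (ih (gaussianDer_hasTemperateGrowth Q hP Y)).congr fun t ht => ?_
      obtain ⟨L, hL, hLY⟩ := hasFDerivAt_integral_gaussian Q μ hP (h t ht)
      rw [hL.fderiv, hLY]

end Gaussian

end SuperPfaffian
end

noncomputable section

set_option linter.unusedSectionVars false

namespace SuperPfaffian

variable {V₀ V₁ : Type*} [AddCommGroup V₀] [Module ℝ V₀] [FiniteDimensional ℝ V₀]
  [AddCommGroup V₁] [Module ℝ V₁] [FiniteDimensional ℝ V₁]

/-! ### Superfunctions and their values -/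

/-- The exterior powers above the dimension vanish, so finitely many finite-dimensional graded
pieces remain. -/
instance finiteDimensional_exteriorAlgebra {K M : Type*} [Field K] [AddCommGroup M] [Module K M]
    [FiniteDimensional K M] : FiniteDimensional K (ExteriorAlgebra K M) := by
  have h1 := (DirectSum.Decomposition.isInternal fun i : ℕ => ⋀[K]^i M).submodule_iSup_eq_top
  have h2 : (⨆ i : ℕ, ⋀[K]^i M) ≤ ⨆ i : Fin (finrank K M + 1), ⋀[K]^(i : ℕ) M := by
    refine iSup_le fun i => ?_
    by_cases hi : i < finrank K M + 1
    · exact le_iSup (fun i : Fin (finrank K M + 1) => ⋀[K]^(i : ℕ) M) ⟨i, hi⟩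
    · have h3 : finrank K (⋀[K]^i M) = 0 := by
        rw [exteriorPower.finrank_eq, Nat.choose_eq_zero_of_lt (by omega)]
      rw [Submodule.finrank_eq_zero.1 h3]
      exact bot_le
  rw [h1, top_le_iff] at h2
  exact Module.finite_def.2 (h2 ▸ Submodule.fg_iSup _ fun i => Module.Finite.iff_fg.1 inferInstance)

namespace SuperFun

variable {B : SymplecticForm V₀ V₁}

theorem induction_on {p : SuperFun B → Prop} (F : SuperFun B) (zero : p 0)
    (tmul : ∀ f η, p (.tmul f η)) (add : ∀ F G, p F → p G → p (F + G)) : p F :=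
  TensorProduct.induction_on F zero tmul add

theorem add_tmul (f g : SmoothFun (posCone B)) (η : OddForms B) :
    tmul (f + g) η = tmul f η + tmul g η :=
  TensorProduct.add_tmul f g η

theorem zero_tmul (η : OddForms B) : tmul (0 : SmoothFun (posCone B)) η = 0 :=
  TensorProduct.zero_tmul _ η

theorem tmul_sum {κ : Type*} (s : Finset κ) (f : SmoothFun (posCone B)) (η : κ → OddForms B) :
    tmul f (∑ i ∈ s, η i) = ∑ i ∈ s, tmul f (η i) :=
  TensorProduct.tmul_sum f s η

theorem exists_eq_sum {κ : Type*} [Fintype κ] (b : Basis κ ℂ (OddForms B)) (F : SuperFun B) :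
    ∃ f : κ → SmoothFun (posCone B), F = ∑ i, tmul (f i) (b i) := by
  induction F using induction_on with
  | zero => exact ⟨0, by simp [zero_tmul]⟩
  | tmul f η =>
    refine ⟨fun i => b.repr η i • f, ?_⟩
    conv_lhs => rw [← b.sum_repr η]
    simp only [tmul_sum, tmul_smul, smul_tmul]
  | add F G hF hG =>
    obtain ⟨f, rfl⟩ := hF
    obtain ⟨g, rfl⟩ := hG
    exact ⟨f + g, by simp [add_tmul, Finset.sum_add_distrib]⟩

/-- A superfunction is determined by its values at the generic points. -/
theorem ext_evalAt {F G : SuperFun B}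
    (h : ∀ X ∈ (posCone B).carrier, ∀ ℓ : Dual ℂ (OddForms B), ℓ (evalAt X F) = ℓ (evalAt X G)) :
    F = G := by
  rw [← sub_eq_zero]
  let b := finBasis ℂ (OddForms B)
  obtain ⟨f, hf⟩ := exists_eq_sum b (F - G)
  have h0 : ∀ i, f i = 0 := by
    intro i
    ext X
    by_cases hX : X ∈ (posCone B).carrier
    · have h1 := h X hX (b.coord i)
      rw [← sub_eq_zero, ← map_sub, ← map_sub, hf] at h1
      simpa [evalAt_tmul, Finsupp.single_apply] using h1
    · exact (f i).2.2 X hX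
  rw [hf]
  simp [h0, zero_tmul]

/-- A function with smooth coefficients is the family of values of a superfunction. -/
theorem exists_evalAt_eq (Φ : SpoEven B → OddForms B)
    (h : ∀ ℓ : Dual ℂ (OddForms B), ContDiffOn ℝ ∞ (fun t => ℓ (Φ (coords (SpoEven B) t)))
      (coords (SpoEven B) ⁻¹' (posCone B).carrier)) :
    ∃ F : SuperFun B, ∀ X ∈ (posCone B).carrier, evalAt X F = Φ X := by
  classical
  let b := finBasis ℂ (OddForms B)
  let f : Fin (finrank ℂ (OddForms B)) → SmoothFun (posCone B) := fun i =>
    ⟨fun X => if X ∈ (posCone B).carrier then b.coord i (Φ X) else 0,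
      (h (b.coord i)).congr fun t ht => if_pos ht, fun X hX => if_neg hX⟩
  refine ⟨∑ i, tmul (f i) (b i), fun X hX => ?_⟩
  rw [map_sum]
  conv_rhs => rw [← b.sum_repr (Φ X)]
  refine Finset.sum_congr rfl fun i _ => ?_
  rw [evalAt_tmul]
  simp only [f, if_pos hX, Basis.coord_apply]

theorem evalAt_partialOdd (X : SpoEven B) (Y : SpoOdd B) (F : SuperFun B) :
    evalAt X (partialOdd B Y F) = antiderivation (-evalDual Y) (evalAt X F) := by
  induction F using induction_on with
  | zero => simp
  | tmul f η =>
    rw [evalAt_tmul, map_smul]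
    rfl
  | add F G hF hG => simp only [map_add, hF, hG]

/-- Links the algebraic operator `partialEven` with Fréchet derivatives of the scalar functions
obtained by evaluation and a linear form. -/
theorem hasFDerivAt_evalAt (F : SuperFun B) (ℓ : Dual ℂ (OddForms B))
    {x : Fin (finrank ℝ (SpoEven B)) → ℝ} (hx : coords (SpoEven B) x ∈ (posCone B).carrier) :
    ∃ L : (Fin (finrank ℝ (SpoEven B)) → ℝ) →L[ℝ] ℂ,
      HasFDerivAt (fun t => ℓ (evalAt (coords (SpoEven B) t) F)) L x ∧
      ∀ Y, L ((coords (SpoEven B)).symm Y) =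
        ℓ (evalAt (coords (SpoEven B) x) (partialEven B Y F)) := by
  induction F using induction_on with
  | zero => exact ⟨0, by simpa using hasFDerivAt_const (0 : ℂ) x, by simp⟩
  | tmul f η =>
    have h1 := ((SmoothFun.contDiffAt f hx).differentiableAt (by simp)).hasFDerivAt
    refine ⟨_, (h1.mul_const (ℓ η)).congr_of_eventuallyEq
      (Filter.Eventually.of_forall fun t => ?_), fun Y => ?_⟩
    · simp [evalAt_tmul]
    · change _ = ℓ (evalAt _ (.tmul (dirDeriv Y f) η))
      rw [evalAt_tmul, dirDeriv_apply Y f hx]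
      simp [mul_comm]
  | add F G hF hG =>
    obtain ⟨L, hL, hL'⟩ := hF
    obtain ⟨M, hM, hM'⟩ := hG
    refine ⟨L + M, ?_, fun Y => ?_⟩
    · simp only [map_add]
      exact hL.add hM
    · simp [hL', hM']

end SuperFun

end SuperPfaffian
end

noncomputable section

set_option linter.unusedSectionVars false
set_option maxSynthPendingDepth 3

namespace SuperPfaffian

/-! ### Exponentials of nilpotent elements and weak calculus in algebras -/

theorem nilExp_eq_sum {A : Type*} [Ring A] [Algebra ℂ A] {a : A} {d : ℕ} (h : a ^ d = 0) :
    nilExp a = ∑ k ∈ Finset.range d, (k.factorial : ℂ)⁻¹ • a ^ k := by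
  refine finsum_eq_sum_of_support_subset _ fun k hk => ?_
  rw [Finset.coe_range, Set.mem_Iio]
  by_contra! hd
  exact hk (by simp [pow_eq_zero_of_le hd h])

theorem factorial_inv_smul (k : ℕ) {M : Type*} [AddCommGroup M] [Module ℂ M] (x : M) :
    ((k + 1).factorial : ℂ)⁻¹ • ((k + 1 : ℂ) • x) = (k.factorial : ℂ)⁻¹ • x := by
  have h : (k : ℂ) + 1 ≠ 0 := by exact_mod_cast k.succ_ne_zero
  rw [smul_smul, Nat.factorial_succ]
  push_cast
  rw [mul_inv, mul_comm ((k : ℂ) + 1)⁻¹, mul_assoc, inv_mul_cancel₀ h, mul_one]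

section Weak

variable {A : Type*} [Ring A] [Algebra ℂ A] [FiniteDimensional ℂ A]

/-- Writes a linear form of a product as a polynomial in the coordinates of the factors, so that
product rules in the algebra reduce to the scalar ones without a norm on it. -/
theorem dual_mul_eq_sum (ℓ : Dual ℂ A) (a b : A) :
    ℓ (a * b) = ∑ i, ∑ j, (finBasis ℂ A).coord i a * (finBasis ℂ A).coord j b *
      ℓ (finBasis ℂ A i * finBasis ℂ A j) := by
  conv_lhs => rw [← (finBasis ℂ A).sum_repr a, ← (finBasis ℂ A).sum_repr b, Finset.sum_mul_sum]
  simp only [map_sum, smul_mul_smul_comm, map_smul, smul_eq_mul, Basis.coord_apply]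

/-- Derivatives of curves in a finite dimensional algebra, computed after composition with
linear forms. -/
def HasWeakDerivAt (g : ℝ → A) (g' : A) (s : ℝ) : Prop :=
  ∀ ℓ : Dual ℂ A, HasDerivAt (fun s => ℓ (g s)) (ℓ g') s

namespace HasWeakDerivAt

variable {g h : ℝ → A} {g' h' : A} {s : ℝ}

theorem const (a : A) (s : ℝ) : HasWeakDerivAt (fun _ => a) 0 s := fun ℓ => by
  simpa using hasDerivAt_const s (ℓ a)

theorem congr_deriv (hg : HasWeakDerivAt g g' s) (e : g' = h') : HasWeakDerivAt g h' s := e ▸ hg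

theorem mul (hg : HasWeakDerivAt g g' s) (hh : HasWeakDerivAt h h' s) :
    HasWeakDerivAt (fun s => g s * h s) (g' * h s + g s * h') s := fun ℓ => by
  rw [map_add, dual_mul_eq_sum ℓ g', dual_mul_eq_sum ℓ (g s),
    funext fun s => dual_mul_eq_sum ℓ (g s) (h s)]
  simp only [← Finset.sum_add_distrib, ← add_mul]
  exact HasDerivAt.fun_sum fun i _ => HasDerivAt.fun_sum fun j _ =>
    ((hg _).mul (hh _)).mul_const _

theorem const_smul (c : ℂ) (hg : HasWeakDerivAt g g' s) :
    HasWeakDerivAt (fun s => c • g s) (c • g') s := fun ℓ => by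
  simpa using (hg ℓ).const_mul c

theorem sum {κ : Type*} {u : Finset κ} {g : κ → ℝ → A} {g' : κ → A}
    (hg : ∀ i ∈ u, HasWeakDerivAt (g i) (g' i) s) :
    HasWeakDerivAt (fun s => ∑ i ∈ u, g i s) (∑ i ∈ u, g' i) s := fun ℓ => by
  simp only [map_sum]
  exact HasDerivAt.fun_sum fun i hi => hg i hi ℓ

theorem pow_succ (hg : HasWeakDerivAt g g' s) (hc : Commute (g s) g') (k : ℕ) :
    HasWeakDerivAt (fun s => g s ^ (k + 1)) ((k + 1 : ℂ) • (g' * g s ^ k)) s := by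
  induction k with
  | zero => simpa using hg
  | succ k ih =>
    have h1 := ih.mul hg
    simp only [← _root_.pow_succ] at h1
    convert h1 using 1
    rw [smul_mul_assoc, mul_assoc, ← _root_.pow_succ, (hc.pow_left (k + 1)).eq]
    push_cast
    module

theorem nilExp (hg : HasWeakDerivAt g g' s) (hc : Commute (g s) g') {d : ℕ}
    (hd : ∀ s, g s ^ d = 0) :
    HasWeakDerivAt (fun s => nilExp (g s)) (g' * nilExp (g s)) s := by
  -- The differentiated exponential is truncated one term later than the one in the derivative,
  -- because the term of index `k + 1` differentiates to `g'` times the term of index `k`.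
  have h1 (s) := nilExp_eq_sum (pow_eq_zero_of_le d.le_succ (hd s))
  rw [funext h1, nilExp_eq_sum (hd s), Finset.mul_sum]
  simp only [Finset.sum_range_succ']
  intro ℓ
  simp only [map_add, pow_zero]
  refine HasDerivAt.add_const _ ?_
  refine HasWeakDerivAt.sum (fun k _ => ?_) ℓ
  rw [mul_smul_comm, ← factorial_inv_smul]
  exact (hg.pow_succ hc k).const_smul _

end HasWeakDerivAt

/-- Functions with temperate growth with values in a finite dimensional algebra. -/
def WeaklyTempered {E : Type*} [NormedAddCommGroup E] [NormedSpace ℝ E] (g : E → A) : Prop :=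
  ∀ ℓ : Dual ℂ A, Function.HasTemperateGrowth fun x => ℓ (g x)

namespace WeaklyTempered

variable {E : Type*} [NormedAddCommGroup E] [NormedSpace ℝ E] {g h : E → A}

theorem const (a : A) : WeaklyTempered fun _ : E => a := fun ℓ => .const (ℓ a)

theorem add (hg : WeaklyTempered g) (hh : WeaklyTempered h) :
    WeaklyTempered fun x => g x + h x := fun ℓ => by
  simp only [map_add]
  exact (hg ℓ).add (hh ℓ)

theorem mul (hg : WeaklyTempered g) (hh : WeaklyTempered h) :
    WeaklyTempered fun x => g x * h x := fun ℓ => by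
  rw [funext fun x => dual_mul_eq_sum ℓ (g x) (h x)]
  exact .sum fun i _ => .sum fun j _ => ((hg _).mul (hh _)).mul (.const _)

theorem const_smul (c : ℂ) (hg : WeaklyTempered g) : WeaklyTempered fun x => c • g x := fun ℓ => by
  simp only [map_smul, smul_eq_mul]
  exact (Function.HasTemperateGrowth.const c).mul (hg ℓ)

theorem sum {κ : Type*} {u : Finset κ} {g : κ → E → A} (hg : ∀ i ∈ u, WeaklyTempered (g i)) :
    WeaklyTempered fun x => ∑ i ∈ u, g i x := fun ℓ => by
  simp only [map_sum]
  exact .sum fun i hi => hg i hi ℓ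

theorem pow (hg : WeaklyTempered g) (k : ℕ) : WeaklyTempered fun x => g x ^ k := by
  induction k with
  | zero => simpa using const 1
  | succ k ih => simpa only [pow_succ] using ih.mul hg

theorem nilExp (hg : WeaklyTempered g) {d : ℕ} (hd : ∀ x, g x ^ d = 0) :
    WeaklyTempered fun x => nilExp (g x) := by
  simp only [nilExp_eq_sum (hd _)]
  exact sum fun k _ => (hg.pow k).const_smul _

theorem smul_const [FiniteDimensional ℝ E] (f : E →ₗ[ℝ] ℝ) (a : A) :
    WeaklyTempered fun x => (f x : ℂ) • a := fun ℓ => by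
  simp only [map_smul, smul_eq_mul]
  exact ((Complex.ofRealCLM.comp (LinearMap.toContinuousLinearMap f)).hasTemperateGrowth).mul
    (.const _)

end WeaklyTempered

end Weak

/-! ### Elements of degree two of an exterior algebra -/

section Exterior

variable {M : Type*} [AddCommGroup M] [Module ℂ M]

theorem ι_mul_ι_mem (a b : M) : ExteriorAlgebra.ι ℂ a * ExteriorAlgebra.ι ℂ b ∈ ⋀[ℂ]^2 M := by
  rw [ExteriorAlgebra.exteriorPower, pow_two]
  exact Submodule.mul_mem_mul (LinearMap.mem_range_self _ _) (LinearMap.mem_range_self _ _)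

theorem degreeTwo_induction {p : ExteriorAlgebra ℂ M → Prop} {N : ExteriorAlgebra ℂ M}
    (hN : N ∈ ⋀[ℂ]^2 M) (h : ∀ a b, p (ExteriorAlgebra.ι ℂ a * ExteriorAlgebra.ι ℂ b))
    (add : ∀ x y, p x → p y → p (x + y)) : p N := by
  rw [ExteriorAlgebra.exteriorPower, pow_two] at hN
  refine Submodule.mul_induction_on hN ?_ add
  rintro _ ⟨a, rfl⟩ _ ⟨b, rfl⟩
  exact h a b

/-- A product of two generators anticommutes twice past any third one, hence is central. -/
theorem degreeTwo_commute {N : ExteriorAlgebra ℂ M} (hN : N ∈ ⋀[ℂ]^2 M)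
    (x : ExteriorAlgebra ℂ M) : Commute N x := by
  refine degreeTwo_induction (p := fun N => Commute N x) hN (fun a b => ?_)
    fun a b ha hb => ha.add_left hb
  · induction x using ExteriorAlgebra.induction with
    | algebraMap r => exact Algebra.commute_algebraMap_right _ _
    | mul x y hx hy => exact hx.mul_right hy
    | add x y hx hy => exact hx.add_right hy
    | ι c =>
      exact SuperSym.anticomm_aux (ExteriorAlgebra.ι_add_mul_swap _ _)
        (ExteriorAlgebra.ι_add_mul_swap _ _)

/-- The power has degree `2(dim M + 1)`, above the top degree. The exponent is not optimal, but it
does not depend on `N`, so the exponential can be truncated uniformly. -/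
theorem degreeTwo_pow_eq_zero [FiniteDimensional ℂ M] {N : ExteriorAlgebra ℂ M}
    (hN : N ∈ ⋀[ℂ]^2 M) : N ^ (finrank ℂ M + 1) = 0 := by
  have h1 : N ^ (finrank ℂ M + 1) ∈ ⋀[ℂ]^(2 * (finrank ℂ M + 1)) M := by
    have := Submodule.pow_mem_pow _ hN (finrank ℂ M + 1)
    rwa [ExteriorAlgebra.exteriorPower, ← pow_mul] at this
  have h2 : finrank ℂ (⋀[ℂ]^(2 * (finrank ℂ M + 1)) M) = 0 := by
    rw [exteriorPower.finrank_eq, Nat.choose_eq_zero_of_lt (by omega)]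
  rwa [Submodule.finrank_eq_zero.1 h2] at h1

theorem antiderivation_ι_mul (d : Dual ℂ M) (a : M) (x : ExteriorAlgebra ℂ M) :
    antiderivation d (ExteriorAlgebra.ι ℂ a * x) =
      d a • x - ExteriorAlgebra.ι ℂ a * antiderivation d x :=
  CliffordAlgebra.contractLeft_ι_mul d a x

theorem antiderivation_ι (d : Dual ℂ M) (a : M) :
    antiderivation d (ExteriorAlgebra.ι ℂ a) = algebraMap ℂ _ (d a) :=
  CliffordAlgebra.contractLeft_ι _ d a

theorem antiderivation_algebraMap (d : Dual ℂ M) (r : ℂ) :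
    antiderivation d (algebraMap ℂ (ExteriorAlgebra ℂ M) r) = 0 :=
  CliffordAlgebra.contractLeft_algebraMap _ d r

theorem antiderivation_degreeTwo_mul (d : Dual ℂ M) {N : ExteriorAlgebra ℂ M} (hN : N ∈ ⋀[ℂ]^2 M)
    (x : ExteriorAlgebra ℂ M) :
    antiderivation d (N * x) = antiderivation d N * x + N * antiderivation d x := by
  refine degreeTwo_induction (p := fun N => antiderivation d (N * x) =
    antiderivation d N * x + N * antiderivation d x) hN (fun a b => ?_) fun a b ha hb => ?_
  · simp only [mul_assoc, antiderivation_ι_mul, antiderivation_ι, sub_mul, mul_sub,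
      smul_mul_assoc, mul_smul_comm, ← Algebra.commutes, ← Algebra.smul_def]
    abel
  · simp only [add_mul, map_add, ha, hb]
    abel

theorem antiderivation_pow_mul (d : Dual ℂ M) {N : ExteriorAlgebra ℂ M} (hN : N ∈ ⋀[ℂ]^2 M)
    (x : ExteriorAlgebra ℂ M) (k : ℕ) :
    antiderivation d (N ^ (k + 1) * x) = (k + 1 : ℂ) • (antiderivation d N * (N ^ k * x)) +
      N ^ (k + 1) * antiderivation d x := by
  induction k with
  | zero => simp [antiderivation_degreeTwo_mul d hN]
  | succ k ih =>
    rw [pow_succ' N (k + 1), mul_assoc, antiderivation_degreeTwo_mul d hN, ih, mul_add,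
      mul_smul_comm, ← mul_assoc N (antiderivation d N), (degreeTwo_commute hN _).eq, mul_assoc,
      ← mul_assoc N (N ^ k), ← pow_succ', ← mul_assoc N (N ^ (k + 1))]
    push_cast
    module

/-- The chain rule for an antiderivation. No signs occur because `N` is even and central. -/
theorem antiderivation_nilExp_mul [FiniteDimensional ℂ M] (d : Dual ℂ M) {N : ExteriorAlgebra ℂ M}
    (hN : N ∈ ⋀[ℂ]^2 M) (x : ExteriorAlgebra ℂ M) :
    antiderivation d (nilExp N * x) =
      antiderivation d N * (nilExp N * x) + nilExp N * antiderivation d x := by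
  have h0 := degreeTwo_pow_eq_zero hN
  -- The exponentials that still contain their constant term after differentiation are truncated one
  -- term later than the one multiplied by `antiderivation d N`, so the sums match after an index
  -- shift.
  conv_lhs => rw [nilExp_eq_sum (pow_eq_zero_of_le (Nat.le_succ _) h0)]
  conv_rhs =>
    enter [2]
    rw [nilExp_eq_sum (pow_eq_zero_of_le (Nat.le_succ _) h0)]
  conv_rhs =>
    enter [1]
    rw [nilExp_eq_sum h0]
  simp only [Finset.sum_range_succ' _ (finrank ℂ M + 1), pow_zero, Nat.factorial_zero,
    Nat.cast_one, inv_one, one_smul, add_mul, one_mul, map_add, Finset.sum_mul, map_sum,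
    smul_mul_assoc, map_smul, antiderivation_pow_mul d hN, smul_add, factorial_inv_smul,
    Finset.sum_add_distrib, Finset.mul_sum, mul_smul_comm]
  abel

/-- Naturality of contractions; applied to the first projection, it moves an odd derivative of the
`spo(V)₁` variables through setting `ξ = 0`. -/
theorem map_antiderivation {M' : Type*} [AddCommGroup M'] [Module ℂ M'] (f : M →ₗ[ℂ] M')
    (d : Dual ℂ M') (x : ExteriorAlgebra ℂ M) :
    ExteriorAlgebra.map f (antiderivation (d ∘ₗ f) x) =
      antiderivation d (ExteriorAlgebra.map f x) := by
  induction x using CliffordAlgebra.left_induction with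
  | algebraMap r =>
    exact (congrArg (ExteriorAlgebra.map f) (antiderivation_algebraMap (d ∘ₗ f) r)).trans
      ((map_zero _).trans ((congrArg _ ((ExteriorAlgebra.map f).commutes r)).trans
        (antiderivation_algebraMap d r)).symm)
  | add x y hx hy => simp only [map_add, hx, hy]
  | ι_mul x m hx =>
    have h1 := antiderivation_ι_mul (d ∘ₗ f) m x
    change ExteriorAlgebra.map f (antiderivation (d ∘ₗ f) (ExteriorAlgebra.ι ℂ m * x)) =
      antiderivation d (ExteriorAlgebra.map f (ExteriorAlgebra.ι ℂ m * x))
    rw [h1, map_mul, ExteriorAlgebra.map_apply_ι, antiderivation_ι_mul, map_sub, map_smul, map_mul,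
      hx, ExteriorAlgebra.map_apply_ι]
    rfl

/-- Contractions anticommute pairwise, so each factor contributes a sign. Applied to the Berezin
integral, this gives `(-1)^n`. -/
theorem antiderivation_list_prod (d : Dual ℂ M) (l : List (Dual ℂ M)) (x : ExteriorAlgebra ℂ M) :
    antiderivation d ((l.map (fun d' => (antiderivation d' : Module.End ℂ _))).prod x) =
      (-1 : ℂ) ^ l.length •
        (l.map (fun d' => (antiderivation d' : Module.End ℂ _))).prod (antiderivation d x) := by
  induction l with
  | nil => simp
  | cons d' l ih =>
    have h (y : ExteriorAlgebra ℂ M) : antiderivation d (antiderivation d' y) =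
        -antiderivation d' (antiderivation d y) := CliffordAlgebra.contractLeft_comm d d' y
    rw [List.map_cons, List.prod_cons, Module.End.mul_apply, Module.End.mul_apply, h, ih, map_smul,
      List.length_cons, pow_succ', mul_smul, neg_one_smul]

end Exterior

end SuperPfaffian
end

noncomputable section

set_option linter.unusedSectionVars false
set_option maxSynthPendingDepth 3

namespace SuperPfaffian

variable {V₀ V₁ : Type*} [AddCommGroup V₀] [Module ℝ V₀] [FiniteDimensional ℝ V₀]
  [AddCommGroup V₁] [Module ℝ V₁] [FiniteDimensional ℝ V₁]

/-! ### The integrand -/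

/-- Elements of `V₁*` as functions of the odd variables. -/
def oddForm (B : SymplecticForm V₀ V₁) : Dual ℝ V₁ →ₗ[ℝ] OddForms₂ B where
  toFun φ := ExteriorAlgebra.ι ℂ (0, complexify φ)
  map_add' φ ψ := by
    rw [← map_add, Prod.mk_add_mk, add_zero]
    simp [complexify, LinearMap.comp_add]
  map_smul' c φ := by
    have h : ((0 : SpoOdd B →ₗ[ℝ] ℂ), complexify (c • φ)) = (c : ℂ) • (0, complexify φ) := by
      rw [Prod.smul_mk, smul_zero]
      congr 1
      ext v
      simp [complexify]
    rw [h, map_smul, RingHom.id_apply, Complex.coe_smul]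

/-- Elements of `V₀*` as constant functions of the odd variables. -/
def evenForm (B : SymplecticForm V₀ V₁) (v₀ : V₀) : Dual ℝ V₀ →ₗ[ℝ] OddForms₂ B where
  toFun φ := (φ v₀ : ℂ) • 1
  map_add' φ ψ := by simp [add_smul]
  map_smul' c φ := by
    rw [LinearMap.smul_apply, smul_eq_mul, Complex.ofReal_mul, mul_smul, Complex.coe_smul]
    rfl

theorem evenForm_commute (B : SymplecticForm V₀ V₁) (v₀ : V₀) (φ : Dual ℝ V₀) (x : OddForms₂ B) :
    Commute (evenForm B v₀ φ) x :=
  (Commute.one_left x).smul_left _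

theorem oddForm_sq (B : SymplecticForm V₀ V₁) (φ : Dual ℝ V₁) : oddForm B φ * oddForm B φ = 0 :=
  ExteriorAlgebra.ι_sq_zero _

/-- The restriction of polynomial superfunctions on `V` to `{v₀} × V₁`. -/
def restrict (B : SymplecticForm V₀ V₁) (v₀ : V₀) : SDual V₀ V₁ →ₐ[ℝ] OddForms₂ B :=
  SuperSym.lift (evenForm B v₀) (oddForm B) (fun φ _ => evenForm_commute B v₀ φ _)
    (oddForm_sq B) (fun φ _ => evenForm_commute B v₀ φ _)

theorem restrict_smul (B : SymplecticForm V₀ V₁) (v₀ : V₀) (a : ℝ) (s : SDual V₀ V₁) :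
    restrict B v₀ (a • s) = (a : ℂ) • restrict B v₀ s :=
  (map_smul (restrict B v₀) a s).trans (Complex.coe_smul _ _).symm

theorem restrict_ι₀ (B : SymplecticForm V₀ V₁) (v₀ : V₀) (φ : Dual ℝ V₀) :
    restrict B v₀ (SuperSym.ι₀ φ) = (φ v₀ : ℂ) • 1 :=
  SuperSym.lift_ι₀ (evenForm B v₀) _ _ _ _ _

theorem restrict_ι₁ (B : SymplecticForm V₀ V₁) (v₀ : V₀) (φ : Dual ℝ V₁) :
    restrict B v₀ (SuperSym.ι₁ φ) = ExteriorAlgebra.ι ℂ (0, complexify φ) :=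
  SuperSym.lift_ι₁ _ (oddForm B) _ _ _ _

theorem restrict_evenCoord (B : SymplecticForm V₀ V₁) (v₀ : V₀) (i) :
    restrict B v₀ (evenCoord i) = ((finBasis ℝ V₀).coord i v₀ : ℂ) • 1 :=
  restrict_ι₀ B v₀ _

theorem restrict_oddCoord (B : SymplecticForm V₀ V₁) (v₀ : V₀) (j) :
    restrict B v₀ (oddCoord j) = vCoord B j :=
  restrict_ι₁ B v₀ _

/-- The part of `nilpotentPart` that depends on `X` only. -/
def nilpotentEven (B : SymplecticForm V₀ V₁) : SpoEven B →ₗ[ℝ] OddForms₂ B where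
  toFun X := ∑ i, ∑ j, (B.odd (finBasis ℝ V₁ i) (X.val (0, finBasis ℝ V₁ j)).2 : ℂ) •
    (vCoord B j * vCoord B i)
  map_add' X Y := by
    simp only [map_add, LinearMap.add_apply, Prod.snd_add, Complex.ofReal_add, add_smul,
      Finset.sum_add_distrib]
  map_smul' a X := by
    simp only [map_smul, LinearMap.smul_apply, Prod.smul_snd, smul_eq_mul, Complex.ofReal_mul,
      mul_smul, Finset.smul_sum, RingHom.id_apply, Complex.coe_smul]

theorem nilpotentEven_apply (B : SymplecticForm V₀ V₁) (X : SpoEven B) :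
    nilpotentEven B X = ∑ i, ∑ j, (B.odd (finBasis ℝ V₁ i) (X.val (0, finBasis ℝ V₁ j)).2 : ℂ) •
      (vCoord B j * vCoord B i) := rfl

/-- The terms containing the odd variables of `spo(V)` do not involve `X`, so the nilpotent part is
affine in `X`. -/
theorem nilpotentPart_add_smul (B : SymplecticForm V₀ V₁) (X Y : SpoEven B) (a : ℝ) (v₀ : V₀) :
    nilpotentPart B (X + a • Y) v₀ = nilpotentPart B X v₀ + (a : ℂ) • nilpotentEven B Y := by
  change nilpotentEven B (X + a • Y) + _ + _ = nilpotentEven B X + _ + _ + _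
  have h (a b c d : OddForms₂ B) : a + b + c + d = a + c + d + b := by abel
  rw [map_add, map_smul, Complex.coe_smul]
  exact h _ _ _ _

theorem even_eq_sum (B : SymplecticForm V₀ V₁) (f : V₀ →ₗ[ℝ] V₀) (v : V₀) :
    B.even v (f v) = ∑ i, ∑ j, B.even (finBasis ℝ V₀ i) (f (finBasis ℝ V₀ j)) *
      ((finBasis ℝ V₀).coord j v * (finBasis ℝ V₀).coord i v) := by
  conv_lhs => rw [← (finBasis ℝ V₀).sum_repr v]
  simp only [map_sum, map_smul, LinearMap.sum_apply, LinearMap.smul_apply, smul_eq_mul,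
    Finset.mul_sum, Basis.coord_apply]
  rw [Finset.sum_comm]
  exact Finset.sum_congr rfl fun i _ => Finset.sum_congr rfl fun j _ => by ring

/-- Splits the moment at `v₀ + v₁` into a nilpotent part, produced by differentiating `nilExp`, and
a scalar part, produced by differentiating the real Gaussian. -/
theorem restrict_momentEven (B : SymplecticForm V₀ V₁) (X : SpoEven B) (v₀ : V₀) :
    restrict B v₀ (momentEven B X) = (-1 / 2 : ℂ) • nilpotentEven B X -
      ((1 / 2 * B.even v₀ (X.val (v₀, 0)).1 : ℝ) : ℂ) • 1 := by
  have h := even_eq_sum B (block₀₀ X.val) v₀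
  simp only [block₀₀_apply] at h
  rw [h, nilpotentEven_apply]
  change restrict B v₀ ((-1 / 2 : ℝ) • _) = _
  rw [restrict_smul, map_add, map_sum, map_sum]
  simp only [map_sum, restrict_smul, map_mul, restrict_evenCoord, restrict_oddCoord,
    smul_mul_smul_comm, mul_one, smul_smul]
  simp only [smul_add, Finset.smul_sum, smul_smul, Complex.ofReal_mul, Complex.ofReal_sum,
    Finset.mul_sum, Finset.sum_smul]
  rw [add_comm, sub_eq_add_neg]
  congr 1
  · push_cast
    rfl
  · rw [← Finset.sum_neg_distrib]
    refine Finset.sum_congr rfl fun i _ => ?_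
    rw [← Finset.sum_neg_distrib]
    refine Finset.sum_congr rfl fun j _ => ?_
    rw [← neg_smul]
    congr 1
    push_cast
    ring

theorem nilpotentPart_mem (B : SymplecticForm V₀ V₁) (X : SpoEven B) (v₀ : V₀) :
    (-1 / 2 : ℂ) • nilpotentPart B X v₀ ∈ ⋀[ℂ]^2 ((SpoOdd B →ₗ[ℝ] ℂ) × (V₁ →ₗ[ℝ] ℂ)) := by
  refine Submodule.smul_mem _ _ (add_mem (add_mem ?_ ?_) ?_) <;>
    exact sum_mem fun i _ => sum_mem fun j _ => Submodule.smul_mem _ _ (ι_mul_ι_mem _ _)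

/-- The contraction of the variables in `spo(V)₁` with `Y`. -/
def oddContraction {B : SymplecticForm V₀ V₁} (Y : SpoOdd B) :
    Dual ℂ ((SpoOdd B →ₗ[ℝ] ℂ) × (V₁ →ₗ[ℝ] ℂ)) :=
  (-evalDual Y) ∘ₗ LinearMap.fst ℂ (SpoOdd B →ₗ[ℝ] ℂ) (V₁ →ₗ[ℝ] ℂ)

theorem oddContraction_snd {B : SymplecticForm V₀ V₁} (Y : SpoOdd B) (ψ : V₁ →ₗ[ℝ] ℂ) :
    oddContraction Y (0, ψ) = 0 := by
  simp [oddContraction]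

theorem oddContraction_spoCoord {B : SymplecticForm V₀ V₁} (Y : SpoOdd B) (k) :
    oddContraction Y (complexify ((finBasis ℝ (SpoOdd B)).coord k), 0) =
      -(((finBasis ℝ (SpoOdd B)).coord k Y : ℝ) : ℂ) := rfl

theorem antiderivation_restrict {B : SymplecticForm V₀ V₁} (Y : SpoOdd B) (v₀ : V₀)
    (s : SDual V₀ V₁) : antiderivation (oddContraction Y) (restrict B v₀ s) = 0 := by
  induction s using SuperSym.left_induction with
  | algebraMap r =>
    rw [AlgHom.commutes]
    exact antiderivation_algebraMap _ (r : ℂ)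
  | add x y hx hy => rw [map_add, map_add, hx, hy, add_zero]
  | mul₀ φ x hx => rw [map_mul, restrict_ι₀, smul_one_mul, map_smul, hx, smul_zero]
  | mul₁ φ x hx =>
    rw [map_mul, restrict_ι₁, antiderivation_ι_mul, hx, oddContraction_snd, zero_smul, mul_zero,
      sub_zero]

theorem sum_coord_smul {W A : Type*} [AddCommGroup W] [Module ℝ W] [FiniteDimensional ℝ W]
    [AddCommGroup A] [Module ℂ A] (f : W →ₗ[ℝ] ℝ) (Y : W) (a : A) :
    ∑ k, ((f (finBasis ℝ W k) : ℝ) : ℂ) • ((((finBasis ℝ W).coord k Y : ℝ) : ℂ) • a) =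
      ((f Y : ℝ) : ℂ) • a := by
  conv_rhs => rw [← (finBasis ℝ W).sum_repr Y]
  simp only [map_sum, map_smul, smul_eq_mul, Complex.ofReal_sum, Complex.ofReal_mul,
    Finset.sum_smul, smul_smul, Basis.coord_apply, mul_comm]

/-- Only the two mixed sums contain the odd coordinates of `spo(V)`. Their opposite orders of
factors, with the convention `∂_Y ψ = -ψ(Y)`, produce the difference of blocks that defines
`momentOdd`. -/
theorem antiderivation_nilpotentPart {B : SymplecticForm V₀ V₁} (Y : SpoOdd B) (X : SpoEven B)
    (v₀ : V₀) : antiderivation (oddContraction Y) ((-1 / 2 : ℂ) • nilpotentPart B X v₀) =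
      restrict B v₀ (momentOdd B Y) := by
  have h1 (i j) : antiderivation (oddContraction Y) (vCoord B j * vCoord B i) = 0 := by
    rw [vCoord, vCoord, antiderivation_ι_mul, antiderivation_ι, oddContraction_snd,
      oddContraction_snd]
    simp
  have h2 (i k) : antiderivation (oddContraction Y) (spoCoord B k * vCoord B i) =
      -((((finBasis ℝ (SpoOdd B)).coord k Y : ℝ) : ℂ) • vCoord B i) := by
    rw [vCoord, spoCoord, antiderivation_ι_mul, antiderivation_ι, oddContraction_snd,
      oddContraction_spoCoord]
    simp
  have h3 (j k) : antiderivation (oddContraction Y) (vCoord B j * spoCoord B k) =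
      (((finBasis ℝ (SpoOdd B)).coord k Y : ℝ) : ℂ) • vCoord B j := by
    rw [vCoord, spoCoord, antiderivation_ι_mul, antiderivation_ι, oddContraction_snd,
      oddContraction_spoCoord, ← Algebra.commutes, ← Algebra.smul_def]
    simp
  let f (j) : SpoOdd B →ₗ[ℝ] ℝ := B.odd (finBasis ℝ V₁ j) ∘ₗ LinearMap.snd ℝ V₀ V₁ ∘ₗ
    LinearMap.applyₗ ((v₀, 0) : V₀ × V₁) ∘ₗ SpoOdd.val
  let g (j) : SpoOdd B →ₗ[ℝ] ℝ := B.even v₀ ∘ₗ LinearMap.fst ℝ V₀ V₁ ∘ₗ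
    LinearMap.applyₗ ((0, finBasis ℝ V₁ j) : V₀ × V₁) ∘ₗ SpoOdd.val
  have hf (j) := sum_coord_smul (f j) Y (vCoord B j)
  have hg (j) := sum_coord_smul (g j) Y (vCoord B j)
  have e1 : antiderivation (oddContraction Y) (nilpotentPart B X v₀) =
      ∑ j, ((g j Y - f j Y : ℝ) : ℂ) • vCoord B j := by
    simp only [nilpotentPart, map_add, map_sum, map_smul, h1, h2, h3, smul_zero, smul_neg,
      Finset.sum_const_zero, zero_add, Complex.ofReal_sub, sub_smul, Finset.sum_sub_distrib,
      Finset.sum_neg_distrib]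
    rw [← sub_eq_neg_add]
    congr 1
    · exact Finset.sum_congr rfl fun j _ => hg j
    · exact Finset.sum_congr rfl fun j _ => hf j
  have e2 : restrict B v₀ (∑ i, evenCoord i * ∑ j,
      (B.even (finBasis ℝ V₀ i) (Y.val (0, finBasis ℝ V₁ j)).1 -
        B.odd (finBasis ℝ V₁ j) (Y.val (finBasis ℝ V₀ i, 0)).2) • oddCoord j) =
      ∑ j, ((g j Y - f j Y : ℝ) : ℂ) • vCoord B j := by
    simp only [map_sum, map_mul, restrict_smul, restrict_evenCoord, restrict_oddCoord,
      smul_one_mul, Finset.smul_sum]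
    rw [Finset.sum_comm]
    refine Finset.sum_congr rfl fun j _ => ?_
    let u : V₀ →ₗ[ℝ] ℝ := B.even.flip (Y.val (0, finBasis ℝ V₁ j)).1 -
      B.odd (finBasis ℝ V₁ j) ∘ₗ block₁₀ Y.val
    refine Eq.trans (Finset.sum_congr rfl fun i _ => ?_) (sum_coord_smul u v₀ (vCoord B j))
    rw [smul_comm]
    rfl
  rw [map_smul, e1, ← e2]
  change _ = restrict B v₀ ((-1 / 2 : ℝ) • _)
  rw [restrict_smul]
  push_cast
  rfl

end SuperPfaffian
end

noncomputable section

set_option linter.unusedSectionVars false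
set_option maxSynthPendingDepth 3

/-! ### The tempered factor of the integrand and its derivatives -/

namespace SuperPfaffian

variable {V₀ V₁ : Type*} [AddCommGroup V₀] [Module ℝ V₀] [FiniteDimensional ℝ V₀]
  [AddCommGroup V₁] [Module ℝ V₁] [FiniteDimensional ℝ V₁]

/-- The polynomial factor of `s exp(-½ B(v, X̂v))` at `v = v₀ + v₁`. -/
def polyFactor (B : SymplecticForm V₀ V₁) (s : SDual V₀ V₁) (X : SpoEven B) (v₀ : V₀) :
    OddForms₂ B :=
  restrict B v₀ s * nilExp ((-1 / 2 : ℂ) • nilpotentPart B X v₀)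

theorem restrict_mul_expMoment (B : SymplecticForm V₀ V₁) (s : SDual V₀ V₁) (X : SpoEven B)
    (v₀ : V₀) : restrict B v₀ s * expMoment B X v₀ =
      (Real.exp (-(1 / 2) * B.even v₀ (X.val (v₀, 0)).1) : ℂ) • polyFactor B s X v₀ :=
  mul_smul_comm _ _ _

section Tempered

variable {E : Type*} [NormedAddCommGroup E] [NormedSpace ℝ E] [FiniteDimensional ℝ E]
  {B : SymplecticForm V₀ V₁} (a : E →ₗ[ℝ] SpoEven B) (e : E →ₗ[ℝ] V₀)

theorem weaklyTempered_restrict (s : SDual V₀ V₁) :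
    WeaklyTempered fun p => restrict B (e p) s := by
  induction s using SuperSym.left_induction with
  | algebraMap r =>
    simp only [AlgHom.commutes]
    exact .const _
  | add x y hx hy => simpa only [map_add] using hx.add hy
  | mul₀ φ x hx =>
    simp only [map_mul, restrict_ι₀]
    exact (WeaklyTempered.smul_const (φ ∘ₗ e) 1).mul hx
  | mul₁ φ x hx =>
    simp only [map_mul, restrict_ι₁]
    exact (WeaklyTempered.const _).mul hx

/-- The coefficients are linear in `X` or in `v₀`, so the truncated exponential is polynomial. -/
theorem weaklyTempered_nilpotentPart :
    WeaklyTempered fun p => (-1 / 2 : ℂ) • nilpotentPart B (a p) (e p) := by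
  refine WeaklyTempered.const_smul _ (.add (.add ?_ ?_) ?_)
  · refine .sum fun i _ => .sum fun j _ => ?_
    exact WeaklyTempered.smul_const (B.odd (finBasis ℝ V₁ i) ∘ₗ LinearMap.snd ℝ V₀ V₁ ∘ₗ
      LinearMap.applyₗ ((0, finBasis ℝ V₁ j) : V₀ × V₁) ∘ₗ SpoEven.val ∘ₗ a) _
  · refine .sum fun i _ => .sum fun k _ => ?_
    exact WeaklyTempered.smul_const (B.odd (finBasis ℝ V₁ i) ∘ₗ
      block₁₀ (finBasis ℝ (SpoOdd B) k).val ∘ₗ e) _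
  · refine .sum fun j _ => .sum fun k _ => ?_
    exact WeaklyTempered.smul_const
      (B.even.flip ((finBasis ℝ (SpoOdd B) k).val (0, finBasis ℝ V₁ j)).1 ∘ₗ e) _

theorem weaklyTempered_polyFactor (s : SDual V₀ V₁) :
    WeaklyTempered fun p => polyFactor B s (a p) (e p) :=
  (weaklyTempered_restrict e s).mul
    ((weaklyTempered_nilpotentPart a e).nilExp fun _ => degreeTwo_pow_eq_zero (nilpotentPart_mem B _ _))

end Tempered

/-- Differentiating this factor yields only the nilpotent half of the moment of `Y`. The scalar half
is added and subtracted: the term `½ B(v₀, Yv₀)` is the one that the real Gaussian cancels. -/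
theorem hasWeakDerivAt_polyFactor (B : SymplecticForm V₀ V₁) (s : SDual V₀ V₁) (X Y : SpoEven B)
    (v₀ : V₀) : HasWeakDerivAt (fun τ : ℝ => polyFactor B s (X + τ • Y) v₀)
      (polyFactor B (momentEven B Y * s) X v₀ +
        ((1 / 2 * B.even v₀ (Y.val (v₀, 0)).1 : ℝ) : ℂ) • polyFactor B s X v₀) 0 := by
  have h1 : HasWeakDerivAt (fun τ : ℝ => (-1 / 2 : ℂ) • nilpotentPart B (X + τ • Y) v₀)
      ((-1 / 2 : ℂ) • nilpotentEven B Y) 0 := by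
    refine HasWeakDerivAt.const_smul _ fun ℓ => ?_
    simp only [nilpotentPart_add_smul, map_add, map_smul, smul_eq_mul]
    simpa using ((hasDerivAt_id (0 : ℝ)).ofReal_comp.mul_const (ℓ (nilpotentEven B Y))).const_add
      (ℓ (nilpotentPart B X v₀))
  have h2 := (HasWeakDerivAt.const (restrict B v₀ s) 0).mul
    (h1.nilExp (degreeTwo_commute (nilpotentPart_mem B _ _) _)
      fun _ => degreeTwo_pow_eq_zero (nilpotentPart_mem B _ _))
  refine h2.congr_deriv ?_
  have h3 : Commute (nilpotentEven B Y) (restrict B v₀ s) := by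
    rw [nilpotentEven_apply]
    exact degreeTwo_commute (sum_mem fun i _ => sum_mem fun j _ =>
      Submodule.smul_mem _ _ (ι_mul_ι_mem _ _)) _
  rw [zero_smul, add_zero, zero_mul, zero_add, polyFactor, polyFactor, map_mul,
    restrict_momentEven, sub_mul, sub_mul, smul_mul_assoc, smul_mul_assoc, smul_mul_assoc,
    smul_mul_assoc, one_mul, smul_mul_assoc, sub_add_cancel, mul_smul_comm, h3.eq, mul_assoc]

/-- Neither `s` nor the real Gaussian contains the odd variables of `spo(V)`, so an odd derivative
falls on the nilpotent exponential alone and brings down the whole moment. -/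
theorem antiderivation_polyFactor {B : SymplecticForm V₀ V₁} (Y : SpoOdd B) (s : SDual V₀ V₁)
    (X : SpoEven B) (v₀ : V₀) : antiderivation (oddContraction Y) (polyFactor B s X v₀) =
      polyFactor B (momentOdd B Y * s) X v₀ := by
  have hN := nilpotentPart_mem B X v₀
  have hE (x) : Commute (nilExp ((-1 / 2 : ℂ) • nilpotentPart B X v₀)) x := by
    rw [nilExp_eq_sum (degreeTwo_pow_eq_zero hN)]
    exact Commute.sum_left _ _ _ fun k _ => ((degreeTwo_commute hN x).pow_left k).smul_left _
  rw [polyFactor, ← (hE _).eq, antiderivation_nilExp_mul _ hN, antiderivation_restrict, mul_zero,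
    add_zero, antiderivation_nilpotentPart, polyFactor, map_mul, (hE _).eq, mul_assoc]

/-! ### The Liouville integral -/

/-- A trilinear map on finite dimensional spaces as a continuous trilinear map. -/
def toContinuousTrilinear {T U : Type*} [NormedAddCommGroup T] [NormedSpace ℝ T]
    [FiniteDimensional ℝ T] [NormedAddCommGroup U] [NormedSpace ℝ U] [FiniteDimensional ℝ U]
    (β : T →ₗ[ℝ] U →ₗ[ℝ] U →ₗ[ℝ] ℝ) : T →L[ℝ] U →L[ℝ] U →L[ℝ] ℝ :=
  LinearMap.toContinuousLinearMap
    { toFun := fun t => LinearMap.toContinuousLinearMap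
        ((LinearMap.toContinuousLinearMap (E := U) (F' := ℝ) (𝕜 := ℝ)).toLinearMap ∘ₗ β t)
      map_add' := fun s t => by ext; simp
      map_smul' := fun c t => by ext; simp }

/-- The quadratic form `B(v, Xv)` on `V₀`. -/
def evenTrilinear (B : SymplecticForm V₀ V₁) : SpoEven B →ₗ[ℝ] V₀ →ₗ[ℝ] V₀ →ₗ[ℝ] ℝ where
  toFun X := (B.even.flip ∘ₗ block₀₀ X.val).flip
  map_add' X Y := by ext; simp
  map_smul' a X := by ext; simp

section Liouville

variable {B : SymplecticForm V₀ V₁} {r n : ℕ} (c : OrientedCoordinates B r n)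

/-- The function `B(v, Xv)` in coordinates. -/
def coordForm : (Fin (finrank ℝ (SpoEven B)) → ℝ) →L[ℝ] (Fin r ⊕ Fin r → ℝ) →L[ℝ]
    (Fin r ⊕ Fin r → ℝ) →L[ℝ] ℝ :=
  toContinuousTrilinear (LinearMap.mk₂ ℝ
    (fun t x => (evenTrilinear B (coords _ t) (c.e.equivFun.symm x)) ∘ₗ
      c.e.equivFun.symm.toLinearMap)
    (fun s t x => by simp only [map_add, LinearMap.add_apply, LinearMap.add_comp])
    (fun a t x => by simp only [map_smul, LinearMap.smul_apply, LinearMap.smul_comp])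
    (fun t x y => by simp only [map_add, LinearMap.add_comp])
    (fun a t x => by simp only [map_smul, LinearMap.smul_comp]))

theorem coordForm_apply (t x y) : coordForm c t x y =
    B.even (c.e.equivFun.symm x) ((coords (SpoEven B) t).val (c.e.equivFun.symm y, 0)).1 := rfl

theorem coordForm_pos {t} (ht : coords (SpoEven B) t ∈ (posCone B).carrier)
    (x : Fin r ⊕ Fin r → ℝ) (hx : x ≠ 0) : 0 < coordForm c t x x :=
  ht _ ((LinearEquiv.map_ne_zero_iff _).2 hx)

/-- The polynomial factor of the integrand in coordinates. -/
def coordFactor (s : SDual V₀ V₁) (ℓ : Dual ℂ (OddForms B))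
    (p : (Fin (finrank ℝ (SpoEven B)) → ℝ) × (Fin r ⊕ Fin r → ℝ)) : ℂ :=
  ℓ (berezin c (polyFactor B s (coords (SpoEven B) p.1) (c.e.equivFun.symm p.2)))

theorem coordFactor_hasTemperateGrowth (s : SDual V₀ V₁) (ℓ : Dual ℂ (OddForms B)) :
    (coordFactor c s ℓ).HasTemperateGrowth := by
  let a : (Fin (finrank ℝ (SpoEven B)) → ℝ) × (Fin r ⊕ Fin r → ℝ) →ₗ[ℝ] SpoEven B :=
    (coords (SpoEven B)).toLinearMap ∘ₗ LinearMap.fst ℝ _ _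
  let e : (Fin (finrank ℝ (SpoEven B)) → ℝ) × (Fin r ⊕ Fin r → ℝ) →ₗ[ℝ] V₀ :=
    c.e.equivFun.symm.toLinearMap ∘ₗ LinearMap.snd ℝ _ _
  have h := weaklyTempered_polyFactor a e s (ℓ ∘ₗ berezin c)
  exact h

theorem berezin_eq_gaussian (s : SDual V₀ V₁) (ℓ : Dual ℂ (OddForms B)) (t)
    (x : Fin r ⊕ Fin r → ℝ) :
    ℓ (berezin c (restrict B (c.e.equivFun.symm x) s *
      expMoment B (coords (SpoEven B) t) (c.e.equivFun.symm x))) =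
      gaussian (coordForm c) (coordFactor c s ℓ) t x := by
  rw [restrict_mul_expMoment, map_smul, map_smul]
  rfl

/-- The term subtracted in `gaussianDer` cancels the scalar term of `hasWeakDerivAt_polyFactor`:
differentiating along `Y` multiplies the integrand by the moment of `Y`. -/
theorem gaussianDer_coordFactor (s : SDual V₀ V₁) (ℓ : Dual ℂ (OddForms B)) (Y : SpoEven B) :
    gaussianDer (coordForm c) (coordFactor c s ℓ) ((coords (SpoEven B)).symm Y) =
      coordFactor c (momentEven B Y * s) ℓ := by
  funext p
  have hd := ((coordFactor_hasTemperateGrowth c s ℓ).1.differentiable (by simp)) p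
  have h1 := hd.hasFDerivAt.hasLineDerivAt ((coords (SpoEven B)).symm Y, 0)
  have h2 := hasWeakDerivAt_polyFactor B s (coords (SpoEven B) p.1) Y (c.e.equivFun.symm p.2)
    (ℓ ∘ₗ berezin c)
  have h3 : HasDerivAt (fun τ : ℝ =>
      coordFactor c s ℓ (p + τ • ((coords (SpoEven B)).symm Y, 0))) _ 0 := h1
  have h4 (τ : ℝ) : coordFactor c s ℓ (p + τ • ((coords (SpoEven B)).symm Y, 0)) =
      (ℓ ∘ₗ berezin c) (polyFactor B s (coords (SpoEven B) p.1 + τ • Y)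
        (c.e.equivFun.symm p.2)) := by
    simp [coordFactor]
  rw [gaussianDer, (h3.congr_deriv rfl).unique ((funext h4) ▸ h2), coordForm_apply]
  simp [coordFactor]

/-- `F` is the function `∫_V d_V(v) s(v) exp(-½ B(v, X̂v))`. -/
def IsLiouvilleIntegral (s : SDual V₀ V₁) (F : SuperFun B) : Prop :=
  ∀ X ∈ (posCone B).carrier, ∀ ℓ : Dual ℂ (OddForms B),
    MeasureTheory.Integrable (fun x : Fin r ⊕ Fin r → ℝ =>
      ℓ (berezin c (restrict B (c.e.equivFun.symm x) s *
        expMoment B X (c.e.equivFun.symm x)))) ∧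
    ℓ (evalAt X F) = ((2 * Real.pi) ^ r : ℂ)⁻¹ *
      ∫ x : Fin r ⊕ Fin r → ℝ, ℓ (berezin c (restrict B (c.e.equivFun.symm x) s *
        expMoment B X (c.e.equivFun.symm x)))

variable {c}

theorem isLiouvilleIntegral_one_iff {F : SuperFun B} :
    IsLiouvilleIntegral c 1 F ↔ IsSuperPfaffian c F := by
  simp only [IsLiouvilleIntegral, IsSuperPfaffian, map_one, one_mul]

/-- Integrability is automatic over the positive cone, so only the values have to be compared. -/
theorem isLiouvilleIntegral_iff {s : SDual V₀ V₁} {F : SuperFun B} :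
    IsLiouvilleIntegral c s F ↔ ∀ t, coords (SpoEven B) t ∈ (posCone B).carrier →
      ∀ ℓ : Dual ℂ (OddForms B), ℓ (evalAt (coords (SpoEven B) t) F) =
        ((2 * Real.pi) ^ r : ℂ)⁻¹ * ∫ x, gaussian (coordForm c) (coordFactor c s ℓ) t x := by
  constructor
  · intro h t ht ℓ
    simpa only [berezin_eq_gaussian] using (h _ ht ℓ).2
  · intro h X hX ℓ
    obtain ⟨t, rfl⟩ := (coords (SpoEven B)).surjective X
    simp only [berezin_eq_gaussian]
    exact ⟨integrable_gaussian _ _ (coordFactor_hasTemperateGrowth c s ℓ) (coordForm_pos c hX),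
      h t hX ℓ⟩

theorem IsLiouvilleIntegral.unique {s : SDual V₀ V₁} {F G : SuperFun B}
    (hF : IsLiouvilleIntegral c s F) (hG : IsLiouvilleIntegral c s G) : F = G :=
  SuperFun.ext_evalAt fun X hX ℓ => (hF X hX ℓ).2.trans (hG X hX ℓ).2.symm

variable (c) in
theorem exists_isLiouvilleIntegral (s : SDual V₀ V₁) :
    ∃ F : SuperFun B, IsLiouvilleIntegral c s F := by
  let b := finBasis ℂ (OddForms B)
  -- The integral is defined coordinate by coordinate in a basis of the exterior algebra; linearity
  -- of the integral then gives the formula for every linear form.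
  let Φ : SpoEven B → OddForms B := fun X => ∑ i, (((2 * Real.pi) ^ r : ℂ)⁻¹ *
    ∫ x, gaussian (coordForm c) (coordFactor c s (b.coord i)) ((coords _).symm X) x) • b i
  have hΦ : ∀ t, coords (SpoEven B) t ∈ (posCone B).carrier → ∀ ℓ : Dual ℂ (OddForms B),
      ℓ (Φ (coords (SpoEven B) t)) =
        ((2 * Real.pi) ^ r : ℂ)⁻¹ * ∫ x, gaussian (coordForm c) (coordFactor c s ℓ) t x := by
    intro t ht ℓ
    have h1 : ∀ x, gaussian (coordForm c) (coordFactor c s ℓ) t x =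
        ∑ i, gaussian (coordForm c) (coordFactor c s (b.coord i)) t x * ℓ (b i) := by
      intro x
      simp only [gaussian, coordFactor, mul_assoc, ← Finset.mul_sum]
      congr 1
      conv_lhs => rw [← b.sum_repr (berezin c _)]
      simp only [map_sum, map_smul, smul_eq_mul, Basis.coord_apply]
    simp only [h1, Φ, map_sum, map_smul, smul_eq_mul, LinearEquiv.symm_apply_apply]
    rw [MeasureTheory.integral_finsetSum _ fun i _ =>
      (integrable_gaussian _ _ (coordFactor_hasTemperateGrowth c s _)
        (coordForm_pos c ht)).mul_const _, Finset.mul_sum]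
    refine Finset.sum_congr rfl fun i _ => ?_
    rw [MeasureTheory.integral_mul_const, mul_assoc]
  obtain ⟨F, hF⟩ := SuperFun.exists_evalAt_eq Φ fun ℓ =>
    (contDiffOn_const.mul (contDiffOn_integral_gaussian (coordForm c) MeasureTheory.volume
      (posCone B).isOpen (fun t ht => coordForm_pos c ht)
      (coordFactor_hasTemperateGrowth c s ℓ))).congr fun t ht => hΦ t ht ℓ
  exact ⟨F, isLiouvilleIntegral_iff.2 fun t ht ℓ => (congrArg ℓ (hF _ ht)).trans (hΦ t ht ℓ)⟩

theorem IsLiouvilleIntegral.partialEven {s : SDual V₀ V₁} {F : SuperFun B}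
    (hF : IsLiouvilleIntegral c s F) (Y : SpoEven B) :
    IsLiouvilleIntegral c (momentEven B Y * s) (partialEven B Y F) := by
  rw [isLiouvilleIntegral_iff] at hF ⊢
  intro t ht ℓ
  obtain ⟨L, hL, hLY⟩ := SuperFun.hasFDerivAt_evalAt F ℓ ht
  obtain ⟨M, hM, hMY⟩ := hasFDerivAt_integral_gaussian (coordForm c) MeasureTheory.volume
    (coordFactor_hasTemperateGrowth c s ℓ) (coordForm_pos c ht)
  -- The cone is open, so the two functions agree near `t` and have the same derivative there.
  have h1 : (fun t => ℓ (evalAt (coords (SpoEven B) t) F)) =ᶠ[nhds t] fun t =>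
      ((2 * Real.pi) ^ r : ℂ)⁻¹ * ∫ x, gaussian (coordForm c) (coordFactor c s ℓ) t x := by
    filter_upwards [(posCone B).isOpen.mem_nhds ht] with t ht using hF t ht ℓ
  have h2 := hL.unique ((hM.const_mul _).congr_of_eventuallyEq h1)
  rw [← hLY, h2, ← gaussianDer_coordFactor, ← hMY]
  rfl

/-- The sole use of the parity of `n`: moving past the `n` derivatives of the Berezin integral costs
`(-1)^n = 1`. -/
theorem antiderivation_berezin (hn : Even n) (Y : SpoOdd B) (x : OddForms₂ B) :
    antiderivation (-evalDual Y) (berezin c x) = berezin c (antiderivation (oddContraction Y) x) := by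
  have h := antiderivation_list_prod (oddContraction Y)
    (List.ofFn fun j => c.ξ.coord j ∘ₗ LinearMap.snd ℂ (SpoOdd B →ₗ[ℝ] ℂ) (V₁ →ₗ[ℝ] ℂ)) x
  rw [List.length_ofFn, hn.neg_one_pow, one_smul, List.map_ofFn] at h
  rw [berezin, LinearMap.comp_apply, LinearMap.comp_apply]
  refine (map_antiderivation (LinearMap.fst ℂ (SpoOdd B →ₗ[ℝ] ℂ) (V₁ →ₗ[ℝ] ℂ))
    (-evalDual Y) _).symm.trans ?_
  exact congrArg (ExteriorAlgebra.map _) h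

theorem IsLiouvilleIntegral.partialOdd (hn : Even n) {s : SDual V₀ V₁} {F : SuperFun B}
    (hF : IsLiouvilleIntegral c s F) (Y : SpoOdd B) :
    IsLiouvilleIntegral c (momentOdd B Y * s) (partialOdd B Y F) := by
  rw [isLiouvilleIntegral_iff] at hF ⊢
  intro t ht ℓ
  have h := hF t ht (ℓ ∘ₗ antiderivation (-evalDual Y))
  have h1 : coordFactor c s (ℓ ∘ₗ antiderivation (-evalDual Y)) =
      coordFactor c (momentOdd B Y * s) ℓ := by
    funext p
    simp only [coordFactor, LinearMap.comp_apply, antiderivation_berezin hn,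
      antiderivation_polyFactor]
  rw [SuperFun.evalAt_partialOdd, ← h1]
  exact h

theorem IsLiouvilleIntegral.add {s s' : SDual V₀ V₁} {F F' : SuperFun B}
    (hF : IsLiouvilleIntegral c s F) (hF' : IsLiouvilleIntegral c s' F') :
    IsLiouvilleIntegral c (s + s') (F + F') := by
  intro X hX ℓ
  obtain ⟨h1, h2⟩ := hF X hX ℓ
  obtain ⟨h3, h4⟩ := hF' X hX ℓ
  simp only [map_add, add_mul]
  refine ⟨h1.add h3, ?_⟩
  rw [MeasureTheory.integral_add h1 h3, h2, h4, mul_add]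

theorem IsLiouvilleIntegral.smul {s : SDual V₀ V₁} {F : SuperFun B}
    (hF : IsLiouvilleIntegral c s F) (a : ℝ) :
    IsLiouvilleIntegral c (a • s) ((a : ℂ) • F) := by
  intro X hX ℓ
  obtain ⟨h1, h2⟩ := hF X hX ℓ
  simp only [restrict_smul, smul_mul_assoc, map_smul, smul_eq_mul]
  refine ⟨h1.const_mul _, ?_⟩
  rw [MeasureTheory.integral_const_mul, h2, mul_left_comm]

/-- Differential operators act on Liouville integrals by multiplying the integrand by moments. -/
theorem IsLiouvilleIntegral.diffOp (hn : Even n) (D : SSpo B) {s : SDual V₀ V₁} {F : SuperFun B}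
    (hF : IsLiouvilleIntegral c s F) :
    IsLiouvilleIntegral c (moment B D * s) (diffOp B D F) := by
  -- For a product, the second factor has already changed both the integrand and the superfunction
  -- before the first acts.
  induction D using SuperSym.gen_induction generalizing s F with
  | algebraMap a =>
    rw [AlgHom.commutes, AlgHom.commutes, ← Algebra.smul_def]
    exact hF.smul a
  | add x y hx hy =>
    rw [map_add, map_add, add_mul]
    exact (hx hF).add (hy hF)
  | mul x y hx hy =>
    rw [map_mul, map_mul, mul_assoc]
    exact hx (hy hF)
  | gen₀ Y =>
    rw [moment_ι₀, SuperPfaffian.diffOp, SuperSym.lift_ι₀]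
    exact hF.partialEven Y
  | gen₁ Y =>
    rw [moment_ι₁, SuperPfaffian.diffOp, SuperSym.lift_ι₁]
    exact hF.partialOdd hn Y

/-- The superfunction `∂_D F` is the Liouville integral of the zero integrand, as is `0`, and a
superfunction is determined by its values. -/
theorem diffOp_eq_zero_of_moment_eq_zero (hn : Even n) {F : SuperFun B} (hF : IsSuperPfaffian c F)
    {D : SSpo B} (hD : moment B D = 0) : diffOp B D F = 0 := by
  have h := (isLiouvilleIntegral_one_iff.2 hF).diffOp hn D
  rw [hD, zero_mul] at h
  refine h.unique fun X hX ℓ => ?_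
  simp

end Liouville

end SuperPfaffian
end

/-! ### The theorem on the superPfaffian -/

theorem mainTheorem7
    {V₀ V₁ : Type*} [AddCommGroup V₀] [Module ℝ V₀] [FiniteDimensional ℝ V₀]
    [AddCommGroup V₁] [Module ℝ V₁] [FiniteDimensional ℝ V₁]
    (B : SuperPfaffian.SymplecticForm V₀ V₁) {r n : ℕ} (hn : Even n)
    (c : SuperPfaffian.OrientedCoordinates B r n) :
    ∃ Spf : SuperPfaffian.SuperFun B,
      SuperPfaffian.IsSuperPfaffian c Spf ∧
      (∀ F : SuperPfaffian.SuperFun B, SuperPfaffian.IsSuperPfaffian c F → F = Spf) ∧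
      (∀ D : SuperPfaffian.SSpo B, SuperPfaffian.moment B D = 0 →
        SuperPfaffian.diffOp B D Spf = 0) ∧
      (0 < Module.finrank ℝ V₀ →
        ∀ D ∈ ⨆ k : ℕ, ⨆ _ : 0 < k, SuperPfaffian.homogeneousInvariants B k,
          SuperPfaffian.diffOp B D Spf = 0) ∧
      (Module.finrank ℝ V₀ = 0 →
        ∀ k : ℕ, 0 < k → ∀ D ∈ SuperPfaffian.homogeneousInvariants B k,
          (2 * k ≠ Module.finrank ℝ V₁ ∨ SuperPfaffian.IsIsometryInvariant D) →
            SuperPfaffian.diffOp B D Spf = 0) ∧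
      (∀ (N : ℕ) (X X' : Module.Basis (Fin N) ℝ
            (SuperPfaffian.SpoEven B × SuperPfaffian.SpoOdd B)),
        (∀ i j, SuperPfaffian.K B (X i) (X' j) = if i = j then 1 else 0) →
          SuperPfaffian.diffOp B (SuperPfaffian.casimir B X X') Spf = 0) := by
  obtain ⟨Spf, h⟩ := SuperPfaffian.exists_isLiouvilleIntegral c 1
  have hS := SuperPfaffian.isLiouvilleIntegral_one_iff.1 h
  have h1 (D : SuperPfaffian.SSpo B) (hD : SuperPfaffian.moment B D = 0) :
      SuperPfaffian.diffOp B D Spf = 0 :=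
    SuperPfaffian.diffOp_eq_zero_of_moment_eq_zero hn hS hD
  refine ⟨Spf, hS, fun F hF => (SuperPfaffian.isLiouvilleIntegral_one_iff.2 hF).unique h, h1,
    fun h₀ D hD => h1 D ?_, fun h₀ k hk D hD hk' => h1 D ?_, fun N X X' hX => h1 _ ?_⟩
  -- The kernel of `μ̌` is a subspace, so it contains the sum of the spaces of invariants once it
  -- contains each of them.
  · have h2 : ⨆ k : ℕ, ⨆ _ : 0 < k, SuperPfaffian.homogeneousInvariants B k ≤
        LinearMap.ker (SuperPfaffian.moment B).toLinearMap :=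
      iSup_le fun k => iSup_le fun hk D hD =>
        LinearMap.mem_ker.2 (SuperPfaffian.moment_eq_zero_of_even_ne_zero B h₀ hk hD)
    exact LinearMap.mem_ker.1 (h2 hD)
  · exact SuperPfaffian.moment_eq_zero_of_even_eq_zero B h₀ hk hD hk'
  · exact SuperPfaffian.moment_casimir B X X' hX
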